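/- **Parameters.** Let $\varepsilon_1,\dots,\varepsilon_4\in\mathbb C$ with $\sum_a\varepsilon_a=0$, and put $q_a=e^{\varepsilon_a}$, so that $q_1q_2q_3q_4=1$. Assume this is the only multiplicative relation: if $\prod_a q_a^{m_a}=1$ with $m_a\in\mathbb Z$, then $m_1=m_2=m_3=m_4$. Write $\log q_a:=\varepsilon_a$ and $\log(-q_a):=\varepsilon_a+\pi i$. For $S\subseteq\{1,2,3,4\}$ put $q_S=\prod_{a\in S}q_a$ and $\mathbf P_S^{[n]}=\prod_{a\in S}(1-q_a^n)$; write $\mathbf P_4=\mathbf P_{\{1,2,3,4\}}$, and $\bar a,\bar A$ for the complements of $\{a\}$ and of $A$. **Operators.** Let $\mathsf a_n$ ($n\ne0$) satisfy $[\mathsf a_n,\mathsf a_m]=-\frac1n\mathbf P_4^{[n]}\delta_{n+m,0}$, acting on the Fock space $\mathbb C[\mathsf a_{-1},\mathsf a_{-2},\dots]$. The zero modes with $[\partial_{\mathsf t},\mathsf t_0]=[\tilde\partial_{\mathsf t},\tilde{\mathsf t}_0]=1$ (all other brackets zero) act on functions $\mathbb C^2\to\mathbb C[\mathsf a_{-1},\mathsf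 a_{-2},\dots]$: $\mathsf t_0,\tilde{\mathsf t}_0$ multiply by the two coordinates, and $e^{d\partial_{\mathsf t}},e^{d\tilde\partial_{\mathsf t}}$ translate the coordinates by $d$. The vertex operators are - $\mathsf A(x)=e^{\mathsf t_0}\,{:}\exp\sum_{n\ne0}\mathsf a_nx^{-n}{:}$; - $\mathsf S_a(x)=x^{-\mathsf t_0/\log q_a}\,e^{-\tilde\partial_{\mathsf t}/\log q_a}\,{:}\exp\sum_{n\ne0}\frac{\mathsf a_n}{\mathbf P_a^{[-n]}}x^{-n}{:}$; - $\mathsf X_A(x)=e^{\log q_c\log q_d\,\tilde{\mathsf t}_0}\,{:}\exp\sum_{n\ne0}\frac{\mathsf a_n}{\mathbf P_A^{[-n]}}x^{-n}{:}$ for $A=\{a,b\}$, $\bar A=\{c,d\}$; - $\mathsf W_{\bar a}(x)=x^{-\log q_a\tilde{\mathsf t}_0}\,e^{-\log q_a\log(-q_a)\tilde{\mathsf t}_0}\,e^{-\log q_a\,\partial_{\mathsf t}}\,{:}\exp\sum_{n\ne0}\frac{\mathsf a_n}{\mathbf P_{\bar a}^{[-n]}}x^{-n}{:}$. When $x$ is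 replaced by $q_1^{k_1}\cdots q_4^{k_4}x$ inside a complex power, the logarithm of the factor is $\sum_ik_i\varepsilon_i$. **Partition functions.** A partition in the directions $S$ is a finite lower set $\lambda\subset\mathbb N^S$ (with $0\in\mathbb N$): a Young diagram if $|S|=2$, a plane partition if $|S|=3$. Its box $b$ has content $\chi(b)=\prod_{i\in S}q_i^{b_i}$. Put $$\mathscr S_{ab}(y)=\frac{(1-q_ay)(1-q_by)}{(1-y)(1-q_aq_by)},\qquad g_{\bar a}(y)=\frac{(1-q_a^{-1}y)\prod_{i\ne a}(1-q_iy)}{(1-y)\prod_{i\ne a}(1-q_a^{-1}q_i^{-1}y)}.$$ For $A=\{a,b\}$ and a scalar $Q$, $$\mathsf N_A(Q;\lambda)=\prod_{b\in\lambda}(1-q_AQ\chi(b))(1-Q/\chi(b))\prod_{b,b'\in\lambda}\mathscr S_{A}\!\left(Q\chi(b)/\chi(b')\right),$$ and, with $c=\min\bar A$, $$\tilde{\mathcal Z}^{D4}_A[\lambda]=q_c^{-|\lambda|}\frac{\mathsf N_A(q_c;\lambda)}{\mathsf N_A(1;\lambda)},\qquad \tilde{\mathcal Z}^{D6}_{\bar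 a}[\pi]=\prod_{b\in\pi}\frac{1-q_a/\chi(b)}{1-1/\chi(b)}\prod_{b,b'\in\pi}g_{\bar a}\!\left(\chi(b)/\chi(b')\right)^{-1}.$$ In both coefficients, every factor of the form $1-y$ that vanishes (numerator or denominator) is omitted. **$qq$-characters.** With a formal counting parameter $\mathfrak q$, attach to the vertices $a$, edges $A=\{a,b\}$ and facets $\bar a$ of the tetrahedron with vertex set $\{1,2,3,4\}$ the operators $$\mathscr Q_a(x)=\sum_{k\in\mathbb Z}\mathfrak q^k\,\mathsf S_a(q_a^kx),\qquad \mathsf T_A(x)=\sum_{\lambda}\mathfrak q^{|\lambda|}\tilde{\mathcal Z}^{D4}_A[\lambda]\,{:}\mathsf X_A(x)\prod_{b\in\lambda}\mathsf A(\chi(b)x)^{-1}{:}\,,$$ $$\mathsf T_{\bar a}(x)=\sum_{\pi}\mathfrak q^{|\pi|}\tilde{\mathcal Z}^{D6}_{\bar a}[\pi]\,{:}\mathsf W_{\bar a}(x)\prod_{b\in\pi}\mathsf A(\chi(b)x)^{-1}{:}\,,$$ the sums being over Young diagrams in the directions $A$ and over plane partitions in the directions $\bar a$. **Commutation.** For two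 of these operators, $\mathsf T(x)$ and $\mathsf T'(x')$, and for $f(x,x')=C\,x^{\mu}x'^{\nu}$ with $C,\mu,\nu\in\mathbb C$, the identity $$\mathsf T(x)\mathsf T'(x')-f(x,x')\,\mathsf T'(x')\mathsf T(x)=0\qquad(*)$$ means the following. Products of vertex operators are formal distributions (two-sided formal series in $x,x'$, complex exponents allowed, with operator coefficients). For every $N$, the terms contributing to $\mathfrak q^N$, one for each pair of summands of $\mathsf T$ and $\mathsf T'$, add up to zero. Here an infinite family adds up to zero if each member is a remainder plus a finite sum of distributions, each supported at one point $x'=zx$, $z\in\mathbb C$ (annihilated by a power of $x'-zx$, like $\delta(x'/(zx))$), such that only finitely many remainders are nonzero and they sum to zero, and for every $z$ only finitely many of the parts supported at $x'=zx$ are nonzero and they sum to zero. For a finite family this is ordinary vanishing of the sum. **Theorem.** Let $i,j$ be faces (vertices, edges or facets) of the tetrahedron, with associated $qq$-characters $\mathsf T_i,\mathsf T_j$. There is a zero-mode factor $f(x,x')=C\,x^{\mu}x'^{\nu}$ with $C\neq0$ and $\mu,\nu\in\mathbb C$ such that $(*)$ holds for $\mathsf T_i(x)$ and $\mathsf T_j(x')$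 if and only if $i$ and $j$ do not intersect (have no common vertex). Explicitly: 1. $(*)$ holds with $f=1$ for $\mathscr Q_a(x)$ and $\mathscr Q_b(x')$ whenever $a\ne b$; 2. $(*)$ holds with $f=1$ for $\mathsf T_A(x)$ and $\mathscr Q_c(x')$ whenever $c\in\bar A$; 3. $(*)$ holds with $f=1$ for $\mathsf T_{\bar a}(x)$ and $\mathscr Q_a(x')$; 4. $(*)$ holds with $f=-q_A\,x'/x$ for $\mathsf T_A(x)$ and $\mathsf T_{\bar A}(x')$. -/

import Mathlib

noncomputable section

namespace GaugeOrigami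

/-! ### Equivariant parameters

`ε a` are the `Ω`-background parameters, `q a = exp (ε a)`; the logarithm `log (q a)` is `ε a`.
The four directions `1, 2, 3, 4` are the elements of `Fin 4`. -/

/-- `q_a = e^{ε_a}`. -/
def q (ε : Fin 4 → ℂ) (a : Fin 4) : ℂ := Complex.exp (ε a)

/-- The Adams operation `P_S^{[n]} = ∏_{a ∈ S} (1 - q_a ^ n)`. -/
def adamsP (ε : Fin 4 → ℂ) (S : Finset (Fin 4)) (n : ℤ) : ℂ := ∏ a ∈ S, (1 - q ε a ^ n)

/-! ### The Fock space

The oscillators obey `[a_n, a_m] = -(1/n) P_4^{[n]} δ_{n+m,0}`, where `P_4 = ∏_a (1 - q_a)`.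
They act on polynomials in `y_1, y_2, …` (the variable `X k` is `y_{k+1}`): for `n > 0`,
`a_{-n}` is multiplication by `y_n`, and `a_n` is `-(1/n) P_4^{[n]} ∂/∂y_n`.

The zero modes `t_0, t̃_0, ∂_t, ∂̃_t` with `[∂_t, t_0] = [∂̃_t, t̃_0] = 1` act on functions of two
variables `(t, s)`: `t_0` and `t̃_0` are multiplication by `t` and `s`, and the exponentials
`e^{d ∂_t}`, `e^{d ∂̃_t}` are the translations `t ↦ t + d`, `s ↦ s + d`. -/

/-- The oscillator Fock space `ℂ[y_1, y_2, …]`. -/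
abbrev Osc : Type := MvPolynomial ℕ ℂ

/-- The full state space: functions of the zero-mode variables with values in `Osc`. -/
abbrev Fock : Type := ℂ → ℂ → Osc

/-- `exp (∑_{n > 0} κ_{-n} a_{-n} x^n)`, a power series in `x`. -/
def creation (κ : ℤ → ℂ) : PowerSeries Osc :=
  PowerSeries.subst
    (PowerSeries.mk fun n : ℕ =>
      if n = 0 then (0 : Osc) else MvPolynomial.C (κ (-(n : ℤ))) * MvPolynomial.X (n - 1))
    (PowerSeries.exp ℂ)

/-- `exp (∑_{n > 0} κ_n a_n x^{-n})`, the value being a polynomial in `x⁻¹` (the polynomial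
variable). Being the exponential of a derivation with constant coefficients it is the translation
`y_n ↦ y_n - (1/n) P_4^{[n]} κ_n x^{-n}`. -/
def annihilation (ε : Fin 4 → ℂ) (κ : ℤ → ℂ) : Osc →ₐ[ℂ] Polynomial Osc :=
  MvPolynomial.aeval fun k : ℕ =>
    Polynomial.C (MvPolynomial.X k : Osc) +
      Polynomial.C (MvPolynomial.C
        (-(1 / ((k : ℂ) + 1)) * adamsP ε Finset.univ ((k : ℤ) + 1) * κ ((k : ℤ) + 1)) : Osc) *
        Polynomial.X ^ (k + 1)

/-- The coefficient of `x^m` in the normally ordered exponential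
`:exp (∑_{n ≠ 0} κ_n a_n x^{-n}):
  = exp (∑_{n > 0} κ_{-n} a_{-n} x^n) exp (∑_{n > 0} κ_n a_n x^{-n})`. -/
def oscMode (ε : Fin 4 → ℂ) (κ : ℤ → ℂ) (m : ℤ) : Osc →ₗ[ℂ] Osc :=
  (Polynomial.lsum fun j : ℕ =>
    LinearMap.mulLeft ℂ
      (if 0 ≤ m + (j : ℤ) then PowerSeries.coeff (m + (j : ℤ)).toNat (creation κ) else 0)) ∘ₗ
    (annihilation ε κ).toLinearMap

/-- The data of the normally ordered vertex operator
`x^{p t_0 + p' t̃_0} e^{c t_0 + c' t̃_0} e^{d ∂_t + d' ∂̃_t} :exp (∑_{n ≠ 0} κ_n a_n x^{-n}):`. -/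
structure VertexOp where
  κ : ℤ → ℂ
  p : ℂ
  p' : ℂ
  c : ℂ
  c' : ℂ
  d : ℂ
  d' : ℂ

namespace VertexOp

open Classical in
/-- The coefficient of `x^α`, `α ∈ ℂ`, in a vertex operator. (At the point `(t, s)` the operator
`x^{p t_0 + p' t̃_0}` is `x^{p t + p' s}`, so complex exponents occur.) -/
def mode (ε : Fin 4 → ℂ) (V : VertexOp) (α : ℂ) : Module.End ℂ Fock where
  toFun F t s :=
    if h : ∃ m : ℤ, α = V.p * t + V.p' * s + (m : ℂ) then
      Complex.exp (V.c * t + V.c' * s) • oscMode ε V.κ h.choose (F (t + V.d) (s + V.d'))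
    else 0
  map_add' F G := by
    funext t s
    by_cases h : ∃ m : ℤ, α = V.p * t + V.p' * s + (m : ℂ)
    · simp only [Pi.add_apply, dif_pos h, map_add, smul_add]
    · simp only [Pi.add_apply, dif_neg h, add_zero]
  map_smul' r F := by
    funext t s
    by_cases h : ∃ m : ℤ, α = V.p * t + V.p' * s + (m : ℂ)
    · simp only [Pi.smul_apply, dif_pos h, map_smul, RingHom.id_apply]
      exact smul_comm _ _ _
    · simp only [Pi.smul_apply, dif_neg h, RingHom.id_apply, smul_zero]

/-- The vertex operator `V(e^ℓ x)`. -/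
def scale (V : VertexOp) (ℓ : ℂ) : VertexOp where
  κ n := Complex.exp (-(n : ℂ) * ℓ) * V.κ n
  p := V.p
  p' := V.p'
  c := V.c + ℓ * V.p
  c' := V.c' + ℓ * V.p'
  d := V.d
  d' := V.d'

/-- The normally ordered product `:V(x) ∏_{i ∈ s} B(e^{ℓ_i} x)^{-1}:`. -/
def dress {ι : Type} (V B : VertexOp) (s : Finset ι) (ℓ : ι → ℂ) : VertexOp where
  κ n := V.κ n - ∑ i ∈ s, (B.scale (ℓ i)).κ n
  p := V.p - ∑ i ∈ s, (B.scale (ℓ i)).p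
  p' := V.p' - ∑ i ∈ s, (B.scale (ℓ i)).p'
  c := V.c - ∑ i ∈ s, (B.scale (ℓ i)).c
  c' := V.c' - ∑ i ∈ s, (B.scale (ℓ i)).c'
  d := V.d - ∑ i ∈ s, (B.scale (ℓ i)).d
  d' := V.d' - ∑ i ∈ s, (B.scale (ℓ i)).d'

end VertexOp

/-! ### The D-brane vertex operators -/

/-- The root current (D0): `A(x) = e^{t_0} :exp (∑ a_n x^{-n}):`. -/
def opA : VertexOp where
  κ _ := 1
  p := 0
  p' := 0
  c := 1
  c' := 0
  d := 0
  d' := 0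

/-- The screening current (D2): `s_{a,n} = a_n / P_a^{[-n]}`, with zero mode
`x^{-t_0 / log q_a} e^{-∂̃_t / log q_a}`. -/
def opS (ε : Fin 4 → ℂ) (a : Fin 4) : VertexOp where
  κ n := 1 / adamsP ε {a} (-n)
  p := -(1 / ε a)
  p' := 0
  c := 0
  c' := 0
  d := 0
  d' := -(1 / ε a)

/-- The D4 operator on the directions `A = {a, b}`: `x_{A,n} = a_n / P_A^{[-n]}`, with zero mode
`e^{log q_c log q_d t̃_0}`, where `{c, d}` is the complement of `A`. -/
def opX (ε : Fin 4 → ℂ) (a b : Fin 4) : VertexOp where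
  κ n := 1 / adamsP ε {a, b} (-n)
  p := 0
  p' := 0
  c := 0
  c' := ∏ i ∈ ({a, b} : Finset (Fin 4))ᶜ, ε i
  d := 0
  d' := 0

/-- The D6 operator on the directions `ā = {a}ᶜ`: `w_{ā,n} = a_n / P_ā^{[-n]}`, with zero mode
`x^{-log q_a t̃_0} e^{-log q_a log (-q_a) t̃_0} e^{-log q_a ∂_t}`, where
`log (-q_a) = ε_a + π i`. -/
def opW (ε : Fin 4 → ℂ) (a : Fin 4) : VertexOp where
  κ n := 1 / adamsP ε {a}ᶜ (-n)
  p := 0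
  p' := -ε a
  c := 0
  c' := -(ε a * (ε a + Real.pi * Complex.I))
  d := -ε a
  d' := 0

/-! ### Partitions and their `U(1)` partition functions -/

/-- Partitions in the directions `S`: finite lower sets of boxes in `ℕ^S`. For `|S| = 2` these are
Young diagrams, for `|S| = 3` plane partitions. (Box coordinates start at `0`.) -/
def Partition (S : Finset (Fin 4)) : Type :=
  {lam : Finset (S → ℕ) // IsLowerSet (lam : Set (S → ℕ))}

/-- The logarithm of the `q`-content `∏_{a ∈ S} q_a^{b_a}` of a box (with origin at `1`). -/
def logContent (ε : Fin 4 → ℂ) {S : Finset (Fin 4)} (b : S → ℕ) : ℂ := ∑ a : S, (b a : ℂ) * ε a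

/-- The `q`-content of a box (with origin at `1`). -/
def content (ε : Fin 4 → ℂ) {S : Finset (Fin 4)} (b : S → ℕ) : ℂ := Complex.exp (logContent ε b)

/-- The factor `1 - y` of an equivariant index. Vanishing factors occur equally often in numerators
and denominators of the `U(1)` partition functions below, and cancel: they are left out. -/
def fac (y : ℂ) : ℂ := if y = 1 then 1 else 1 - y

/-- `𝒮_{ab}(y) = (1 - q_a y)(1 - q_b y) / ((1 - y)(1 - q_a q_b y))`. -/
def strucS (ε : Fin 4 → ℂ) (a b : Fin 4) (y : ℂ) : ℂ :=
  fac (q ε a * y) * fac (q ε b * y) / (fac y * fac (q ε a * q ε b * y))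

/-- `g_ā(y) = (1 - q_a⁻¹ y) ∏_{i ≠ a} (1 - q_i y) / ((1 - y) ∏_{i ≠ a} (1 - q_a⁻¹ q_i⁻¹ y))`. -/
def strucG (ε : Fin 4 → ℂ) (a : Fin 4) (y : ℂ) : ℂ :=
  (fac ((q ε a)⁻¹ * y) * ∏ i ∈ ({a}ᶜ : Finset (Fin 4)), fac (q ε i * y)) /
    (fac y * ∏ i ∈ ({a}ᶜ : Finset (Fin 4)), fac ((q ε a)⁻¹ * (q ε i)⁻¹ * y))

/-- The Nekrasov factor `N_A(v₁, λ | v₂, λ)`, `A = {a, b}`, as a function of `Q = v₁ / v₂`. -/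
def nekrasov (ε : Fin 4 → ℂ) (a b : Fin 4) (Q : ℂ)
    (lam : Finset (({a, b} : Finset (Fin 4)) → ℕ)) : ℂ :=
  (∏ x ∈ lam, fac (q ε a * q ε b * (Q * content ε x))) *
    (∏ x ∈ lam, fac (Q / content ε x)) *
    ∏ x ∈ lam, ∏ y ∈ lam, strucS ε a b (Q * content ε x / content ε y)

/-- The `U(1)` D4 partition function
`q_c^{-|λ|} N_A(q_c v, λ | v, λ) / N_A(v, λ | v, λ)`, where `A = {a, b}` and `c` is the smallest
direction outside `A`. -/
def ZD4 (ε : Fin 4 → ℂ) (a b : Fin 4) (lam : Finset (({a, b} : Finset (Fin 4)) → ℕ)) : ℂ :=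
  let c : Fin 4 := (({a, b} : Finset (Fin 4))ᶜ).inf id
  (q ε c ^ lam.card)⁻¹ * (nekrasov ε a b (q ε c) lam / nekrasov ε a b 1 lam)

/-- The `U(1)` D6 partition function
`∏_{x ∈ π} (1 - q_a / χ(x)) / (1 - 1 / χ(x)) ∏_{x, y ∈ π} g_ā(χ(x) / χ(y))⁻¹`. -/
def ZD6 (ε : Fin 4 → ℂ) (a : Fin 4)
    (lam : Finset (({a}ᶜ : Finset (Fin 4)) → ℕ)) : ℂ :=
  (∏ x ∈ lam, fac (q ε a / content ε x) / fac (1 / content ε x)) *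
    ∏ x ∈ lam, ∏ y ∈ lam, (strucG ε a (content ε x / content ε y))⁻¹

/-! ### The `qq`-characters -/

/-- The proper faces of the tetrahedron: its vertices `a`, its edges `{a, b}`, and its facets
`ā = {a}ᶜ`. -/
inductive Face where
  | vertex (a : Fin 4)
  | edge (a b : Fin 4) (h : a < b)
  | facet (a : Fin 4)

/-- The set of vertices of a face. -/
def Face.verts : Face → Finset (Fin 4)
  | .vertex a => {a}
  | .edge a b _ => {a, b}
  | .facet a => {a}ᶜ

/-- A formal sum `∑_{i ∈ I} 𝔮^{level i} coeff i • op i (x)` of vertex operators. -/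
structure OpSum where
  I : Type
  level : I → ℤ
  coeff : I → ℂ
  op : I → VertexOp

/-- The `qq`-character of a face:
* D2: the screening charge `∑_{k ∈ ℤ} 𝔮^k S_a(q_a^k x)`;
* D4: `∑_λ 𝔮^{|λ|} Z_A[λ] :X_A(x) ∏_{b ∈ λ} A(χ(b) x)^{-1}:` over Young diagrams;
* D6: `∑_π 𝔮^{|π|} Z_ā[π] :W_ā(x) ∏_{b ∈ π} A(χ(b) x)^{-1}:` over plane partitions. -/
def qqChar (ε : Fin 4 → ℂ) : Face → OpSum
  | .vertex a =>
    { I := ℤ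
      level := fun k => k
      coeff := fun _ => 1
      op := fun k => (opS ε a).scale ((k : ℂ) * ε a) }
  | .edge a b _ =>
    { I := Partition {a, b}
      level := fun lam => (lam.1.card : ℤ)
      coeff := fun lam => ZD4 ε a b lam.1
      op := fun lam => (opX ε a b).dress opA lam.1 (logContent ε) }
  | .facet a =>
    { I := Partition {a}ᶜ
      level := fun lam => (lam.1.card : ℤ)
      coeff := fun lam => ZD6 ε a lam.1
      op := fun lam => (opW ε a).dress opA lam.1 (logContent ε) }

/-! ### Formal distributions and sums of delta functions -/

/-- Operator-valued formal distributions `∑_{α, β ∈ ℂ} G α β x^α x'^β`. -/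
abbrev FormalDist : Type := ℂ → ℂ → Module.End ℂ Fock

/-- Multiplication of a formal distribution by `x' - z x`. -/
def mulLinear (z : ℂ) (G : FormalDist) : FormalDist :=
  fun α β => G α (β - 1) - z • G (α - 1) β

/-- `G` is supported on `x' = z x`: it is annihilated by a power of `x' - z x`. Such are the
multiples of the delta function `δ(x' / (z x)) = ∑_{n ∈ ℤ} (x' / (z x))^n` (and its derivatives). -/
def SupportedAt (z : ℂ) (G : FormalDist) : Prop := ∃ m : ℕ, (mulLinear z)^[m] G = 0

/-- The formal sum of the family `G` exists and vanishes. Each `G i` is a finite sum of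
delta functions `D i z` (supported on `x' = z x`) and of a remainder `R i`; only finitely many
remainders are nonzero and they add up to `0`; and at every `z` only finitely many `D i z` are
nonzero and they add up to `0`. (For a finite family this says `∑ i, G i = 0`. In general it is
summation in the space obtained from the formal distributions by adjoining arbitrary sums of delta
functions with distinct supports.) -/
def SumsToZero {ι : Type} (G : ι → FormalDist) : Prop :=
  ∃ (R : ι → FormalDist) (D : ι → ℂ →₀ FormalDist),
    (∀ i, G i = R i + (D i).sum fun _ g => g) ∧
    (∀ i z, SupportedAt z (D i z)) ∧
    {i | R i ≠ 0}.Finite ∧ ∑ᶠ i, R i = 0 ∧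
    ∀ z, {i | D i z ≠ 0}.Finite ∧ ∑ᶠ i, D i z = 0

/-- The formal distribution
`V(x) V'(x') - f(x, x') V'(x') V(x)` with the zero-mode factor `f(x, x') = C x^μ x'^ν`. -/
def twistedComm (ε : Fin 4 → ℂ) (C μ ν : ℂ) (V V' : VertexOp) : FormalDist :=
  fun α β => V.mode ε α * V'.mode ε β - C • (V'.mode ε (β - ν) * V.mode ε (α - μ))

/-- `T(x) T'(x') - f(x, x') T'(x') T(x) = 0`, with the zero-mode factor `f(x, x') = C x^μ x'^ν`:
for every `N` the coefficient of `𝔮^N` is a formal sum which vanishes. -/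
def CommuteUpTo (ε : Fin 4 → ℂ) (C μ ν : ℂ) (T T' : OpSum) : Prop :=
  ∀ N : ℤ, SumsToZero fun i : {i : T.I × T'.I // T.level i.1 + T'.level i.2 = N} =>
    (T.coeff i.1.1 * T'.coeff i.1.2) • twistedComm ε C μ ν (T.op i.1.1) (T'.op i.1.2)

end GaugeOrigami

end

/-! Every summand of the `qq`-character of a face `A` has oscillator part `κ n = ev (-n) u /
P_A^{[-n]}` for a virtual character `u` in the group ring `ℤ[ℂˣ]`. For a screening current `u` is a
single point; for D4 and D6 it is the boundary character `1 - P_S ∑ χ(b)` of the partition. By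
Wick's theorem (`oscMode_oscMode`) a product `V(x) V'(x')` is the normally ordered product times the
exponential of `-∑ κ_n κ'_{-n} P_4^{[n]} w^n / n`, with `w = x'/x`.

If the faces are disjoint, `P_A P_B` divides `P_4`, so this exponential is a rational function `∏ (1
- v w)^{M v}` with `M = exchangeChar`. The opposite order gives the expansion at `w = ∞` of the same
function, once the zero modes and `f` supply the leading coefficient and the degree (`Exchange`).
The difference of the two expansions is a sum of delta functions at the poles, which are simple
(`jump_eq_sum_poles`, `Exchange.twistedComm_eq`).

The poles correspond to corners of partitions: the coefficients of a boundary character are governed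
by addable and removable boxes (`shapeChar_coeff_pair`, `shapeChar_coeff_triple`). Thus the poles of
all summands are matched in pairs: a box is moved between the two partitions, or is added while the
screening current moves one step back; for two screening currents, both indices shift by one in
opposite directions. At the pole the merged operators of the two partners agree. Their residues are
opposite: the partition functions are themselves indices of characters, the characters of the two
residues differ by antisymmetric terms `K - dual K`, and the index of such a term is just `±
signedDet K` (`index_sub_dual`). Only finitely many summands of a given level have a pole at a given
point, so the sum vanishes in the required sense (`commuteUpTo_of_matching`).

Conversely, let the faces share a vertex `a`. At level `0` the family of products is either infinite
or a single term, so some member has zero remainder and is a finite sum of delta functions. Its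
vacuum expectation value is then a rational series, and so is the contraction; hence `M P_A P_B = ±
q_A (dual u) u' P_4` for some `M` in the group ring. The factor `1 - q_a` occurs at least twice on
the left. Cancelling it once and reducing modulo the powers of `q_a` kills the left side, while the
right side becomes a product of non-zero-divisors (`not_rational_contraction`). -/

noncomputable section

namespace GaugeOrigami

/-! ### Exponentials of power series, characterised by their logarithmic derivative -/

section

open PowerSeries in
/-- `E` has constant coefficient `1` and logarithmic derivative `∑ a i X ^ i`. -/
def IsExp {S : Type*} [CommRing S] (a : ℕ → S) (E : PowerSeries S) : Prop :=
  constantCoeff E = 1 ∧ d⁄dX S E = PowerSeries.mk a * E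

namespace IsExp

open PowerSeries

variable {S T : Type*} [CommRing S] [CommRing T] {a b : ℕ → S} {E E' : PowerSeries S}

lemma coeff_succ (h : IsExp a E) (n : ℕ) :
    coeff (n + 1) E * ((n : S) + 1) = ∑ p ∈ Finset.HasAntidiagonal.antidiagonal n,
      a p.1 * coeff p.2 E := by
  have := congrArg (coeff n) h.2
  rw [coeff_derivative, coeff_mul] at this
  simpa using this

/-- The differential equation is a recursion for the coefficients in which only `n + 1` has to be
inverted. Identities between exponentials thereby reduce to identities between logarithmic
derivatives, which are additive. -/
lemma unique [Algebra ℚ S] (h : IsExp a E) (h' : IsExp a E') : E = E' := by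
  ext n
  induction n using Nat.strong_induction_on with
  | _ n ih =>
    rcases n with _ | n
    · have h1 := h.1
      have h2 := h'.1
      rw [← coeff_zero_eq_constantCoeff_apply] at h1 h2
      rw [h1, h2]
    · have hu : IsUnit ((n : S) + 1) := by
        have : IsUnit (algebraMap ℚ S ((n : ℚ) + 1)) :=
          (IsUnit.mk0 _ (by positivity)).map (algebraMap ℚ S)
        simpa using this
      refine hu.mul_right_cancel ?_
      rw [h.coeff_succ, h'.coeff_succ]
      refine Finset.sum_congr rfl fun p hp => ?_
      rw [ih p.2 (by have := Finset.HasAntidiagonal.mem_antidiagonal.1 hp; omega)]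

lemma mul (h : IsExp a E) (h' : IsExp b E') : IsExp (a + b) (E * E') := by
  refine ⟨by rw [map_mul, h.1, h'.1, mul_one], ?_⟩
  have : PowerSeries.mk (a + b) = PowerSeries.mk a + PowerSeries.mk b := by ext n; simp
  rw [Derivation.leibniz, h.2, h'.2, this]
  simp only [smul_eq_mul]
  ring

lemma one : IsExp (0 : ℕ → S) 1 := by
  refine ⟨map_one _, ?_⟩
  have : PowerSeries.mk (0 : ℕ → S) = 0 := by ext n; simp
  rw [this, zero_mul, derivative_one]

lemma map (h : IsExp a E) (f : S →+* T) : IsExp (fun i => f (a i)) (E.map f) := by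
  constructor
  · rw [← coeff_zero_eq_constantCoeff_apply, coeff_map, coeff_zero_eq_constantCoeff_apply, h.1,
      map_one]
  · ext n
    have := congrArg f (congrArg (coeff n) h.2)
    rw [coeff_derivative, coeff_mul, map_sum] at this
    rw [coeff_derivative, coeff_mul, coeff_map]
    simpa using this

lemma rescale (h : IsExp a E) (z : S) :
    IsExp (fun i => z ^ (i + 1) * a i) (PowerSeries.rescale z E) := by
  constructor
  · rw [← coeff_zero_eq_constantCoeff_apply, coeff_rescale, coeff_zero_eq_constantCoeff_apply, h.1,
      pow_zero, one_mul]
  · ext n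
    have := h.coeff_succ n
    rw [coeff_derivative, coeff_mul, coeff_rescale, mul_assoc, this, Finset.mul_sum]
    refine Finset.sum_congr rfl fun p hp => ?_
    rw [coeff_mk, coeff_rescale, ← Finset.HasAntidiagonal.mem_antidiagonal.1 hp]
    ring

lemma one_sub (u : S) : IsExp (fun i => -u ^ (i + 1)) (1 - PowerSeries.C u * X) := by
  constructor
  · simp
  -- The geometric series telescopes against `1 - u X`.
  · have h : PowerSeries.mk (fun i => -u ^ (i + 1)) * (1 - PowerSeries.C u * X)
        = - PowerSeries.C u := by
      ext n
      rw [mul_sub, mul_one, map_sub, mul_comm (PowerSeries.C u), ← mul_assoc, coeff_mul_C]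
      rcases n with _ | n
      · simp
      · rw [coeff_succ_mul_X]
        simp [pow_succ]
    rw [h]
    simp [Derivation.leibniz]

end IsExp

open PowerSeries in
/-- `exp (∑_{n > 0} b n X ^ n)`. -/
lemma isExp_subst {S : Type*} [CommRing S] [Algebra ℂ S] (b : ℕ → S) :
    IsExp (fun i => ((i : S) + 1) * b (i + 1))
      (PowerSeries.subst (PowerSeries.mk fun n => if n = 0 then 0 else b n)
        (PowerSeries.exp ℂ) : PowerSeries S) := by
  set g : PowerSeries S := PowerSeries.mk fun n => if n = 0 then 0 else b n with hgdef
  have hg0 : constantCoeff g = 0 := by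
    rw [← coeff_zero_eq_constantCoeff_apply, coeff_mk]; simp
  have hg : HasSubst g := HasSubst.of_constantCoeff_zero' hg0
  -- The exponential is taken over `ℂ` but the chain rule is applied over `S`; both exponentials
  -- have the same rational coefficients.
  let _ : Algebra ℚ S := Algebra.compHom S (algebraMap ℚ ℂ)
  have : IsScalarTower ℚ ℂ S := IsScalarTower.of_algebraMap_eq fun _ => rfl
  have e : (PowerSeries.subst g (PowerSeries.exp ℂ) : PowerSeries S)
      = PowerSeries.subst g (PowerSeries.exp S) := by
    ext n
    rw [coeff_subst' hg, coeff_subst' hg]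
    refine finsum_congr fun d => ?_
    rw [coeff_exp, coeff_exp, algebraMap_smul, algebraMap_smul]
  rw [e]
  constructor
  · refine (constantCoeff_subst hg _).trans ?_
    rw [finsum_eq_single _ 0]
    · simp
    · intro n hn
      change _ • constantCoeff (g ^ n) = 0
      rw [map_pow, hg0, zero_pow hn, smul_zero]
  · rw [derivative_subst hg, derivative_exp, mul_comm]
    congr 1
    ext n
    rw [coeff_derivative, coeff_mk, coeff_mk, if_neg (by omega), mul_comm]

end

/-! ### Creation and annihilation parts, and their contraction -/

section

open PowerSeries in
/-- `exp (-∑_{n > 0} h n w ^ n / n)`. -/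
def contraction (h : ℕ → ℂ) : PowerSeries ℂ :=
  PowerSeries.subst (PowerSeries.mk fun n => if n = 0 then 0 else -(1 / (n : ℂ)) * h n)
    (PowerSeries.exp ℂ)

lemma isExp_contraction (h : ℕ → ℂ) : IsExp (fun i => -h (i + 1)) (contraction h) := by
  have := isExp_subst (S := ℂ) (fun n => -(1 / (n : ℂ)) * h n)
  convert this using 2 with i
  · have : (i : ℂ) + 1 ≠ 0 := by exact_mod_cast Nat.succ_ne_zero i
    push_cast
    field_simp
  · rfl

lemma isExp_creation (κ : ℤ → ℂ) :
    IsExp (fun i : ℕ => MvPolynomial.C (((i : ℂ) + 1) * κ (-((i : ℤ) + 1))) * MvPolynomial.X i)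
      (creation κ) := by
  have := isExp_subst (S := Osc) (fun n => MvPolynomial.C (κ (-(n : ℤ))) * MvPolynomial.X (n - 1))
  convert this using 2 with i
  · simp [mul_assoc]
  · rfl

/-- The coefficient of `x ^ k` in the creation part of a vertex operator. -/
def creationCoeff (κ : ℤ → ℂ) (k : ℤ) : Osc :=
  if 0 ≤ k then PowerSeries.coeff k.toNat (creation κ) else 0

lemma creationCoeff_natCast (κ : ℤ → ℂ) (k : ℕ) :
    creationCoeff κ k = PowerSeries.coeff k (creation κ) := by
  simp [creationCoeff]

lemma creationCoeff_of_neg (κ : ℤ → ℂ) {k : ℤ} (h : k < 0) : creationCoeff κ k = 0 := by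
  simp [creationCoeff, not_le.2 h]

/-- The coefficient of `x ^ (-j)` in the annihilation part of a vertex operator. -/
def annihilationCoeff (ε : Fin 4 → ℂ) (κ : ℤ → ℂ) (j : ℕ) : Osc →ₗ[ℂ] Osc :=
  ((Polynomial.lcoeff Osc j).restrictScalars ℂ) ∘ₗ (annihilation ε κ).toLinearMap

lemma annihilationCoeff_apply (ε : Fin 4 → ℂ) (κ : ℤ → ℂ) (j : ℕ) (F : Osc) :
    annihilationCoeff ε κ j F = (annihilation ε κ F).coeff j := rfl

/-- Any bound beyond which the annihilation coefficients vanish may serve as the range, which lets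
several such sums be put over a common range. -/
lemma oscMode_eq_sum (ε : Fin 4 → ℂ) (κ : ℤ → ℂ) (m : ℤ) (F : Osc) (D : ℕ)
    (hD : ∀ j, D ≤ j → annihilationCoeff ε κ j F = 0) :
    oscMode ε κ m F =
      ∑ j ∈ Finset.range D, creationCoeff κ (m + j) * annihilationCoeff ε κ j F := by
  have h1 : oscMode ε κ m F =
      (annihilation ε κ F).sum fun j G => creationCoeff κ (m + j) * G := rfl
  rw [h1, Polynomial.sum_over_range' _ (by simp) (D + ((annihilation ε κ F).natDegree + 1))
    (by omega)]
  rw [Finset.sum_range_add]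
  simp only [← annihilationCoeff_apply]
  rw [add_eq_left]
  refine Finset.sum_eq_zero fun j _ => ?_
  rw [hD _ (by omega), mul_zero]

lemma annihilationCoeff_mul (ε : Fin 4 → ℂ) (κ : ℤ → ℂ) (j : ℕ) (F G : Osc) :
    annihilationCoeff ε κ j (F * G) = ∑ p ∈ Finset.HasAntidiagonal.antidiagonal j,
      annihilationCoeff ε κ p.1 F * annihilationCoeff ε κ p.2 G := by
  simp only [annihilationCoeff_apply, map_mul, Polynomial.coeff_mul]

/-- Annihilation parts take polynomial values, so only finitely many modes act nontrivially on a
given `F`. One bound `D` serves both operators, and the mode sums below become sums over rectangles.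
-/
lemma exists_annihilationCoeff_bound (ε : Fin 4 → ℂ) (κ κ' : ℤ → ℂ) (F : Osc) :
    ∃ D : ℕ, (∀ j, D ≤ j → annihilationCoeff ε κ' j F = 0) ∧
      ∀ i j, D ≤ i → annihilationCoeff ε κ i (annihilationCoeff ε κ' j F) = 0 := by
  set D' := (annihilation ε κ' F).natDegree + 1
  set D := ∑ j ∈ Finset.range D',
    ((annihilation ε κ (annihilationCoeff ε κ' j F)).natDegree + 1) with hD
  have h1 : ∀ j, D' ≤ j → annihilationCoeff ε κ' j F = 0 := fun j hj => by
    rw [annihilationCoeff_apply]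
    exact Polynomial.coeff_eq_zero_of_natDegree_lt (by omega)
  refine ⟨D' + D, fun j hj => h1 j (by omega), fun i j hi => ?_⟩
  by_cases hj : D' ≤ j
  · rw [h1 j hj, map_zero]
  · rw [annihilationCoeff_apply]
    refine Polynomial.coeff_eq_zero_of_natDegree_lt ?_
    have : (annihilation ε κ (annihilationCoeff ε κ' j F)).natDegree + 1 ≤ D := by
      rw [hD]
      exact Finset.single_le_sum
        (f := fun j => (annihilation ε κ (annihilationCoeff ε κ' j F)).natDegree + 1)
        (fun _ _ => Nat.zero_le _) (Finset.mem_range.2 (not_le.1 hj))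
    omega

/-- The two-variable translation `F ↦ ∑ annihilationCoeff κ i (annihilationCoeff κ' j F) X^i Y^j`. -/
def annihilation₂ (ε : Fin 4 → ℂ) (κ κ' : ℤ → ℂ) : Osc →ₐ[ℂ] Polynomial (Polynomial Osc) :=
  (Polynomial.mapAlgHom (annihilation ε κ)).comp (annihilation ε κ')

lemma coeff_coeff_annihilation₂ (ε : Fin 4 → ℂ) (κ κ' : ℤ → ℂ) (i j : ℕ) (F : Osc) :
    ((annihilation₂ ε κ κ' F).coeff j).coeff i =
      annihilationCoeff ε κ i (annihilationCoeff ε κ' j F) := by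
  simp [annihilation₂, annihilationCoeff_apply]

lemma coeff_coeff_swap {R : Type*} [CommRing R] (p : Polynomial (Polynomial R)) (i j : ℕ) :
    ((Polynomial.Bivariate.swap p).coeff i).coeff j = (p.coeff j).coeff i := by
  induction p using Polynomial.induction_on' with
  | add p q hp hq => simp only [map_add, Polynomial.coeff_add, hp, hq]
  | monomial n f =>
    induction f using Polynomial.induction_on' with
    | add p q hp hq => simp only [map_add, Polynomial.coeff_add, hp, hq]
    | monomial m a =>
      rw [Polynomial.Bivariate.swap_monomial_monomial]
      simp only [Polynomial.coeff_monomial]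
      by_cases h1 : m = i <;> by_cases h2 : n = j <;> simp [h1, h2, Polynomial.coeff_monomial]

lemma annihilation_X (ε : Fin 4 → ℂ) (κ : ℤ → ℂ) (k : ℕ) :
    annihilation ε κ (MvPolynomial.X k) = Polynomial.C (MvPolynomial.X k : Osc) +
      Polynomial.C (MvPolynomial.C
        (-(1 / ((k : ℂ) + 1)) * adamsP ε Finset.univ ((k : ℤ) + 1) * κ ((k : ℤ) + 1)) : Osc) *
        Polynomial.X ^ (k + 1) := by
  simp [annihilation]

lemma annihilation_C (ε : Fin 4 → ℂ) (κ : ℤ → ℂ) (r : ℂ) :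
    annihilation ε κ (MvPolynomial.C r) = Polynomial.C (MvPolynomial.C r) :=
  (annihilation ε κ).commutes r

/-- Both annihilation parts are translations of the variables `y_n` by constants, hence commute. The
two-variable translation is compared with its swap on generators. -/
lemma annihilationCoeff_comm (ε : Fin 4 → ℂ) (κ κ' : ℤ → ℂ) (i j : ℕ) (F : Osc) :
    annihilationCoeff ε κ i (annihilationCoeff ε κ' j F) =
      annihilationCoeff ε κ' j (annihilationCoeff ε κ i F) := by
  have h : annihilation₂ ε κ κ' F = Polynomial.Bivariate.swap (annihilation₂ ε κ' κ F) := by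
    induction F using MvPolynomial.induction_on with
    | C r =>
      simp only [annihilation₂, AlgHom.comp_apply, annihilation_C, Polynomial.coe_mapAlgHom,
        Polynomial.map_C, RingHom.coe_coe, Polynomial.Bivariate.swap_C_C]
    | add p q hp hq => rw [map_add, map_add, map_add, hp, hq]
    | mul_X p k hp =>
      rw [map_mul, map_mul, map_mul, hp]
      congr 1
      simp only [annihilation₂, AlgHom.comp_apply, annihilation_X, map_add, map_mul, map_pow,
        Polynomial.coe_mapAlgHom, Polynomial.map_C, Polynomial.map_X,
        RingHom.coe_coe, annihilation_C,
        Polynomial.Bivariate.swap_X, Polynomial.Bivariate.swap_Y, Polynomial.Bivariate.swap_C_C]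
      ring
  rw [← coeff_coeff_annihilation₂, ← coeff_coeff_annihilation₂, h]
  exact coeff_coeff_swap _ _ _

/-- Translations compose by adding the shifts. Substituting `y X` for the second variable puts the
two operators at proportional points. -/
lemma annihilation_add (ε : Fin 4 → ℂ) (κ κ' κ'' : ℤ → ℂ) (y : ℂ)
    (h : ∀ n : ℕ, κ'' (n + 1) = κ (n + 1) + y ^ (n + 1) * κ' (n + 1)) (F : Osc) :
    annihilation ε κ'' F =
      (annihilation₂ ε κ κ' F).eval
        (Polynomial.C (MvPolynomial.C y) * Polynomial.X) := by
  have : annihilation ε κ'' =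
      ((Polynomial.evalRingHom
        (Polynomial.C (MvPolynomial.C y : Osc) * Polynomial.X)).comp
          (annihilation₂ ε κ κ').toRingHom : Osc →+* Polynomial Osc) := by
    refine MvPolynomial.ringHom_ext (fun r => ?_) fun k => ?_
    · simp [annihilation₂]
    · simp only [annihilation₂, AlgHom.toRingHom_eq_coe, RingHom.coe_comp, Function.comp_apply,
        RingHom.coe_coe, AlgHom.comp_apply, annihilation_X, map_add, map_mul, map_pow,
        Polynomial.coe_mapAlgHom, Polynomial.map_C, Polynomial.map_X,
        annihilation_C, Polynomial.coe_evalRingHom,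
        Polynomial.eval_add, Polynomial.eval_mul, Polynomial.eval_C, Polynomial.eval_X,
        Polynomial.eval_pow, h]
      ring
  exact congrArg (fun f : Osc →+* Polynomial Osc => f F) this

lemma annihilationCoeff_add (ε : Fin 4 → ℂ) (κ κ' κ'' : ℤ → ℂ) (y : ℂ)
    (h : ∀ n : ℕ, κ'' (n + 1) = κ (n + 1) + y ^ (n + 1) * κ' (n + 1)) (F : Osc) (j : ℕ) :
    annihilationCoeff ε κ'' j F = ∑ p ∈ Finset.HasAntidiagonal.antidiagonal j,
      y ^ p.2 • annihilationCoeff ε κ p.1 (annihilationCoeff ε κ' p.2 F) := by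
  rw [annihilationCoeff_apply, annihilation_add ε κ κ' κ'' y h, Polynomial.eval_eq_sum,
    Polynomial.sum_over_range' _ (by simp) ((annihilation₂ ε κ κ' F).natDegree + 1 + (j + 1))
      (by omega), Polynomial.finsetSum_coeff,
    ← Finset.Nat.sum_antidiagonal_swap, Finset.Nat.sum_antidiagonal_eq_sum_range_succ_mk]
  have key : ∀ b, ((annihilation₂ ε κ κ' F).coeff b *
      (Polynomial.C (MvPolynomial.C y : Osc) * Polynomial.X) ^ b).coeff j =
      if b ≤ j then y ^ b • annihilationCoeff ε κ (j - b) (annihilationCoeff ε κ' b F) else 0 := by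
    intro b
    rw [mul_pow, ← mul_assoc, Polynomial.coeff_mul_X_pow', ← Polynomial.C_pow,
      Polynomial.coeff_mul_C, coeff_coeff_annihilation₂, ← map_pow, mul_comm,
      MvPolynomial.C_mul']
  simp only [key]
  rw [add_comm, Finset.sum_range_add, add_eq_left.2]
  · refine Finset.sum_congr rfl fun b hb => ?_
    have := Finset.mem_range.1 hb
    rw [if_pos (by omega)]
    rfl
  · refine Finset.sum_eq_zero fun b _ => if_neg (by omega)

/-- The contraction of the annihilation part `κ` with the creation part `κ'`. -/
lemma map_annihilation_creation (ε : Fin 4 → ℂ) (κ κ' : ℤ → ℂ) :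
    (creation κ').map (annihilation ε κ).toRingHom =
      (creation κ').map Polynomial.C *
        PowerSeries.rescale (Polynomial.X : Polynomial Osc)
          ((contraction fun n => κ n * κ' (-n) * adamsP ε Finset.univ n).map
            (algebraMap ℂ (Polynomial Osc))) := by
  have e : algebraMap ℂ (Polynomial Osc) = Polynomial.C.comp MvPolynomial.C := rfl
  have h1 := (isExp_creation κ').map (annihilation ε κ).toRingHom
  have h2 := ((isExp_creation κ').map (Polynomial.C (R := Osc))).mul
    (((isExp_contraction fun n => κ n * κ' (-n) * adamsP ε Finset.univ n).map
      (algebraMap ℂ (Polynomial Osc))).rescale Polynomial.X)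
  -- The translation adds a constant to `X i`, so the logarithmic derivative of the creation series
  -- changes by a scalar series. The factor `1 / (i + 1)` of the commutator cancels the `i + 1`
  -- coming from the derivative.
  have h3 : ∀ i : ℕ, (annihilation ε κ).toRingHom
      (MvPolynomial.C (((i : ℂ) + 1) * κ' (-((i : ℤ) + 1))) * MvPolynomial.X i) =
      Polynomial.C (MvPolynomial.C (((i : ℂ) + 1) * κ' (-((i : ℤ) + 1))) * MvPolynomial.X i) +
      (Polynomial.X : Polynomial Osc) ^ (i + 1) * algebraMap ℂ (Polynomial Osc)
        (-(κ ((i + 1 : ℕ) : ℤ) * κ' (-((i + 1 : ℕ) : ℤ)) *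
          adamsP ε Finset.univ ((i + 1 : ℕ) : ℤ))) := by
    intro i
    have h0 : (i : ℂ) + 1 ≠ 0 := by exact_mod_cast Nat.succ_ne_zero i
    have h4 : ((i : ℂ) + 1) * κ' (-((i : ℤ) + 1)) *
        (-(1 / ((i : ℂ) + 1)) * adamsP ε Finset.univ ((i : ℤ) + 1) * κ ((i : ℤ) + 1)) =
        -(κ ((i : ℤ) + 1) * κ' (-((i : ℤ) + 1)) * adamsP ε Finset.univ ((i : ℤ) + 1)) := by
      field_simp
    rw [AlgHom.toRingHom_eq_coe, RingHom.coe_coe, map_mul, annihilation_C, annihilation_X, mul_add,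
      ← Polynomial.C_mul, ← mul_assoc, ← Polynomial.C_mul, ← MvPolynomial.C_mul, h4, e,
      RingHom.comp_apply, mul_comm (Polynomial.X ^ (i + 1))]
    push_cast
    rfl
  simp only [h3] at h1
  exact h1.unique h2

/-- This is the coefficient of `X ^ j` in `map_annihilation_creation`: absorbing `j` units of degree
from the creation series costs the `j`-th coefficient of the contraction. -/
lemma annihilationCoeff_creationCoeff (ε : Fin 4 → ℂ) (κ κ' : ℤ → ℂ) (j : ℕ) (k : ℤ) :
    annihilationCoeff ε κ j (creationCoeff κ' k) =
      PowerSeries.coeff j (contraction fun n => κ n * κ' (-n) * adamsP ε Finset.univ n) •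
        creationCoeff κ' (k - j) := by
  rcases lt_or_ge k 0 with hk | hk
  · rw [creationCoeff_of_neg _ hk, creationCoeff_of_neg _ (by omega), map_zero, smul_zero]
  lift k to ℕ using hk
  have := congrArg (Polynomial.coeff · j)
    (congrArg (PowerSeries.coeff k) (map_annihilation_creation ε κ κ'))
  simp only [PowerSeries.coeff_map, PowerSeries.coeff_mul, Polynomial.finsetSum_coeff,
    PowerSeries.coeff_rescale, Polynomial.coeff_C_mul] at this
  rw [creationCoeff_natCast, annihilationCoeff_apply]
  refine Eq.trans this ?_
  have e : algebraMap ℂ (Polynomial Osc) = Polynomial.C.comp MvPolynomial.C := rfl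
  simp only [e, RingHom.comp_apply, mul_comm (Polynomial.X ^ _), Polynomial.coeff_C_mul_X_pow]
  rcases le_or_gt j k with hj | hj
  · rw [Finset.sum_eq_single (k - j, j)]
    · rw [if_pos rfl, mul_comm, MvPolynomial.C_mul', ← Nat.cast_sub hj, creationCoeff_natCast]
    · rintro ⟨a, b⟩ hp hne
      rw [Finset.HasAntidiagonal.mem_antidiagonal] at hp
      rw [if_neg, mul_zero]
      rintro rfl
      exact hne (by ext <;> simp at hp ⊢; omega)
    · intro h
      simp at h
      omega
  · rw [creationCoeff_of_neg _ (by omega), smul_zero]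
    refine Finset.sum_eq_zero fun p hp => ?_
    have := Finset.HasAntidiagonal.mem_antidiagonal.1 hp
    rw [if_neg (by omega), mul_zero]

lemma creation_add (κ κ' κ'' : ℤ → ℂ) (z : ℂ)
    (h : ∀ n : ℕ, κ'' (-(n + 1)) = κ (-(n + 1)) + z ^ (n + 1) * κ' (-(n + 1))) :
    creation κ'' = creation κ * PowerSeries.rescale (MvPolynomial.C z) (creation κ') := by
  refine (isExp_creation κ'').unique ?_
  convert (isExp_creation κ).mul ((isExp_creation κ').rescale (MvPolynomial.C z)) using 1
  funext i
  rw [Pi.add_apply, ← map_pow, ← mul_assoc, ← map_mul, ← add_mul, ← map_add, h]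
  congr 2
  ring

end

/-! ### Wick's theorem for the modes of two vertex operators -/

section

lemma sum_antidiagonal_eq_sum_prod {M : Type*} [AddCommMonoid M] (f : ℕ × ℕ → M) (A D : ℕ)
    (hf : ∀ p : ℕ × ℕ, A ≤ p.1 ∨ D ≤ p.2 → f p = 0) :
    ∑ j ∈ Finset.range (A + D), ∑ p ∈ Finset.HasAntidiagonal.antidiagonal j, f p =
      ∑ p ∈ Finset.range A ×ˢ Finset.range D, f p := by
  rw [← Finset.sum_fiberwise_of_maps_to (t := Finset.range (A + D)) (g := fun p : ℕ × ℕ => p.1 + p.2)]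
  · refine Finset.sum_congr rfl fun j _ => ?_
    symm
    refine Finset.sum_subset ?_ ?_
    · intro p hp
      exact Finset.HasAntidiagonal.mem_antidiagonal.2 (Finset.mem_filter.1 hp).2
    · intro p hp hp'
      refine hf p ?_
      by_contra! h
      refine hp' (Finset.mem_filter.2 ⟨?_, Finset.HasAntidiagonal.mem_antidiagonal.1 hp⟩)
      simpa using h
  · intro p hp
    have : p.1 < A ∧ p.2 < D := by simpa using hp
    simp only [Finset.mem_range]
    omega

/-- The coefficient of `x ^ m x' ^ n` in the normally ordered product of two vertex operators,
applied to `F`. -/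
def pairMode (ε : Fin 4 → ℂ) (κ κ' : ℤ → ℂ) (m n : ℤ) (F : Osc) : Osc :=
  ∑ᶠ p : ℕ × ℕ, creationCoeff κ (m + p.1) * creationCoeff κ' (n + p.2) *
    annihilationCoeff ε κ p.1 (annihilationCoeff ε κ' p.2 F)

section Bound

variable {ε : Fin 4 → ℂ} {κ κ' : ℤ → ℂ} {F : Osc} {D : ℕ}

lemma pairMode_eq_sum (hD : ∀ j, D ≤ j → annihilationCoeff ε κ' j F = 0)
    (hD' : ∀ i j, D ≤ i → annihilationCoeff ε κ i (annihilationCoeff ε κ' j F) = 0) (m n : ℤ) :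
    pairMode ε κ κ' m n F = ∑ p ∈ Finset.range D ×ˢ Finset.range D,
      creationCoeff κ (m + p.1) * creationCoeff κ' (n + p.2) *
        annihilationCoeff ε κ p.1 (annihilationCoeff ε κ' p.2 F) := by
  refine finsum_eq_sum_of_support_subset _ fun p hp => ?_
  rw [Function.mem_support] at hp
  simp only [Finset.coe_product, Finset.coe_range, Set.mem_prod, Set.mem_Iio]
  by_contra h
  apply hp
  rcases not_and_or.1 h with h | h
  · rw [hD' _ _ (not_lt.1 h), mul_zero]
  · rw [hD _ (not_lt.1 h), map_zero, mul_zero]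

end Bound

/-- Normal ordering forgets the order of the factors: creation parts are commuting polynomials,
annihilation parts commuting translations. -/
lemma pairMode_comm (ε : Fin 4 → ℂ) (κ κ' : ℤ → ℂ) (m n : ℤ) (F : Osc) :
    pairMode ε κ κ' m n F = pairMode ε κ' κ n m F := by
  unfold pairMode
  rw [← finsum_comp_equiv (Equiv.prodComm ℕ ℕ)]
  refine finsum_congr fun p => ?_
  simp only [Equiv.prodComm_apply, Prod.fst_swap, Prod.snd_swap]
  rw [annihilationCoeff_comm, mul_comm (creationCoeff κ _)]

/-- A very negative `j` kills the first creation factor and a very large one the second. Hence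
two-sided series, such as delta functions, can be paired with `pairMode`. -/
lemma pairMode_support_finite (ε : Fin 4 → ℂ) (κ κ' : ℤ → ℂ) (m n : ℤ) (F : Osc) :
    {j : ℤ | pairMode ε κ κ' (m + j) (n - j) F ≠ 0}.Finite := by
  obtain ⟨D, hD, hD'⟩ := exists_annihilationCoeff_bound ε κ κ' F
  refine (Set.finite_Icc (-(m + D)) (n + D)).subset fun j hj => ?_
  by_contra h
  refine hj ?_
  rw [pairMode_eq_sum hD hD']
  refine Finset.sum_eq_zero fun p hp => ?_
  have hp' : p.1 < D ∧ p.2 < D := by simpa using hp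
  rw [Set.mem_Icc, not_and_or, not_le, not_le] at h
  rcases h with h | h
  · rw [creationCoeff_of_neg κ (by omega), zero_mul, zero_mul]
  · rw [creationCoeff_of_neg κ' (by omega), mul_zero, zero_mul]

/-- The coefficients of a power series, extended by zero to negative exponents. -/
def extCoeff (E : PowerSeries ℂ) (j : ℤ) : ℂ := if 0 ≤ j then PowerSeries.coeff j.toNat E else 0

/-- Wick's theorem for two vertex operators. -/
lemma oscMode_oscMode (ε : Fin 4 → ℂ) (κ κ' : ℤ → ℂ) (m n : ℤ) (F : Osc) :
    oscMode ε κ m (oscMode ε κ' n F) =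
      ∑ᶠ j : ℤ, extCoeff (contraction fun n => κ n * κ' (-n) * adamsP ε Finset.univ n) j •
        pairMode ε κ κ' (m + j) (n - j) F := by
  set E := contraction fun n => κ n * κ' (-n) * adamsP ε Finset.univ n with hE
  obtain ⟨D, hD, hD'⟩ := exists_annihilationCoeff_bound ε κ κ' F
  -- The inner creation coefficients have index at most `n + D`, so contracting `B` or more units
  -- gives zero.
  set B := (n + D + 1).toNat with hB
  have hB' : ∀ a : ℕ, B ≤ a → n + D < a := fun a ha => by omega
  -- Annihilation is multiplicative: `p.1` of its units are contracted with the inner creation part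
  -- and `p.2` act on the state.
  have hl : oscMode ε κ m (oscMode ε κ' n F) = ∑ b ∈ Finset.range D,
      ∑ p ∈ Finset.range B ×ˢ Finset.range D, creationCoeff κ (m + (p.1 + p.2 : ℕ)) *
        (PowerSeries.coeff p.1 E • creationCoeff κ' (n + b - p.1) *
          annihilationCoeff ε κ p.2 (annihilationCoeff ε κ' b F)) := by
    rw [oscMode_eq_sum ε κ' n F D hD, map_sum]
    refine Finset.sum_congr rfl fun b hb => ?_
    have hb' := Finset.mem_range.1 hb
    have hz : ∀ p : ℕ × ℕ, B ≤ p.1 ∨ D ≤ p.2 →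
        PowerSeries.coeff p.1 E • creationCoeff κ' (n + b - p.1) *
          annihilationCoeff ε κ p.2 (annihilationCoeff ε κ' b F) = 0 := by
      rintro p (hp | hp)
      · rw [creationCoeff_of_neg κ' (by have := hB' _ hp; omega), smul_zero, zero_mul]
      · rw [hD' _ _ hp, mul_zero]
    have hmul : ∀ j, annihilationCoeff ε κ j
        (creationCoeff κ' (n + b) * annihilationCoeff ε κ' b F) =
        ∑ p ∈ Finset.HasAntidiagonal.antidiagonal j,
          PowerSeries.coeff p.1 E • creationCoeff κ' (n + b - p.1) *
          annihilationCoeff ε κ p.2 (annihilationCoeff ε κ' b F) := fun j => by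
      rw [annihilationCoeff_mul]
      simp only [annihilationCoeff_creationCoeff, hE]
    rw [oscMode_eq_sum ε κ m _ (B + D), ← sum_antidiagonal_eq_sum_prod _ B D]
    · refine Finset.sum_congr rfl fun j _ => ?_
      rw [hmul, Finset.mul_sum]
      refine Finset.sum_congr rfl fun p hp => ?_
      rw [Finset.HasAntidiagonal.mem_antidiagonal.1 hp]
    · intro p hp
      rw [hz p hp, mul_zero]
    · intro j hj
      rw [hmul]
      refine Finset.sum_eq_zero fun p hp => hz p ?_
      have := Finset.HasAntidiagonal.mem_antidiagonal.1 hp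
      omega
  rw [hl, finsum_eq_sum_of_support_subset (s := (Finset.range B).map Nat.castEmbedding)]
  · rw [Finset.sum_map]
    simp only [Finset.sum_product]
    rw [Finset.sum_comm]
    refine Finset.sum_congr rfl fun a _ => ?_
    rw [pairMode_eq_sum hD hD', Finset.sum_product_right, Finset.smul_sum]
    refine Finset.sum_congr rfl fun b _ => ?_
    rw [Finset.smul_sum]
    refine Finset.sum_congr rfl fun c _ => ?_
    have : extCoeff E ((Nat.castEmbedding (R := ℤ)) a) = PowerSeries.coeff a E := by
      simp [extCoeff]
    rw [this, Nat.castEmbedding_apply, smul_mul_assoc, mul_smul_comm, mul_assoc]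
    congr 3
    · push_cast
      ring_nf
    · congr 2
      ring
  · intro j hj
    rw [Function.mem_support] at hj
    have h0 : 0 ≤ j := by
      by_contra h
      exact hj (by simp [extCoeff, h])
    lift j to ℕ using h0
    simp only [Finset.coe_map, Set.mem_image, Finset.coe_range, Set.mem_Iio,
      Nat.castEmbedding_apply, Nat.cast_inj, exists_eq_right]
    by_contra h
    refine hj ?_
    rw [pairMode_eq_sum hD hD', Finset.sum_eq_zero, smul_zero]
    intro p hp
    have hp' : p.1 < D ∧ p.2 < D := by simpa using hp
    rw [creationCoeff_of_neg κ' (by have := hB' j (not_lt.1 h); omega), mul_zero, zero_mul]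

/-- The opposite order is written over the same `pairMode` terms so that it can be subtracted from
`oscMode_oscMode`. Its coefficients live at `j ≤ 0`: it is an expansion in inverse powers of `x' /
x`. -/
lemma oscMode_oscMode_swap (ε : Fin 4 → ℂ) (κ κ' : ℤ → ℂ) (m n : ℤ) (F : Osc) :
    oscMode ε κ' n (oscMode ε κ m F) =
      ∑ᶠ j : ℤ, extCoeff (contraction fun n => κ' n * κ (-n) * adamsP ε Finset.univ n) (-j) •
        pairMode ε κ κ' (m + j) (n - j) F := by
  rw [oscMode_oscMode, ← finsum_comp_equiv (Equiv.neg ℤ)]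
  refine finsum_congr fun j => ?_
  rw [pairMode_comm, Equiv.neg_apply, sub_neg_eq_add, sub_eq_add_neg n j]

/-- At `x' = z x` the product of the two creation series is a single one by `creation_add`; the
weight `z ^ (-j)` is `z ^ (n - j)`, the power of the second series, up to the constant `z ^ (-n)`.
-/
lemma finsum_creationCoeff (κ κ' κ'' : ℤ → ℂ) {z : ℂ} (hz : z ≠ 0)
    (h : ∀ n : ℕ, κ'' (-(n + 1)) = κ (-(n + 1)) + z ^ (n + 1) * κ' (-(n + 1))) (m n : ℤ) :
    (Function.support fun j : ℤ =>
        z ^ (-j) • (creationCoeff κ (m + j) * creationCoeff κ' (n - j))).Finite ∧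
      ∑ᶠ j : ℤ, z ^ (-j) • (creationCoeff κ (m + j) * creationCoeff κ' (n - j)) =
        z ^ (-n) • creationCoeff κ'' (m + n) := by
  rcases lt_or_ge (m + n) 0 with hk | hk
  · have : ∀ j : ℤ, z ^ (-j) • (creationCoeff κ (m + j) * creationCoeff κ' (n - j)) = 0 := by
      intro j
      rcases lt_or_ge (m + j) 0 with hj | hj
      · rw [creationCoeff_of_neg κ hj, zero_mul, smul_zero]
      · rw [creationCoeff_of_neg κ' (by omega), mul_zero, smul_zero]
    simp only [this, creationCoeff_of_neg κ'' hk]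
    simp
  · obtain ⟨k, hk⟩ := Int.eq_ofNat_of_zero_le hk
    have hs : (Function.support fun j : ℤ =>
        z ^ (-j) • (creationCoeff κ (m + j) * creationCoeff κ' (n - j))) ⊆
        ((Finset.HasAntidiagonal.antidiagonal k).image fun p => n - (p.2 : ℤ) : Finset ℤ) := by
      intro j hj
      rw [Function.mem_support] at hj
      have h1 : 0 ≤ m + j := by
        by_contra h
        exact hj (by rw [creationCoeff_of_neg κ (not_le.1 h), zero_mul, smul_zero])
      have h2 : 0 ≤ n - j := by
        by_contra h
        exact hj (by rw [creationCoeff_of_neg κ' (not_le.1 h), mul_zero, smul_zero])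
      simp only [Finset.coe_image, Set.mem_image, Finset.mem_coe,
        Finset.HasAntidiagonal.mem_antidiagonal]
      exact ⟨((m + j).toNat, (n - j).toNat), by simp only []; omega, by simp only []; omega⟩
    refine ⟨(Finset.finite_toSet _).subset hs, ?_⟩
    rw [finsum_eq_sum_of_support_subset _ hs, Finset.sum_image, hk, creationCoeff_natCast,
      creation_add κ κ' κ'' z h, PowerSeries.coeff_mul, Finset.smul_sum]
    · refine Finset.sum_congr rfl fun p hp => ?_
      have hp' := Finset.HasAntidiagonal.mem_antidiagonal.1 hp
      have e1 : m + (n - (p.2 : ℤ)) = (p.1 : ℕ) := by omega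
      have e2 : n - (n - (p.2 : ℤ)) = (p.2 : ℕ) := by omega
      rw [e1, e2, creationCoeff_natCast, creationCoeff_natCast, PowerSeries.coeff_rescale, ← map_pow,
        MvPolynomial.C_mul', mul_smul_comm, smul_smul, ← zpow_natCast z, ← zpow_add₀ hz]
      congr 2
      ring
    · intro p hp p' hp' e
      have h1 := Finset.HasAntidiagonal.mem_antidiagonal.1 hp
      have h2 := Finset.HasAntidiagonal.mem_antidiagonal.1 hp'
      ext <;> simp only [] at e <;> omega

/-- The normally ordered product at `x' = z x` is a single vertex operator. -/
lemma finsum_pairMode (ε : Fin 4 → ℂ) (κ κ' κ'' : ℤ → ℂ) {z : ℂ} (hz : z ≠ 0)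
    (h : ∀ n ≠ 0, κ'' n = κ n + z ^ (-n) * κ' n) (m n : ℤ) (F : Osc) :
    ∑ᶠ j : ℤ, z ^ (-j) • pairMode ε κ κ' (m + j) (n - j) F =
      z ^ (-n) • oscMode ε κ'' (m + n) F := by
  have h1 : ∀ n : ℕ, κ'' (-(n + 1)) = κ (-(n + 1)) + z ^ (n + 1) * κ' (-(n + 1)) := fun n => by
    rw [h _ (by omega), neg_neg]
    norm_cast
  have h2 : ∀ n : ℕ, κ'' (n + 1) = κ (n + 1) + z⁻¹ ^ (n + 1) * κ' (n + 1) := fun n => by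
    rw [h _ (by omega), zpow_neg, inv_pow]
    norm_cast
  obtain ⟨D, hD, hD'⟩ := exists_annihilationCoeff_bound ε κ κ' F
  -- The annihilation degree of the merged operator splits as `p.1 + p.2` between the two factors,
  -- the second one evaluated at `z⁻¹`.
  have hr : oscMode ε κ'' (m + n) F = ∑ p ∈ Finset.range D ×ˢ Finset.range D,
      creationCoeff κ'' (m + n + (p.1 + p.2 : ℕ)) *
        (z⁻¹ ^ p.2 • annihilationCoeff ε κ p.1 (annihilationCoeff ε κ' p.2 F)) := by
    have hz : ∀ p : ℕ × ℕ, D ≤ p.1 ∨ D ≤ p.2 →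
        annihilationCoeff ε κ p.1 (annihilationCoeff ε κ' p.2 F) = 0 := by
      rintro p (hp | hp)
      · exact hD' _ _ hp
      · rw [hD _ hp, map_zero]
    rw [oscMode_eq_sum ε κ'' _ F (D + D), ← sum_antidiagonal_eq_sum_prod]
    · refine Finset.sum_congr rfl fun j _ => ?_
      rw [annihilationCoeff_add ε κ κ' κ'' _ h2, Finset.mul_sum]
      refine Finset.sum_congr rfl fun p hp => ?_
      rw [Finset.HasAntidiagonal.mem_antidiagonal.1 hp]
    · intro p hp
      rw [hz p hp, smul_zero, mul_zero]
    · intro j hj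
      rw [annihilationCoeff_add ε κ κ' κ'' _ h2]
      refine Finset.sum_eq_zero fun p hp => ?_
      have := Finset.HasAntidiagonal.mem_antidiagonal.1 hp
      rw [hz p (by omega), smul_zero]
  rw [hr, Finset.smul_sum]
  have e1 : ∀ j : ℤ, z ^ (-j) • pairMode ε κ κ' (m + j) (n - j) F =
      ∑ p ∈ Finset.range D ×ˢ Finset.range D,
        (z ^ (-j) • (creationCoeff κ (m + p.1 + j) * creationCoeff κ' (n + p.2 - j))) *
        annihilationCoeff ε κ p.1 (annihilationCoeff ε κ' p.2 F) := fun j => by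
    rw [pairMode_eq_sum hD hD', Finset.smul_sum]
    refine Finset.sum_congr rfl fun p _ => ?_
    rw [smul_mul_assoc, add_right_comm, add_sub_right_comm]
  rw [finsum_congr e1, finsum_sum_comm]
  · refine Finset.sum_congr rfl fun p _ => ?_
    have := finsum_creationCoeff κ κ' κ'' hz h1 (m + p.1) (n + p.2)
    rw [← finsum_mul' _ _ this.1, this.2, smul_mul_assoc, mul_smul_comm, smul_smul, inv_pow,
      ← zpow_natCast z, ← zpow_neg, ← zpow_add₀ hz]
    congr 2
    · ring
    · congr 1
      push_cast
      ring
  · intro p _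
    refine (finsum_creationCoeff κ κ' κ'' hz h1 (m + p.1) (n + p.2)).1.subset ?_
    intro j hj
    rw [Function.mem_support] at hj ⊢
    exact left_ne_zero_of_mul hj

end

/-! ### Virtual characters, indices and partial fractions -/

section

/-- The group ring `ℤ[ℂˣ]` of virtual characters. -/
abbrev Character : Type := MonoidAlgebra ℤ ℂˣ

namespace Character

/-- The character of a single point. -/
def point (v : ℂˣ) : Character := MonoidAlgebra.single v 1

/-- The character evaluated with the points raised to the power `n`. -/
def ev (n : ℤ) : Character →+* ℂ :=
  (MonoidAlgebra.lift ℤ ℂ ℂˣ ((Units.coeHom ℂ).comp (zpowGroupHom n))).toRingHom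

@[simp] lemma ev_point (n : ℤ) (v : ℂˣ) : ev n (point v) = (v : ℂ) ^ n := by
  simp [ev, point, MonoidAlgebra.lift_single]

lemma point_mul (v w : ℂˣ) : point v * point w = point (v * w) := by
  simp [point, MonoidAlgebra.single_mul_single]

lemma point_one : point 1 = 1 := rfl

lemma point_mul_coeff (v w : ℂˣ) (M : Character) :
    (point v * M).coeff w = M.coeff (v⁻¹ * w) := by
  simp [point]

lemma coeff_point (v w : ℂˣ) : (point v).coeff w = if v = w then 1 else 0 := by
  classical
  simp [point, Finsupp.single_apply]

lemma coeff_one (w : ℂˣ) : (1 : Character).coeff w = if w = 1 then 1 else 0 := by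
  rw [← point_one, coeff_point]
  simp [eq_comm]

/-- The dual character. -/
def dual : Character →+* Character := MonoidAlgebra.mapDomainRingHom ℤ (invMonoidHom : ℂˣ →* ℂˣ)

@[simp] lemma dual_point (v : ℂˣ) : dual (point v) = point v⁻¹ := by
  simp [dual, point]

-- Points generate the group ring additively, so it suffices to control adding and removing a single
-- point. All multiplicative extensions below are handled in this way.
@[elab_as_elim]
lemma induction {P : Character → Prop} (M : Character) (h0 : P 0)
    (hadd : ∀ v M, P M → P (M + point v)) (hsub : ∀ v M, P M → P (M - point v)) : P M := by
  have hz : ∀ (v : ℂˣ) (n : ℤ) (M : Character), P M → P (M + n • point v) := by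
    intro v n M hM
    induction n using Int.induction_on with
    | zero => simpa using hM
    | succ n ih =>
      rw [add_smul, one_smul, ← add_assoc]
      exact hadd _ _ ih
    | pred n ih =>
      rw [sub_smul, one_smul, ← add_sub_assoc]
      exact hsub _ _ ih
  have : ∀ f : ℂˣ →₀ ℤ, P (MonoidAlgebra.ofCoeff f) := by
    intro f
    induction f using Finsupp.induction with
    | zero => exact h0
    | single_add a b f ha hb ih =>
      have e : MonoidAlgebra.ofCoeff (Finsupp.single a b + f) =
          (MonoidAlgebra.ofCoeff f + b • point a : Character) := by
        ext w
        simp [point, Finsupp.single_apply, add_comm]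
      rw [e]
      exact hz _ _ _ ih
  exact this M.coeff

@[simp] lemma dual_dual (M : Character) : dual (dual M) = M := by
  induction M using induction with
  | h0 => simp
  | hadd v M h => simp [h]
  | hsub v M h => simp [h]

lemma ev_dual (n : ℤ) (M : Character) : ev n (dual M) = ev (-n) M := by
  induction M using induction with
  | h0 => simp
  | hadd v M h => simp [h]
  | hsub v M h => simp [h]

lemma coeff_dual (M : Character) (w : ℂˣ) : (dual M).coeff w = M.coeff w⁻¹ := by
  induction M using induction with
  | h0 => simp
  | hadd v M h => simp [h, coeff_point, inv_eq_iff_eq_inv]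
  | hsub v M h => simp [h, coeff_point, inv_eq_iff_eq_inv]

/-- The degree of a character. -/
def deg : Character →+* ℤ := (MonoidAlgebra.lift ℤ ℤ ℂˣ (1 : ℂˣ →* ℤ)).toRingHom

@[simp] lemma deg_point (v : ℂˣ) : deg (point v) = 1 := by
  simp [deg, point, MonoidAlgebra.lift_single]

@[simp] lemma deg_dual (M : Character) : deg (dual M) = deg M := by
  induction M using induction with
  | h0 => simp
  | hadd v M h => simp [h]
  | hsub v M h => simp [h]

section Prod

variable {G : Type*} [CommGroup G]

/-- The multiplicative extension `∏_v f v ^ M v` of `f`. -/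
def prod (f : ℂˣ → G) (M : Character) : G := M.coeff.prod fun v n => f v ^ n

lemma prod_add (f : ℂˣ → G) (M N : Character) : prod f (M + N) = prod f M * prod f N := by
  classical
  simp only [prod, MonoidAlgebra.coeff_add]
  exact Finsupp.prod_add_index' (fun _ => zpow_zero _) (fun _ _ _ => zpow_add _ _ _)

@[simp] lemma prod_zero (f : ℂˣ → G) : prod f 0 = 1 := by simp [prod]

lemma prod_neg (f : ℂˣ → G) (M : Character) : prod f (-M) = (prod f M)⁻¹ := by
  rw [eq_inv_iff_mul_eq_one, ← prod_add, neg_add_cancel, prod_zero]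

lemma prod_sub (f : ℂˣ → G) (M N : Character) : prod f (M - N) = prod f M / prod f N := by
  rw [sub_eq_add_neg, prod_add, prod_neg, div_eq_mul_inv]

@[simp] lemma prod_point (f : ℂˣ → G) (v : ℂˣ) : prod f (point v) = f v := by
  simp [prod, point]

lemma prod_sum {ι : Type*} (f : ℂˣ → G) (s : Finset ι) (M : ι → Character) :
    prod f (∑ i ∈ s, M i) = ∏ i ∈ s, prod f (M i) := by
  classical
  induction s using Finset.induction_on with
  | empty => simp
  | insert i s hi ih => rw [Finset.sum_insert hi, Finset.prod_insert hi, prod_add, ih]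

end Prod

lemma fac_ne_zero (y : ℂ) : fac y ≠ 0 := by
  unfold fac
  split_ifs with h
  · exact one_ne_zero
  · exact sub_ne_zero.2 (Ne.symm h)

/-- The factors `1 - v`, the vanishing one being left out. -/
def facUnit (v : ℂˣ) : ℂˣ := Units.mk0 (fac v) (fac_ne_zero v)

lemma fac_of_ne {v : ℂˣ} (h : v ≠ 1) : fac v = 1 - v :=
  if_neg fun h' => h (Units.ext h')

lemma coe_facUnit (v : ℂˣ) : (facUnit v : ℂ) = fac v := rfl

/-- The index `∏_v (1 - v) ^ M v`, vanishing factors being left out. -/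
def index (M : Character) : ℂˣ := prod facUnit M

/-- `∏_v (-v) ^ M v`. -/
def signedDet (M : Character) : ℂˣ := prod (fun v => -v) M

/-- `∏_v (1 - v w) ^ M v` as a power series in `w`. -/
def series (M : Character) : PowerSeries ℂ :=
  (prod (fun v => ((PowerSeries.isUnit_iff_constantCoeff
    (φ := 1 - PowerSeries.C (v : ℂ) * PowerSeries.X)).2 (by simp)).unit) M : (PowerSeries ℂ)ˣ)

lemma series_add_point (M : Character) (v : ℂˣ) : (series (M + point v) : PowerSeries ℂ) =
    series M * (1 - PowerSeries.C (v : ℂ) * PowerSeries.X) := by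
  simp [series, prod_add]

lemma series_sub_point (M : Character) (v : ℂˣ) : (series (M - point v) : PowerSeries ℂ) *
    (1 - PowerSeries.C (v : ℂ) * PowerSeries.X) = series M := by
  rw [← series_add_point, sub_add_cancel]

lemma zpow_natCast_add_one (v : ℂ) (i : ℕ) : v ^ ((i : ℤ) + 1) = v ^ (i + 1) := by
  exact_mod_cast zpow_natCast v (i + 1)

/-- The logarithmic derivative of `1 - v w` is `-∑ v^{i+1} w^i`, and logarithmic derivatives add.
This turns an oscillator exponent of the form `ev n M` into a finite product. -/
lemma isExp_series (M : Character) : IsExp (fun i => -ev (i + 1) M) (series M) := by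
  induction M using induction with
  | h0 =>
    convert IsExp.one (S := ℂ) using 1
    · funext i; simp
    · simp [series]
  | hadd v M h =>
    rw [series_add_point]
    convert h.mul (IsExp.one_sub (v : ℂ)) using 1
    funext i
    simp only [map_add, ev_point, Pi.add_apply, zpow_natCast_add_one]
    ring
  | hsub v M h =>
    have h1 := IsExp.one_sub (v : ℂ)
    have h2 := series_sub_point M v
    set E : PowerSeries ℂ := series (M - point v)
    set L : PowerSeries ℂ := 1 - PowerSeries.C (v : ℂ) * PowerSeries.X
    have hL : L ≠ 0 := by
      intro h0
      have := h1.1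
      rw [h0] at this
      simp at this
    constructor
    · have := congrArg PowerSeries.constantCoeff h2
      rwa [map_mul, h1.1, mul_one, h.1] at this
    · refine mul_right_cancel₀ hL ?_
      have h3 := h.2
      rw [← h2, Derivation.leibniz, h1.2] at h3
      have h4 : PowerSeries.mk (fun i : ℕ => -ev (i + 1) (M - point v)) =
          PowerSeries.mk (fun i : ℕ => -ev (i + 1) M) -
            PowerSeries.mk (fun i : ℕ => -(v : ℂ) ^ (i + 1)) := by
        ext n
        simp only [PowerSeries.coeff_mk, map_sub, ev_point, zpow_natCast_add_one]
        ring
      rw [h4]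
      simp only [smul_eq_mul] at h3
      linear_combination h3

lemma contraction_eq_series {h : ℕ → ℂ} {M : Character} (hM : ∀ n : ℕ, n ≠ 0 → h n = ev n M) :
    contraction h = series M := by
  refine (isExp_contraction h).unique ?_
  convert isExp_series M using 3 with i
  rw [hM _ (Nat.succ_ne_zero i)]
  push_cast
  rfl

lemma extCoeff_mul_one_sub (E : PowerSeries ℂ) (v : ℂ) (j : ℤ) :
    extCoeff (E * (1 - PowerSeries.C v * PowerSeries.X)) j =
      extCoeff E j - v * extCoeff E (j - 1) := by
  rw [mul_sub, mul_one, mul_left_comm]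
  rcases lt_trichotomy j 0 with hj | rfl | hj
  · simp [extCoeff, not_le.2 hj, show ¬ (1 ≤ j) by omega]
  · simp [extCoeff]
  · obtain ⟨k, rfl⟩ : ∃ k : ℕ, j = k + 1 := ⟨(j - 1).toNat, by omega⟩
    have : ((k : ℤ) + 1).toNat = k + 1 := by omega
    simp [extCoeff, this, PowerSeries.coeff_succ_mul_X, show (0 : ℤ) ≤ k + 1 by omega]

/-- The difference of the expansions at `w = 0` and `w = ∞` of `∏_v (1 - v w) ^ M v`. -/
def jump (M : Character) (j : ℤ) : ℂ :=
  extCoeff (series M) j - (signedDet M : ℂ) * extCoeff (series (dual M)) (deg M - j)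

/-- Since `1 - v w = -v w (1 - v⁻¹ w⁻¹)`, multiplication by this factor obeys the same recursion in
both expansions; the factor `-v` is recorded by `signedDet` and the power of `w` by `deg`. -/
lemma jump_add_point (M : Character) (v : ℂˣ) (j : ℤ) :
    jump (M + point v) j = jump M j - v * jump M (j - 1) := by
  have h1 : signedDet (M + point v) = signedDet M * -v := by simp [signedDet, prod_add]
  simp only [jump]
  rw [series_add_point, map_add, dual_point, series_add_point, h1, map_add, deg_point,
    extCoeff_mul_one_sub, extCoeff_mul_one_sub]
  have e1 : deg M + 1 - j - 1 = deg M - j := by ring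
  have e2 : deg M - (j - 1) = deg M + 1 - j := by ring
  rw [e1, e2]
  push_cast
  field_simp
  ring

/-- The shift of two-sided sequences. -/
def shift : Module.End ℂ (ℤ → ℂ) where
  toFun a j := a (j - 1)
  map_add' _ _ := rfl
  map_smul' _ _ := rfl

lemma jump_add_sum (M : Character) (s : Finset ℂˣ) :
    jump (M + ∑ v ∈ s, point v) =
      Polynomial.aeval shift (∏ v ∈ s, (1 - Polynomial.C (v : ℂ) * Polynomial.X)) (jump M) := by
  classical
  induction s using Finset.induction_on with
  | empty => simp
  | insert a s ha ih =>
    rw [Finset.sum_insert ha, Finset.prod_insert ha, map_mul, Module.End.mul_apply, ← ih,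
      add_comm (point a), ← add_assoc]
    funext j
    rw [jump_add_point]
    simp [shift]

/-- For `1 / (1 - v w)` the expansion at `0` gives the terms `j ≥ 0` and the one at `∞` the terms `j
< 0`; together they form the whole delta series. -/
lemma jump_neg_point (v : ℂˣ) (j : ℤ) : jump (-point v) j = (v : ℂ) ^ j := by
  have hs : ∀ v : ℂˣ, ∀ n : ℕ, PowerSeries.coeff n (series (-point v) : PowerSeries ℂ) =
      (v : ℂ) ^ n := by
    intro v n
    have := series_sub_point 0 v
    rw [zero_sub] at this
    have h2 : (PowerSeries.mk fun n => (v : ℂ) ^ n) *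
        (1 - PowerSeries.C (v : ℂ) * PowerSeries.X) = 1 := by
      ext n
      rw [mul_sub, mul_one, mul_left_comm]
      rcases n with _ | n
      · simp
      · simp [pow_succ, PowerSeries.coeff_one, mul_comm]
    have h3 : (series (-point v) : PowerSeries ℂ) = PowerSeries.mk fun n => (v : ℂ) ^ n := by
      have h4 : (series 0 : PowerSeries ℂ) = 1 := by simp [series]
      rw [h4] at this
      exact left_inv_eq_right_inv this ((mul_comm _ _).trans h2) |>.trans rfl
    rw [h3, PowerSeries.coeff_mk]
  have h1 : signedDet (-point v) = -v⁻¹ := by simp [signedDet, prod_neg, inv_neg]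
  simp only [jump]
  rw [h1, map_neg, dual_point, map_neg, deg_point]
  rcases lt_or_ge j 0 with hj | hj
  · obtain ⟨k, rfl⟩ : ∃ k : ℕ, j = -(k + 1) := ⟨(-j - 1).toNat, by omega⟩
    have e : (-1 : ℤ) - -(k + 1) = k := by ring
    rw [e]
    simp only [extCoeff, Int.natCast_nonneg, if_true, Int.toNat_natCast, hs,
      show ¬ (0 : ℤ) ≤ -(k + 1) by omega, if_false]
    rw [zpow_neg]
    push_cast
    norm_cast
    rw [pow_succ]
    push_cast
    rw [mul_inv]
    ring
  · lift j to ℕ using hj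
    have : ¬ (0 : ℤ) ≤ -1 - j := by omega
    simp only [extCoeff, this, if_false, hs, Int.natCast_nonneg, if_true, Int.toNat_natCast,
      mul_zero, sub_zero, zpow_natCast]

/-- This is Lagrange interpolation of the constant `1` at the nodes `u⁻¹`, in other words the
partial fraction decomposition for simple poles. -/
lemma lagrange_sum (s : Finset ℂˣ) (hs : s.Nonempty) :
    ∑ u ∈ s, Polynomial.C (∏ v ∈ s.erase u, (1 - (v : ℂ) / u)⁻¹) *
      ∏ v ∈ s.erase u, (1 - Polynomial.C (v : ℂ) * Polynomial.X) = 1 := by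
  classical
  refine Eq.trans ?_ (Lagrange.sum_basis (s := s) (v := fun u : ℂˣ => (u : ℂ)⁻¹)
    (fun a _ b _ h => Units.ext (inv_injective h)) hs)
  refine Finset.sum_congr rfl fun u _ => ?_
  rw [map_prod, ← Finset.prod_mul_distrib, Lagrange.basis]
  refine Finset.prod_congr rfl fun v hv => ?_
  have hne : (v : ℂ) ≠ u := fun h => (Finset.mem_erase.1 hv).1 (Units.ext h)
  have h1 : (1 - (v : ℂ) / u) ≠ 0 := by
    rw [sub_ne_zero, ne_comm, Ne, div_eq_one_iff_eq (Units.ne_zero u)]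
    exact hne
  have h2 : ((u : ℂ)⁻¹ - (v : ℂ)⁻¹)⁻¹ = -(v : ℂ) * (1 - (v : ℂ) / u)⁻¹ := by
    rw [inv_eq_iff_eq_inv, mul_inv, inv_inv]
    field_simp
    ring
  rw [Lagrange.basisDivisor, h2, map_mul]
  have h3 : Polynomial.C (-(v : ℂ)) * Polynomial.C (v : ℂ)⁻¹ = -1 := by
    rw [← map_mul, neg_mul, mul_inv_cancel₀ (Units.ne_zero v), map_neg, map_one]
  have h4 : Polynomial.C (-(v : ℂ)) = -Polynomial.C (v : ℂ) := map_neg _ _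
  rw [h4] at h3 ⊢
  linear_combination (Polynomial.C ((1 - (v : ℂ) / u)⁻¹)) * h3

lemma index_add_point (M : Character) (v : ℂˣ) :
    (index (M + point v) : ℂ) = index M * fac v := by
  simp [index, prod_add, coe_facUnit]

/-- Each term of `lagrange_sum`, acting through `shift`, cancels all poles but one and leaves
`jump_neg_point`. In the residue, `index` leaves out exactly the factor that vanishes at the pole.
-/
lemma jump_neg_sum (s : Finset ℂˣ) (j : ℤ) :
    jump (-∑ v ∈ s, point v) j =
      ∑ u ∈ s, (index (point u⁻¹ * -∑ v ∈ s, point v) : ℂ) * (u : ℂ) ^ j := by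
  classical
  have hidx : ∀ u ∈ s, (index (point u⁻¹ * -∑ v ∈ s, point v) : ℂ) =
      ∏ v ∈ s.erase u, (1 - (v : ℂ) / u)⁻¹ := by
    intro u hu
    rw [mul_neg, Finset.mul_sum, index, prod_neg, prod_sum, Units.val_inv_eq_inv_val,
      Units.coe_prod, Finset.prod_inv_distrib, ← Finset.mul_prod_erase _ _ hu]
    simp only [point_mul, prod_point, coe_facUnit]
    have h0 : fac ((u⁻¹ * u : ℂˣ) : ℂ) = 1 := by simp [fac]
    rw [h0, one_mul]
    congr 1
    refine Finset.prod_congr rfl fun v hv => ?_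
    have hne : (u⁻¹ * v : ℂˣ) ≠ 1 := by
      rw [Ne, inv_mul_eq_one]
      exact fun h => (Finset.mem_erase.1 hv).1 h.symm
    rw [fac_of_ne hne, Units.val_mul,
      Units.val_inv_eq_inv_val, div_eq_inv_mul]
  -- Without poles the function is `1` and its two expansions coincide; interpolation needs at least
  -- one node.
  rcases s.eq_empty_or_nonempty with rfl | hs
  · have : (series 0 : PowerSeries ℂ) = 1 := by simp [series]
    simp only [Finset.sum_empty, neg_zero, jump, map_zero, this, signedDet, prod_zero,
      Units.val_one, one_mul, zero_sub]
    rcases lt_trichotomy j 0 with hj | rfl | hj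
    · simp [extCoeff, PowerSeries.coeff_one, not_le.2 hj, hj.le]
    · simp
    · simp [extCoeff, PowerSeries.coeff_one, not_le.2 hj, hj.le]
  · have h1 := congrArg (fun p => (Polynomial.aeval shift p) (jump (-∑ v ∈ s, point v)) j)
      (lagrange_sum s hs)
    simp only [map_one, Module.End.one_apply, map_sum, LinearMap.sum_apply, Finset.sum_apply,
      map_mul, Polynomial.aeval_C, Module.End.mul_apply] at h1
    rw [← h1]
    refine Finset.sum_congr rfl fun u hu => ?_
    rw [← jump_add_sum, hidx u hu]
    have : -∑ v ∈ s, point v + ∑ v ∈ s.erase u, point v = -point u := by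
      rw [← Finset.add_sum_erase _ _ hu]
      ring
    rw [this]
    simp only [Module.algebraMap_end_apply, Pi.smul_apply, smul_eq_mul, jump_neg_point]

/-- Multiplying a delta function by `1 - a w` only evaluates that factor at the support `w = u⁻¹`.
The hypothesis that zeros are not poles ensures that `index` does not omit it. -/
lemma jump_neg_sum_add (s : Finset ℂˣ) (t : Multiset ℂˣ) (ht : ∀ v ∈ t, v ∉ s) (j : ℤ) :
    jump (-∑ v ∈ s, point v + (t.map point).sum) j =
      ∑ u ∈ s, (index (point u⁻¹ * (-∑ v ∈ s, point v + (t.map point).sum)) : ℂ) *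
        (u : ℂ) ^ j := by
  induction t using Multiset.induction_on generalizing j with
  | empty => simpa using jump_neg_sum s j
  | cons a t ih =>
    have ih' := fun j => ih (fun v hv => ht v (Multiset.mem_cons_of_mem hv)) j
    have e : -∑ v ∈ s, point v + ((a ::ₘ t).map point).sum =
        -∑ v ∈ s, point v + (t.map point).sum + point a := by
      rw [Multiset.map_cons, Multiset.sum_cons]
      ring
    rw [e, jump_add_point, ih', ih', Finset.mul_sum, ← Finset.sum_sub_distrib]
    refine Finset.sum_congr rfl fun u hu => ?_
    have hne : (u⁻¹ * a : ℂˣ) ≠ 1 := by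
      rw [Ne, inv_mul_eq_one]
      rintro rfl
      exact ht u (Multiset.mem_cons_self _ _) hu
    rw [mul_add _ _ (point a), point_mul, index_add_point, fac_of_ne hne,
      zpow_sub_one₀ (Units.ne_zero u),
      Units.val_mul, Units.val_inv_eq_inv_val]
    ring

/-- The points of multiplicity `-1`. -/
def poles (M : Character) : Finset ℂˣ := M.coeff.support.filter fun u => M.coeff u = -1

lemma mem_poles {M : Character} {u : ℂˣ} : u ∈ poles M ↔ M.coeff u = -1 := by
  simp only [poles, Finset.mem_filter, Finsupp.mem_support_iff, and_iff_right_iff_imp]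
  intro h
  rw [h]
  decide

/-- The partial fraction expansion: if all poles are simple, the jump is a sum of delta functions. -/
lemma jump_eq_sum_poles (M : Character) (hM : ∀ u, -1 ≤ M.coeff u) (j : ℤ) :
    jump M j = ∑ u ∈ poles M, (index (point u⁻¹ * M) : ℂ) * (u : ℂ) ^ j := by
  classical
  -- With multiplicities at least `-1`, what remains of `M` outside its poles is effective: `t`
  -- lists the zeros with multiplicity.
  obtain ⟨t, ht, e⟩ : ∃ t : Multiset ℂˣ, (∀ v ∈ t, v ∉ poles M) ∧
      M = -∑ v ∈ poles M, point v + (t.map point).sum := by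
    refine ⟨∑ v ∈ M.coeff.support \ poles M, Multiset.replicate (M.coeff v).toNat v, ?_, ?_⟩
    · intro v hv
      rw [Multiset.mem_sum] at hv
      obtain ⟨w, hw, hv⟩ := hv
      rw [Multiset.eq_of_mem_replicate hv]
      exact (Finset.mem_sdiff.1 hw).2
    · have h1 : ∀ (s : Finset ℂˣ) (f : ℂˣ → ℕ),
          ((∑ v ∈ s, Multiset.replicate (f v) v).map point).sum = ∑ v ∈ s, f v • point v := by
        intro s f
        induction s using Finset.induction_on with
        | empty => simp
        | insert a s ha ih =>
          rw [Finset.sum_insert ha, Finset.sum_insert ha, Multiset.map_add, Multiset.sum_add, ih]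
          simp
      rw [h1]
      ext w
      have h2 : ∀ (s : Finset ℂˣ) (f : Character → ℤ) (g : ℂˣ → Character),
        (∑ v ∈ s, g v).coeff w = ∑ v ∈ s, (g v).coeff w := by
        intro s f g
        induction s using Finset.induction_on with
        | empty => simp
        | insert a s ha ih => rw [Finset.sum_insert ha, Finset.sum_insert ha,
            MonoidAlgebra.coeff_add, Finsupp.add_apply, ih]
      rw [MonoidAlgebra.coeff_add, Finsupp.add_apply, MonoidAlgebra.coeff_neg, Finsupp.neg_apply,
        h2 _ (fun _ => 0), h2 _ (fun _ => 0)]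
      simp only [MonoidAlgebra.coeff_smul, Finsupp.smul_apply, coeff_point]
      simp only [nsmul_eq_mul, mul_ite, mul_one, mul_zero, Finset.sum_ite_eq', Finset.mem_sdiff,
        Finsupp.mem_support_iff, mem_poles]
      have := hM w
      split_ifs <;> omega
  rw [e] at ht
  generalize hs : poles M = s at *
  rw [e, jump_neg_sum_add s t]
  · intro v hv
    have := ht v hv
    rwa [← e, hs] at this

end Character

end

/-! ### From poles of the contraction to delta functions -/

section

open Character

/-- The integer chosen in the definition of `mode` is unique because `ℤ` embeds in `ℂ`. -/
lemma VertexOp.mode_apply (ε : Fin 4 → ℂ) (V : VertexOp) {α t s : ℂ} {m : ℤ}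
    (h : α = V.p * t + V.p' * s + m) (F : Fock) :
    V.mode ε α F t s =
      Complex.exp (V.c * t + V.c' * s) • oscMode ε V.κ m (F (t + V.d) (s + V.d')) := by
  have h' : ∃ m : ℤ, α = V.p * t + V.p' * s + (m : ℂ) := ⟨m, h⟩
  have hm : h'.choose = m := by
    have := h'.choose_spec.symm.trans h
    exact_mod_cast add_left_cancel this
  rw [VertexOp.mode, LinearMap.coe_mk, AddHom.coe_mk, dif_pos h', hm]

lemma VertexOp.mode_apply_eq_zero (ε : Fin 4 → ℂ) (V : VertexOp) {α t s : ℂ}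
    (h : ¬ ∃ m : ℤ, α = V.p * t + V.p' * s + m) (F : Fock) : V.mode ε α F t s = 0 := by
  rw [VertexOp.mode, LinearMap.coe_mk, AddHom.coe_mk, dif_neg h]

/-- The normally ordered product `:V(x) V'(z x):`, up to a scalar. -/
def VertexOp.merge (V V' : VertexOp) (z : ℂˣ) : VertexOp where
  -- The value at `n = 0` enters no vertex operator; fixing it makes merged operators comparable as
  -- structures. The exponents `p`, `p'` are those of `V` alone, since the powers of `x'` are kept
  -- separately in `delta`.
  κ n := if n = 0 then 0 else V.κ n + (z : ℂ) ^ (-n) * V'.κ n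
  p := V.p
  p' := V.p'
  c := V.c + V'.c
  c' := V.c' + V'.c'
  d := V.d + V'.d
  d' := V.d' + V'.d'

open Classical in
/-- `δ(x' / (z x)) W(x)`, the powers of `x'` being shifted by `P t_0 + P' t̃_0 + τ`. -/
def delta (ε : Fin 4 → ℂ) (W : VertexOp) (P P' : ℂ) (τ : ℤ) (z : ℂˣ) : FormalDist := fun α β =>
  { toFun F t s :=
      if h : ∃ k : ℤ × ℤ, α = W.p * t + W.p' * s + k.1 ∧ β = P * t + P' * s + τ + k.2 then
        Complex.exp (W.c * t + W.c' * s) • (z : ℂ) ^ (-h.choose.2) •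
          oscMode ε W.κ (h.choose.1 + h.choose.2) (F (t + W.d) (s + W.d'))
      else 0
    map_add' F G := by
      funext t s
      simp only [Pi.add_apply]
      split_ifs
      · simp only [map_add, smul_add]
      · rw [add_zero]
    map_smul' r F := by
      funext t s
      simp only [Pi.smul_apply, RingHom.id_apply]
      split_ifs
      · simp only [map_smul]
        rw [smul_comm _ r, smul_comm _ r]
      · rw [smul_zero] }

lemma delta_apply (ε : Fin 4 → ℂ) (W : VertexOp) (P P' : ℂ) (τ : ℤ) (z : ℂˣ) {α β t s : ℂ}
    {m n : ℤ} (h : α = W.p * t + W.p' * s + m) (h' : β = P * t + P' * s + τ + n) (F : Fock) :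
    delta ε W P P' τ z α β F t s = Complex.exp (W.c * t + W.c' * s) • (z : ℂ) ^ (-n) •
      oscMode ε W.κ (m + n) (F (t + W.d) (s + W.d')) := by
  have hk : ∃ k : ℤ × ℤ, α = W.p * t + W.p' * s + k.1 ∧ β = P * t + P' * s + τ + k.2 :=
    ⟨(m, n), h, h'⟩
  have h1 : hk.choose.1 = m := by exact_mod_cast add_left_cancel (hk.choose_spec.1.symm.trans h)
  have h2 : hk.choose.2 = n := by exact_mod_cast add_left_cancel (hk.choose_spec.2.symm.trans h')
  rw [delta, LinearMap.coe_mk, AddHom.coe_mk, dif_pos hk, h1, h2]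

lemma delta_apply_eq_zero (ε : Fin 4 → ℂ) (W : VertexOp) (P P' : ℂ) (τ : ℤ) (z : ℂˣ) {α β t s : ℂ}
    (h : ¬ ((∃ m : ℤ, α = W.p * t + W.p' * s + m) ∧ ∃ n : ℤ, β = P * t + P' * s + τ + n))
    (F : Fock) : delta ε W P P' τ z α β F t s = 0 := by
  rw [delta, LinearMap.coe_mk, AddHom.coe_mk, dif_neg]
  rintro ⟨k, h1, h2⟩
  exact h ⟨⟨_, h1⟩, _, h2⟩

/-- The coefficients depend only on `m + n`, apart from the factor `z ^ (-n)`, so the two terms of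
`x' - z x` cancel. -/
lemma supportedAt_delta (ε : Fin 4 → ℂ) (W : VertexOp) (P P' : ℂ) (τ : ℤ) (z : ℂˣ) :
    SupportedAt z (delta ε W P P' τ z) := by
  refine ⟨1, ?_⟩
  funext α β
  refine LinearMap.ext fun F => ?_
  funext t s
  change delta ε W P P' τ z α (β - 1) F t s - (z : ℂ) • delta ε W P P' τ z (α - 1) β F t s = 0
  by_cases h : (∃ m : ℤ, α = W.p * t + W.p' * s + m) ∧ ∃ n : ℤ, β = P * t + P' * s + τ + n
  · obtain ⟨⟨m, hm⟩, n, hn⟩ := h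
    rw [delta_apply ε W P P' τ z (m := m) (n := n - 1) hm (by rw [hn]; push_cast; ring),
      delta_apply ε W P P' τ z (m := m - 1) (n := n) (by rw [hm]; push_cast; ring) hn,
      smul_comm (z : ℂ), smul_smul (z : ℂ), ← zpow_one_add₀ z.ne_zero]
    have e1 : m + (n - 1) = m - 1 + n := by ring
    have e2 : -(n - 1) = 1 + -n := by ring
    rw [e1, e2, sub_self]
  · rw [delta_apply_eq_zero, delta_apply_eq_zero, smul_zero, sub_zero]
    · rintro ⟨⟨m, hm⟩, n, hn⟩
      exact h ⟨⟨m + 1, by push_cast; linear_combination hm⟩, n, hn⟩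
    · rintro ⟨⟨m, hm⟩, n, hn⟩
      exact h ⟨⟨m, hm⟩, n + 1, by push_cast; linear_combination hn⟩

lemma supportedAt_smul {z : ℂ} {G : FormalDist} (h : SupportedAt z G) (r : ℂ) :
    SupportedAt z (r • G) := by
  obtain ⟨m, hm⟩ := h
  refine ⟨m, ?_⟩
  have : ∀ (m : ℕ) (G : FormalDist), (mulLinear z)^[m] (r • G) = r • (mulLinear z)^[m] G := by
    intro m
    induction m with
    | zero => intro G; rfl
    | succ m ih =>
      intro G
      rw [Function.iterate_succ_apply, Function.iterate_succ_apply, ← ih]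
      congr 1
      funext α β
      simp only [mulLinear, Pi.smul_apply]
      rw [smul_sub, smul_comm]
  rw [this, hm, smul_zero]

lemma supportedAt_zero (z : ℂ) : SupportedAt z 0 := ⟨0, rfl⟩

/-- The product of the `q_a` is `1` and the number of sign changes is four. This symmetry is what
makes the contraction in the opposite order the dual character. -/
lemma adamsP_univ_neg {ε : Fin 4 → ℂ} (hsum : ∑ a, ε a = 0) (n : ℤ) :
    adamsP ε Finset.univ (-n) = adamsP ε Finset.univ n := by
  have h1 : ∏ a, q ε a = 1 := by
    simp only [q, ← Complex.exp_sum, hsum, Complex.exp_zero]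
  have h2 : ∏ a, (q ε a ^ n) = 1 := by rw [Finset.prod_zpow, h1, one_zpow]
  have h3 : ∀ a, 1 - q ε a ^ n = -(q ε a ^ n) * (1 - q ε a ^ (-n)) := fun a => by
    have : q ε a ≠ 0 := Complex.exp_ne_zero _
    rw [zpow_neg]
    field_simp
    ring
  unfold adamsP
  rw [Finset.prod_congr rfl fun a _ => h3 a, Finset.prod_mul_distrib, Finset.prod_neg, h2,
    Finset.card_univ, Fintype.card_fin, mul_one, (by norm_num : (-1 : ℂ) ^ 4 = 1), one_mul]

/-- The hypotheses under which `V(x) V'(x')` and `f(x, x') V'(x') V(x)` are expansions of the same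
rational function, `∏_u (1 - u x' / x) ^ M u`, times `:V(x) V'(x'):`. -/
structure Exchange (ε : Fin 4 → ℂ) (C : ℂ) (μ ν τ : ℤ) (V V' : VertexOp) (M : Character) : Prop where
  contraction : ∀ n ≠ 0, V.κ n * V'.κ (-n) * adamsP ε Finset.univ n = ev n M
  -- This field and the next two compare the powers of `x` and `x'` in the two orders. The shifts
  -- produced by the zero modes, together with `μ` and `ν`, must be integers that make up for the
  -- degree of the expansion at infinity.
  left : V.p * V'.d + V.p' * V'.d' = ((-deg M - μ : ℤ) : ℂ)
  right : V'.p * V.d + V'.p' * V.d' = τ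
  degree : τ = ν - deg M
  -- The zero-mode phase of the exchange, times `C`, is the leading coefficient of the expansion at
  -- infinity.
  const : C * Complex.exp (V.c * V'.d + V.c' * V'.d' - V'.c * V.d - V'.c' * V.d') = signedDet M
  simple : ∀ u, -1 ≤ M.coeff u

/-- By partial fractions the jump is a combination of the sequences `u ^ j`, and summing `pairMode`
against `u ^ j` is the specialisation `x' = u⁻¹ x` of `finsum_pairMode`. -/
lemma Exchange.jump_sum {ε : Fin 4 → ℂ} {C : ℂ} {μ ν τ : ℤ} {V V' : VertexOp} {M : Character}
    (h : Exchange ε C μ ν τ V V' M) (m n : ℤ) (F : Osc) :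
    ∑ᶠ j : ℤ, jump M j • pairMode ε V.κ V'.κ (m + j) (n - j) F =
      ∑ u ∈ poles M, (index (point u⁻¹ * M) : ℂ) • ((u⁻¹ : ℂˣ) : ℂ) ^ (-n) •
        oscMode ε (V.merge V' u⁻¹).κ (m + n) F := by
  have hf : ∀ c : ℤ → ℂ,
      (Function.support fun j => c j • pairMode ε V.κ V'.κ (m + j) (n - j) F).Finite := fun c =>
    (pairMode_support_finite ε V.κ V'.κ m n F).subset fun j hj => by
      rw [Function.mem_support] at hj
      exact right_ne_zero_of_smul hj
  simp only [jump_eq_sum_poles M h.simple, Finset.sum_smul]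
  rw [finsum_sum_comm _ _ fun u _ => hf _]
  refine Finset.sum_congr rfl fun u _ => ?_
  rw [← finsum_pairMode ε V.κ V'.κ (V.merge V' u⁻¹).κ (z := (u⁻¹ : ℂˣ)) (Units.ne_zero _),
    smul_finsum' _ (hf _)]
  · refine finsum_congr fun j => ?_
    rw [smul_smul, Units.val_inv_eq_inv_val, inv_zpow', neg_neg]
  · intro k hk
    simp [VertexOp.merge, hk]

/-- Both orders share the normally ordered part and differ only in the expansion of one rational
function, so the difference is governed by `jump` and is a sum of delta functions at the poles `x' =
u⁻¹ x`. -/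
lemma Exchange.twistedComm_eq {ε : Fin 4 → ℂ} (hsum : ∑ a, ε a = 0) {C : ℂ} {μ ν τ : ℤ}
    {V V' : VertexOp} {M : Character} (h : Exchange ε C μ ν τ V V' M) :
    twistedComm ε C μ ν V V' = ∑ u ∈ poles M,
      (Complex.exp (V'.c * V.d + V'.c' * V.d') * index (point u⁻¹ * M)) •
        delta ε (V.merge V' u⁻¹) V'.p V'.p' τ u⁻¹ := by
  funext α β
  refine LinearMap.ext fun F => ?_
  funext t s
  have hr : ∀ (c : ℂˣ → ℂ) (G : ℂˣ → FormalDist),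
      (∑ u ∈ poles M, c u • G u) α β F t s = ∑ u ∈ poles M, c u • G u α β F t s := by
    intro c G
    simp only [Finset.sum_apply, LinearMap.sum_apply, Pi.smul_apply, LinearMap.smul_apply]
  rw [hr]
  change V.mode ε α (V'.mode ε β F) t s - C • V'.mode ε (β - ν) (V.mode ε (α - μ) F) t s = _
  have hl := h.left
  have hri := h.right
  have hd := h.degree
  -- At a given point `(t, s)` both orders involve the same coset of exponents, thanks to the
  -- integrality of the shifts; off this coset every term vanishes.
  by_cases hk : (∃ m : ℤ, α = V.p * t + V.p' * s + m) ∧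
      ∃ n : ℤ, β = V'.p * t + V'.p' * s + τ + n
  · obtain ⟨⟨m, hm⟩, n, hn⟩ := hk
    have e1 : V.mode ε α (V'.mode ε β F) t s =
        Complex.exp (V.c * t + V.c' * s) • Complex.exp (V'.c * (t + V.d) + V'.c' * (s + V.d')) •
          oscMode ε V.κ m (oscMode ε V'.κ n (F (t + V.d + V'.d) (s + V.d' + V'.d'))) := by
      rw [V.mode_apply ε hm, V'.mode_apply ε (m := n) (by rw [hn]; linear_combination -hri),
        map_smul]
    have e2 : V'.mode ε (β - ν) (V.mode ε (α - μ) F) t s =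
        Complex.exp (V'.c * t + V'.c' * s) • Complex.exp (V.c * (t + V'.d) + V.c' * (s + V'.d')) •
          oscMode ε V'.κ (n - deg M) (oscMode ε V.κ (m + deg M)
            (F (t + V'.d + V.d) (s + V'.d' + V.d'))) := by
      rw [V'.mode_apply ε (m := n - deg M)
          (by rw [hn, hd]; push_cast; ring),
        V.mode_apply ε (m := m + deg M)
          (by rw [hm]; push_cast at hl ⊢; linear_combination -hl), map_smul]
    set F' := F (t + V.d + V'.d) (s + V.d' + V'.d') with hF'
    have e3 : F (t + V'.d + V.d) (s + V'.d' + V.d') = F' := by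
      rw [hF', add_right_comm t, add_right_comm s]
    rw [e1, e2, e3, oscMode_oscMode, oscMode_oscMode_swap ε V.κ V'.κ]
    have hE1 : GaugeOrigami.contraction (fun n => V.κ n * V'.κ (-n) * adamsP ε Finset.univ n) =
        series M := contraction_eq_series fun n hn => h.contraction n (by exact_mod_cast hn)
    have hE2 : GaugeOrigami.contraction (fun n => V'.κ n * V.κ (-n) * adamsP ε Finset.univ n) =
        series (dual M) := contraction_eq_series fun n hn => by
      rw [ev_dual, ← h.contraction (-n) (by omega), neg_neg, adamsP_univ_neg hsum,
        mul_comm (V.κ _)]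
    rw [hE1, hE2]
    -- The opposite order is shifted by `deg M` in both exponents; reindexing brings it to the form
    -- used in `jump`.
    have e4 : ∑ᶠ j : ℤ, extCoeff (series (dual M)) (-j) •
        pairMode ε V.κ V'.κ (m + deg M + j) (n - deg M - j) F' =
        ∑ᶠ j : ℤ, extCoeff (series (dual M)) (deg M - j) •
          pairMode ε V.κ V'.κ (m + j) (n - j) F' := by
      rw [← finsum_comp_equiv (Equiv.subRight (deg M))]
      refine finsum_congr fun j => ?_
      rw [Equiv.subRight_apply, neg_sub, add_assoc, add_sub_cancel, sub_sub, add_sub_cancel]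
    have hf : ∀ c : ℤ → ℂ,
        (Function.support fun j => c j • pairMode ε V.κ V'.κ (m + j) (n - j) F').Finite := fun c =>
      (pairMode_support_finite ε V.κ V'.κ m n F').subset fun j hj => by
        rw [Function.mem_support] at hj
        exact right_ne_zero_of_smul hj
    have e5 : C * (Complex.exp (V'.c * t + V'.c' * s) *
        Complex.exp (V.c * (t + V'.d) + V.c' * (s + V'.d'))) =
        Complex.exp (V.c * t + V.c' * s) * Complex.exp (V'.c * (t + V.d) + V'.c' * (s + V.d')) *
          signedDet M := by
      rw [← h.const, ← Complex.exp_add, ← Complex.exp_add, mul_left_comm, ← Complex.exp_add]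
      congr 2
      ring
    have e6 : ∑ᶠ j : ℤ, jump M j • pairMode ε V.κ V'.κ (m + j) (n - j) F' =
        ∑ᶠ j : ℤ, extCoeff (series M) j • pairMode ε V.κ V'.κ (m + j) (n - j) F' -
        (signedDet M : ℂ) • ∑ᶠ j : ℤ, extCoeff (series (dual M)) (deg M - j) •
          pairMode ε V.κ V'.κ (m + j) (n - j) F' := by
      rw [smul_finsum' _ (hf _), ← finsum_sub_distrib (hf _)
        (by simp only [smul_smul]; exact hf _)]
      refine finsum_congr fun j => ?_
      rw [jump, sub_smul, mul_smul]
    rw [e4, smul_smul, smul_smul (Complex.exp (V'.c * t + _)), smul_smul C, e5,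
      mul_smul _ (signedDet M : ℂ), ← smul_sub, ← e6, h.jump_sum,
      Finset.smul_sum]
    refine Finset.sum_congr rfl fun u _ => ?_
    rw [delta_apply ε (V.merge V' u⁻¹) _ _ τ _ (m := m) (n := n) hm hn, smul_smul,
      smul_smul _ (Complex.exp _)]
    have e7 : F (t + (V.merge V' u⁻¹).d) (s + (V.merge V' u⁻¹).d') = F' := by
      simp only [VertexOp.merge, hF', add_assoc]
    rw [e7]
    congr 1
    have : Complex.exp (V.c * t + V.c' * s) * Complex.exp (V'.c * (t + V.d) + V'.c' * (s + V.d')) =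
        Complex.exp (V'.c * V.d + V'.c' * V.d') *
          Complex.exp ((V.merge V' u⁻¹).c * t + (V.merge V' u⁻¹).c' * s) := by
      rw [← Complex.exp_add, ← Complex.exp_add]
      congr 1
      simp only [VertexOp.merge]
      ring
    rw [this]
    ring
  · have e1 : V.mode ε α (V'.mode ε β F) t s = 0 := by
      by_cases hm : ∃ m : ℤ, α = V.p * t + V.p' * s + m
      · obtain ⟨m, hm⟩ := hm
        rw [V.mode_apply ε hm, V'.mode_apply_eq_zero, map_zero, smul_zero]
        rintro ⟨n, hn⟩
        exact hk ⟨⟨m, hm⟩, n, by rw [hn]; linear_combination hri⟩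
      · exact V.mode_apply_eq_zero ε hm _
    have e2 : V'.mode ε (β - ν) (V.mode ε (α - μ) F) t s = 0 := by
      by_cases hn : ∃ n : ℤ, β - ν = V'.p * t + V'.p' * s + n
      · obtain ⟨n, hn⟩ := hn
        rw [V'.mode_apply ε hn, V.mode_apply_eq_zero, map_zero, smul_zero]
        rintro ⟨m, hm⟩
        refine hk ⟨⟨m - deg M, ?_⟩, n + deg M, ?_⟩
        · push_cast at hl ⊢
          linear_combination hm + hl
        · rw [hd]
          push_cast
          linear_combination hn
      · exact V'.mode_apply_eq_zero ε hn _
    rw [e1, e2, smul_zero, sub_zero, Finset.sum_eq_zero]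
    intro u _
    rw [delta_apply_eq_zero ε (V.merge V' u⁻¹) _ _ _ _ hk, smul_zero]

/-- The coefficient of the delta function at `x' = u⁻¹ x` in a product of two summands. -/
def residue (T T' : OpSum) (M : Character) (u : ℂˣ) (i : T.I × T'.I) : ℂ :=
  T.coeff i.1 * T'.coeff i.2 *
    (Complex.exp ((T'.op i.2).c * (T.op i.1).d + (T'.op i.2).c' * (T.op i.1).d') *
      index (point u⁻¹ * M))

/-- If the poles of the products of summands cancel in pairs, then the two sums commute. -/
theorem commuteUpTo_of_exchange {ε : Fin 4 → ℂ} (hsum : ∑ a, ε a = 0) {C : ℂ} {μ ν τ : ℤ}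
    {T T' : OpSum} (M : T.I × T'.I → Character) {P P' : ℂ}
    (hex : ∀ i, Exchange ε C μ ν τ (T.op i.1) (T'.op i.2) (M i))
    (hP : ∀ j, (T'.op j).p = P) (hP' : ∀ j, (T'.op j).p' = P')
    (hcancel : ∀ (N : ℤ) (u : ℂˣ), ∃ (s : Finset (T.I × T'.I)) (g : T.I × T'.I → T.I × T'.I),
      (∀ i, i ∈ s ↔ T.level i.1 + T'.level i.2 = N ∧ (M i).coeff u = -1) ∧
      ∀ i ∈ s, g i ∈ s ∧ g i ≠ i ∧ g (g i) = i ∧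
        (T.op (g i).1).merge (T'.op (g i).2) u⁻¹ = (T.op i.1).merge (T'.op i.2) u⁻¹ ∧
        residue T T' (M i) u i + residue T T' (M (g i)) u (g i) = 0) :
    CommuteUpTo ε C μ ν T T' := by
  classical
  intro N
  let d : {i : T.I × T'.I // T.level i.1 + T'.level i.2 = N} → ℂˣ → FormalDist := fun i u =>
    residue T T' (M i.1) u i.1 •
    delta ε ((T.op i.1.1).merge (T'.op i.1.2) u⁻¹) P P' τ u⁻¹
  let D : {i : T.I × T'.I // T.level i.1 + T'.level i.2 = N} → ℂ →₀ FormalDist := fun i =>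
    ∑ u ∈ poles (M i.1), Finsupp.single ((u⁻¹ : ℂˣ) : ℂ) (d i u)
  have hD : ∀ (i : {i : T.I × T'.I // T.level i.1 + T'.level i.2 = N}) (u : ℂˣ),
      D i ((u⁻¹ : ℂˣ) : ℂ) = if (M i.1).coeff u = -1 then d i u else 0 := by
    intro i u
    simp only [D, Finsupp.finsetSum_apply, Finsupp.single_apply, Units.val_inj, inv_inj]
    rw [Finset.sum_ite_eq']
    simp only [mem_poles]
  -- Poles are units, so no delta function sits at `x' = 0`.
  have hD0 : ∀ i : {i : T.I × T'.I // T.level i.1 + T'.level i.2 = N}, D i 0 = 0 := by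
    intro i
    simp only [D, Finsupp.finsetSum_apply]
    refine Finset.sum_eq_zero fun u _ => Finsupp.single_eq_of_ne (Units.ne_zero _).symm
  have hz : ∀ z : ℂ, z = 0 ∨ ∃ u : ℂˣ, z = ((u⁻¹ : ℂˣ) : ℂ) := fun z => by
    by_cases h : z = 0
    · exact Or.inl h
    · exact Or.inr ⟨(Units.mk0 z h)⁻¹, by simp⟩
  -- No remainder is needed: every member of the family is itself a finite sum of delta functions.
  refine ⟨fun _ => 0, D, fun i => ?_, fun i z => ?_, by simp, by simp, fun z => ?_⟩
  · have hsumD : ((D i).sum fun _ g => g) = ∑ u ∈ poles (M i.1), d i u := by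
      rw [← Finsupp.sum_finsetSum_index (h := fun _ g => g) (fun _ => rfl) (fun _ _ _ => rfl)]
      exact Finset.sum_congr rfl fun u _ => Finsupp.sum_single_index rfl
    simp only [zero_add]
    rw [hsumD, (hex i.1).twistedComm_eq hsum, Finset.smul_sum]
    refine Finset.sum_congr rfl fun u _ => ?_
    rw [smul_smul, hP, hP']
    rfl
  · rcases hz z with rfl | ⟨u, rfl⟩
    · rw [hD0]
      exact supportedAt_zero _
    · rw [hD]
      split_ifs
      · exact supportedAt_smul (supportedAt_delta _ _ _ _ _ _) _
      · exact supportedAt_zero _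
  · rcases hz z with rfl | ⟨u, rfl⟩
    · simp [hD0]
    obtain ⟨s, g, hs, hg⟩ := hcancel N u
    have hsub : (Function.support fun i : {i : T.I × T'.I // T.level i.1 + T'.level i.2 = N} =>
        D i ((u⁻¹ : ℂˣ) : ℂ)) ⊆
        (s.subtype fun i : T.I × T'.I => T.level i.1 + T'.level i.2 = N) := by
      intro i hi
      rw [Function.mem_support, hD] at hi
      simp only [Finset.mem_coe, Finset.mem_subtype, hs]
      refine ⟨i.2, ?_⟩
      by_contra h
      exact hi (if_neg h)
    refine ⟨(Finset.finite_toSet _).subset hsub, ?_⟩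
    rw [finsum_eq_sum_of_support_subset _ hsub]
    set f : T.I × T'.I → FormalDist := fun i => residue T T' (M i) u i •
      delta ε ((T.op i.1).merge (T'.op i.2) u⁻¹) P P' τ u⁻¹ with hf
    have hd : ∀ i ∈ s.subtype fun i : T.I × T'.I => T.level i.1 + T'.level i.2 = N,
        D i ((u⁻¹ : ℂˣ) : ℂ) = f i := by
      intro i hi
      rw [Finset.mem_subtype, hs] at hi
      rw [hD, if_pos hi.2]
    rw [Finset.sum_congr rfl hd, Finset.sum_subtype_of_mem f fun i hi => ((hs i).1 hi).1]
    -- Partners carry the same delta function with opposite coefficients, and `g` is an involution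
    -- without fixed points.
    refine Finset.sum_involution (fun i _ => g i) (fun i hi => ?_) (fun i hi _ => (hg i hi).2.1)
      (fun i hi => (hg i hi).1) (fun i hi => (hg i hi).2.2.1)
    simp only [hf]
    rw [(hg i hi).2.2.2.1, ← add_smul, (hg i hi).2.2.2.2, zero_smul]

end

/-! ### Cancellation along a matching of poles -/

section

open Character

/-- If the poles of the products of summands are matched in cancelling pairs, then the two sums
commute. -/
theorem commuteUpTo_of_matching {ε : Fin 4 → ℂ} (hsum : ∑ a, ε a = 0) {C : ℂ} {μ ν τ : ℤ}
    {T T' : OpSum} (M : T.I × T'.I → Character) {P P' : ℂ}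
    (hex : ∀ i, Exchange ε C μ ν τ (T.op i.1) (T'.op i.2) (M i))
    (hP : ∀ j, (T'.op j).p = P) (hP' : ∀ j, (T'.op j).p' = P')
    (R : ℂˣ → T.I × T'.I → T.I × T'.I → Prop)
    (hpole : ∀ u i, (M i).coeff u = -1 ↔ (∃ j, R u i j) ∨ ∃ j, R u j i)
    (hfun : ∀ u i j j', R u i j → R u i j' → j = j')
    (hinj : ∀ u i i' j, R u i j → R u i' j → i = i')
    (hdisj : ∀ u i j k, R u i j → ¬ R u k i)
    (hlevel : ∀ u i j, R u i j → T.level i.1 + T'.level i.2 = T.level j.1 + T'.level j.2)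
    (hmerge : ∀ u i j, R u i j →
      (T.op j.1).merge (T'.op j.2) u⁻¹ = (T.op i.1).merge (T'.op i.2) u⁻¹)
    (hres : ∀ u i j, R u i j → residue T T' (M i) u i + residue T T' (M j) u j = 0)
    (hfin : ∀ (N : ℤ) u, {i : T.I × T'.I |
      T.level i.1 + T'.level i.2 = N ∧ (M i).coeff u = -1}.Finite) :
    CommuteUpTo ε C μ ν T T' := by
  classical
  refine commuteUpTo_of_exchange hsum M hex hP hP' fun N u => ?_
  -- The involution follows `R` forwards where possible and backwards otherwise; by `hdisj` no index
  -- admits both.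
  let g : T.I × T'.I → T.I × T'.I := fun i =>
    if h : ∃ j, R u i j then h.choose else if h : ∃ j, R u j i then h.choose else i
  have hg1 : ∀ i j, R u i j → g i = j := fun i j h => by
    have h' : ∃ j, R u i j := ⟨j, h⟩
    simp only [g, dif_pos h']
    exact hfun u i _ _ h'.choose_spec h
  have hg2 : ∀ i j, R u i j → g j = i := fun i j h => by
    have h' : ∃ i, R u i j := ⟨i, h⟩
    have h'' : ¬ ∃ k, R u j k := fun ⟨k, hk⟩ => hdisj u j k i hk h
    simp only [g, dif_neg h'', dif_pos h']
    exact hinj u _ _ j h'.choose_spec h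
  have hne : ∀ i j, R u i j → i ≠ j := by
    rintro i j h rfl
    exact hdisj u i i i h h
  refine ⟨(hfin N u).toFinset, g, fun i => by simp, fun i hi => ?_⟩
  rw [Set.Finite.mem_toFinset] at hi
  rcases (hpole u i).1 hi.2 with ⟨j, h⟩ | ⟨j, h⟩
  · rw [hg1 i j h, hg2 i j h]
    refine ⟨?_, (hne i j h).symm, rfl, hmerge u i j h, hres u i j h⟩
    rw [Set.Finite.mem_toFinset]
    exact ⟨(hlevel u i j h).symm.trans hi.1, (hpole u j).2 (Or.inr ⟨i, h⟩)⟩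
  · rw [hg2 j i h, hg1 j i h]
    refine ⟨?_, hne j i h, rfl, (hmerge u j i h).symm, ?_⟩
    · rw [Set.Finite.mem_toFinset]
      exact ⟨(hlevel u j i h).trans hi.1, (hpole u j).2 (Or.inl ⟨i, h⟩)⟩
    · rw [add_comm]
      exact hres u j i h

/-! ### Generic parameters -/

/-- The parameters `q_a` satisfy `q_1 q_2 q_3 q_4 = 1` and no other multiplicative relation. -/
structure Generic (ε : Fin 4 → ℂ) : Prop where
  sum : ∑ a, ε a = 0
  gen : ∀ m : Fin 4 → ℤ, ∏ a, q ε a ^ m a = 1 → ∀ a b, m a = m b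

/-- `q_a` as a unit. -/
def qUnit (ε : Fin 4 → ℂ) (a : Fin 4) : ℂˣ := Units.mk0 (q ε a) (Complex.exp_ne_zero _)

@[simp] lemma coe_qUnit (ε : Fin 4 → ℂ) (a : Fin 4) : (qUnit ε a : ℂ) = q ε a := rfl

/-- The monomial `∏_a q_a ^ v_a`. -/
def lat (ε : Fin 4 → ℂ) (v : Fin 4 → ℤ) : ℂˣ := ∏ a, qUnit ε a ^ v a

variable {ε : Fin 4 → ℂ}

lemma lat_add (v w : Fin 4 → ℤ) : lat ε (v + w) = lat ε v * lat ε w := by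
  simp [lat, zpow_add, Finset.prod_mul_distrib]

lemma lat_zero : lat ε 0 = 1 := by simp [lat]

lemma lat_neg (v : Fin 4 → ℤ) : lat ε (-v) = (lat ε v)⁻¹ := by
  simp [lat]

lemma lat_sub (v w : Fin 4 → ℤ) : lat ε (v - w) = lat ε v * (lat ε w)⁻¹ := by
  rw [sub_eq_add_neg, lat_add, lat_neg]

lemma lat_single (a : Fin 4) (n : ℤ) : lat ε (Pi.single a n) = qUnit ε a ^ n := by
  rw [lat, Finset.prod_eq_single a]
  · simp
  · intro b _ hb
    simp [hb]
  · simp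

lemma Generic.prod_q (h : Generic ε) : ∏ a, q ε a = 1 := by
  simp only [q, ← Complex.exp_sum, h.sum, Complex.exp_zero]

/-- Genericity says that the kernel of `v ↦ ∏ q_a ^ v_a` is precisely the diagonal of `ℤ ^ 4`.
Comparing units thereby becomes linear arithmetic on exponents. -/
lemma Generic.lat_eq_one (h : Generic ε) {v : Fin 4 → ℤ} : lat ε v = 1 ↔ ∀ a b, v a = v b := by
  constructor
  · intro hv
    refine h.gen v ?_
    have := congrArg (Units.val) hv
    simpa [lat, Units.coe_prod] using this
  · intro hv
    have h1 : lat ε v = (∏ a, qUnit ε a) ^ v 0 := by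
      rw [lat, ← Finset.prod_zpow]
      exact Finset.prod_congr rfl fun a _ => by rw [hv a 0]
    have h2 : ∏ a, qUnit ε a = 1 := by
      ext
      rw [Units.coe_prod]
      exact h.prod_q
    rw [h1, h2, one_zpow]

lemma Generic.lat_eq (h : Generic ε) {v w : Fin 4 → ℤ} :
    lat ε v = lat ε w ↔ ∀ a b, v a - w a = v b - w b := by
  rw [← mul_inv_eq_one, ← lat_sub, h.lat_eq_one]
  rfl

lemma Generic.qUnit_zpow_ne_one (h : Generic ε) (a : Fin 4) {n : ℤ} (hn : n ≠ 0) :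
    qUnit ε a ^ n ≠ 1 := by
  rw [← lat_single, Ne, h.lat_eq_one]
  intro h'
  have := h' a (a + 1)
  have hne : a + 1 ≠ a := by fin_cases a <;> decide
  rw [Pi.single_eq_same, Pi.single_eq_of_ne hne] at this
  exact hn this

lemma Generic.one_sub_ne_zero (h : Generic ε) (a : Fin 4) {n : ℤ} (hn : n ≠ 0) :
    1 - q ε a ^ n ≠ 0 := by
  rw [sub_ne_zero, ne_comm]
  intro h'
  refine h.qUnit_zpow_ne_one a hn (Units.ext ?_)
  simpa using h'

lemma Generic.adamsP_ne_zero (h : Generic ε) (S : Finset (Fin 4)) {n : ℤ} (hn : n ≠ 0) :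
    adamsP ε S n ≠ 0 :=
  Finset.prod_ne_zero_iff.2 fun a _ => h.one_sub_ne_zero a hn

lemma Generic.eps_ne_zero (h : Generic ε) (a : Fin 4) : ε a ≠ 0 := by
  intro h'
  refine h.one_sub_ne_zero a (one_ne_zero) ?_
  simp [q, h']

/-- The character `∏_{a ∈ S} (1 - q_a)`. -/
def adamsChar (ε : Fin 4 → ℂ) (S : Finset (Fin 4)) : Character := ∏ a ∈ S, (1 - point (qUnit ε a))

lemma ev_adamsChar (S : Finset (Fin 4)) (n : ℤ) : ev n (adamsChar ε S) = adamsP ε S n := by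
  simp [adamsChar, adamsP]

/-- The monomial `∏_{a ∈ S} q_a`. -/
def qProd (ε : Fin 4 → ℂ) (S : Finset (Fin 4)) : ℂˣ := ∏ a ∈ S, qUnit ε a

lemma adamsP_neg (S : Finset (Fin 4)) (n : ℤ) :
    adamsP ε S n = (-1) ^ S.card * (qProd ε S : ℂ) ^ n * adamsP ε S (-n) := by
  have h3 : ∀ a, 1 - q ε a ^ n = -(q ε a ^ n) * (1 - q ε a ^ (-n)) := fun a => by
    have : q ε a ≠ 0 := Complex.exp_ne_zero _
    rw [zpow_neg]
    field_simp
    ring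
  unfold adamsP
  rw [Finset.prod_congr rfl fun a _ => h3 a, Finset.prod_mul_distrib, Finset.prod_neg, qProd,
    Units.coe_prod, ← Finset.prod_zpow]
  rfl

lemma adamsP_univ_eq {A B : Finset (Fin 4)} (hAB : Disjoint A B) (n : ℤ) :
    adamsP ε Finset.univ n = adamsP ε A n * adamsP ε B n * adamsP ε (A ∪ B)ᶜ n := by
  unfold adamsP
  rw [← Finset.prod_union hAB, Finset.prod_mul_prod_compl]

/-- The character of the contraction of two operators attached to disjoint faces `A` and `B`. -/
def exchangeChar (ε : Fin 4 → ℂ) (A B : Finset (Fin 4)) (u u' : Character) : Character :=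
  (-1) ^ A.card * point (qProd ε A) * adamsChar ε (A ∪ B)ᶜ * (dual u * u')

/-- For disjoint faces `P_4` is `P_A P_B` times the Adams polynomial of the remaining directions.
The denominator `P_A^{[-n]}` turns into `P_A^{[n]}` at the cost of the sign and the monomial `q_A`.
-/
lemma Generic.contraction_exchangeChar (h : Generic ε) {A B : Finset (Fin 4)} (hAB : Disjoint A B)
    {u u' : Character} {κ κ' : ℤ → ℂ} (hκ : ∀ n ≠ 0, κ n = ev (-n) u / adamsP ε A (-n))
    (hκ' : ∀ n ≠ 0, κ' n = ev (-n) u' / adamsP ε B (-n)) (n : ℤ) (hn : n ≠ 0) :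
    κ n * κ' (-n) * adamsP ε Finset.univ n = ev n (exchangeChar ε A B u u') := by
  rw [hκ n hn, hκ' (-n) (neg_ne_zero.2 hn), neg_neg, adamsP_univ_eq hAB, adamsP_neg A n]
  have h1 := h.adamsP_ne_zero A (neg_ne_zero.2 hn)
  have h2 := h.adamsP_ne_zero B hn
  simp only [exchangeChar, map_mul, map_pow, map_neg, map_one, ev_point, ev_adamsChar, ev_dual]
  field_simp

/-! ### Partitions as characters -/

section Shape

variable {S : Finset (Fin 4)}

/-- The exponents of the content of a box. -/
def boxExp (b : S → ℕ) : Fin 4 → ℤ := fun i => if h : i ∈ S then (b ⟨i, h⟩ : ℤ) else 0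

/-- The content of a box as a unit. -/
def contentUnit (ε : Fin 4 → ℂ) (b : S → ℕ) : ℂˣ := lat ε (boxExp b)

lemma coe_contentUnit (b : S → ℕ) : (contentUnit ε b : ℂ) = content ε b := by
  rw [contentUnit, lat, content, logContent, Complex.exp_sum, Units.coe_prod,
    ← Finset.prod_subset (Finset.subset_univ S), ← Finset.prod_attach S]
  · refine Finset.prod_congr rfl fun i _ => ?_
    rw [boxExp, dif_pos i.2, Units.val_zpow_eq_zpow_val, coe_qUnit, q, zpow_natCast,
      Complex.exp_nat_mul]
  · intro i _ hi
    rw [boxExp, dif_neg hi, zpow_zero, Units.val_one]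

lemma exp_neg_mul_logContent (b : S → ℕ) (n : ℤ) :
    Complex.exp (-(n : ℂ) * logContent ε b) = (contentUnit ε b : ℂ) ^ (-n) := by
  rw [coe_contentUnit, content, ← Complex.exp_int_mul]
  push_cast
  rfl

/-- The character `∑_{b ∈ λ} χ(b)` of a partition. -/
def boxChar (ε : Fin 4 → ℂ) (lam : Finset (S → ℕ)) : Character :=
  ∑ b ∈ lam, point (contentUnit ε b)

/-- The character `1 - P_S ∑_{b ∈ λ} χ(b)` of the boundary of a partition. -/
def shapeChar (ε : Fin 4 → ℂ) (lam : Finset (S → ℕ)) : Character :=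
  1 - adamsChar ε S * boxChar ε lam

/-- The root current has `κ = 1 = P_S / P_S`, so each inverse factor `A(χ(b) x)⁻¹` subtracts `P_S
χ(b)` from the numerator. -/
lemma Generic.dress_kappa (h : Generic ε) (V : VertexOp)
    (hV : ∀ n, V.κ n = 1 / adamsP ε S (-n)) (lam : Finset (S → ℕ)) (n : ℤ) (hn : n ≠ 0) :
    (V.dress opA lam (logContent ε)).κ n = ev (-n) (shapeChar ε lam) / adamsP ε S (-n) := by
  have h1 := h.adamsP_ne_zero S (neg_ne_zero.2 hn)
  simp only [VertexOp.dress, VertexOp.scale, opA, hV, shapeChar, boxChar, map_sub, map_one, map_mul,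
    map_sum, ev_adamsChar, ev_point, exp_neg_mul_logContent, mul_one]
  field_simp

lemma opS_kappa (a : Fin 4) (k : ℤ) (n : ℤ) :
    ((opS ε a).scale ((k : ℂ) * ε a)).κ n =
      ev (-n) (point (qUnit ε a ^ k)) / adamsP ε {a} (-n) := by
  have : Complex.exp (-(n : ℂ) * ((k : ℂ) * ε a)) = (q ε a ^ k) ^ (-n) := by
    rw [q, ← Complex.exp_int_mul, ← Complex.exp_int_mul]
    push_cast
    ring_nf
  simp only [VertexOp.scale, opS, ev_point, this, Units.val_zpow_eq_zpow_val, coe_qUnit]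
  rw [mul_one_div]

end Shape

end

/-! ### Vacancies of partitions, addable and removable boxes -/

section

open Character

section Shape

variable {ε : Fin 4 → ℂ} {S : Finset (Fin 4)}

/-- The exponent vector `v` only involves the directions `S`. -/
def SuppIn (S : Finset (Fin 4)) (v : Fin 4 → ℤ) : Prop := ∀ i, i ∉ S → v i = 0

/-- The box with a given exponent vector. -/
def boxOf (S : Finset (Fin 4)) (v : Fin 4 → ℤ) : S → ℕ := fun i => (v i).toNat

/-- The indicator vector of a set of directions. -/
def stepSet (T : Finset (Fin 4)) : Fin 4 → ℤ := fun i => if i ∈ T then 1 else 0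

lemma suppIn_boxExp (b : S → ℕ) : SuppIn S (boxExp b) := fun i hi => by simp [boxExp, hi]

lemma boxExp_nonneg (b : S → ℕ) (i : Fin 4) : 0 ≤ boxExp b i := by
  unfold boxExp
  split_ifs <;> simp

lemma boxOf_boxExp (b : S → ℕ) : boxOf S (boxExp b) = b := by
  funext i
  simp [boxOf, boxExp]

lemma boxExp_boxOf {v : Fin 4 → ℤ} (h0 : ∀ i, 0 ≤ v i) (hv : SuppIn S v) :
    boxExp (boxOf S v) = v := by
  funext i
  unfold boxExp boxOf
  split_ifs with h
  · exact Int.toNat_of_nonneg (h0 i)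
  · exact (hv i h).symm

lemma SuppIn.sub_stepSet {v : Fin 4 → ℤ} (hv : SuppIn S v) {T : Finset (Fin 4)} (hT : T ⊆ S) :
    SuppIn S (v - stepSet T) := fun i hi => by
  have : i ∉ T := fun h => hi (hT h)
  simp [stepSet, this, hv i hi]

lemma SuppIn.add_stepSet {v : Fin 4 → ℤ} (hv : SuppIn S v) {T : Finset (Fin 4)} (hT : T ⊆ S) :
    SuppIn S (v + stepSet T) := fun i hi => by
  have : i ∉ T := fun h => hi (hT h)
  simp [stepSet, this, hv i hi]

lemma stepSet_empty : stepSet ∅ = 0 := by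
  funext i
  simp [stepSet]

lemma lat_stepSet (T : Finset (Fin 4)) : lat ε (stepSet T) = qProd ε T := by
  rw [lat, qProd, ← Finset.prod_subset (Finset.subset_univ T)]
  · exact Finset.prod_congr rfl fun i hi => by simp [stepSet, hi]
  · intro i _ hi
    simp [stepSet, hi]

/-- Exponents vanish in a direction `e` outside `S`, which removes the diagonal ambiguity. -/
lemma Generic.lat_injOn (h : Generic ε) {e : Fin 4} (he : e ∉ S) {v w : Fin 4 → ℤ}
    (hv : SuppIn S v) (hw : SuppIn S w) (hvw : lat ε v = lat ε w) : v = w := by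
  funext i
  have := h.lat_eq.1 hvw i e
  rw [hv e he, hw e he] at this
  omega

lemma Generic.contentUnit_injective (h : Generic ε) {e : Fin 4} (he : e ∉ S) {b b' : S → ℕ}
    (hb : contentUnit ε b = contentUnit ε b') : b = b' := by
  have := h.lat_injOn he (suppIn_boxExp b) (suppIn_boxExp b') hb
  rw [← boxOf_boxExp b, this, boxOf_boxExp]

open Classical in
/-- The indicator function of the vacant boxes of `ℕ ^ S`. -/
def vacancy (lam : Finset (S → ℕ)) (v : Fin 4 → ℤ) : ℤ :=
  if (∀ i, 0 ≤ v i) ∧ SuppIn S v ∧ boxOf S v ∉ lam then 1 else 0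

lemma vacancy_nonneg (lam : Finset (S → ℕ)) (v : Fin 4 → ℤ) : 0 ≤ vacancy lam v := by
  unfold vacancy
  split_ifs <;> decide

lemma vacancy_le_one (lam : Finset (S → ℕ)) (v : Fin 4 → ℤ) : vacancy lam v ≤ 1 := by
  unfold vacancy
  split_ifs <;> decide

lemma vacancy_eq_one {lam : Finset (S → ℕ)} {v : Fin 4 → ℤ} :
    vacancy lam v = 1 ↔ (∀ i, 0 ≤ v i) ∧ SuppIn S v ∧ boxOf S v ∉ lam := by
  unfold vacancy
  split_ifs with h <;> simp [h]

/-- The complement of a lower set is an upper set. The support condition is needed only for `w`,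
because a vanishing vacancy of `v` leaves nothing to prove. -/
lemma vacancy_mono {lam : Finset (S → ℕ)} (hl : IsLowerSet (lam : Set (S → ℕ))) {v w : Fin 4 → ℤ}
    (hvw : ∀ i, v i ≤ w i) (hw : SuppIn S w) : vacancy lam v ≤ vacancy lam w := by
  by_cases h : vacancy lam v = 1
  · have h' := vacancy_eq_one.1 h
    rw [h, vacancy_eq_one.2]
    refine ⟨fun i => (h'.1 i).trans (hvw i), hw, fun hb => h'.2.2 (hl (fun i => ?_) hb)⟩
    exact Int.toNat_le_toNat (hvw i)
  · have h1 := vacancy_nonneg lam v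
    have h2 := vacancy_le_one lam v
    have h3 := vacancy_nonneg lam w
    omega

lemma boxChar_coeff_eq_zero (lam : Finset (S → ℕ)) {x : ℂˣ}
    (hx : ¬ ∃ v, SuppIn S v ∧ x = lat ε v) : (boxChar ε lam).coeff x = 0 := by
  have h2 : ∀ s : Finset (S → ℕ), (∑ b ∈ s, point (contentUnit ε b)).coeff x = 0 := by
    intro s
    induction s using Finset.induction_on with
    | empty => simp
    | insert b s hb ih =>
      rw [Finset.sum_insert hb, MonoidAlgebra.coeff_add, Finsupp.add_apply, ih, add_zero,
        coeff_point, if_neg]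
      rintro rfl
      exact hx ⟨_, suppIn_boxExp b, rfl⟩
  exact h2 lam

open Classical in
lemma Generic.boxChar_coeff (h : Generic ε) {e : Fin 4} (he : e ∉ S) (lam : Finset (S → ℕ))
    {v : Fin 4 → ℤ} (hv : SuppIn S v) :
    (boxChar ε lam).coeff (lat ε v) = (if ∀ i, 0 ≤ v i then 1 else 0) - vacancy lam v := by
  have h1 : ∀ b : S → ℕ, (point (contentUnit ε b)).coeff (lat ε v) =
      if (∀ i, 0 ≤ v i) ∧ b = boxOf S v then 1 else 0 := by
    intro b
    rw [coeff_point]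
    congr 1
    rw [eq_iff_iff]
    constructor
    · intro hb
      have := h.lat_injOn he (suppIn_boxExp b) hv hb
      exact ⟨fun i => this ▸ boxExp_nonneg b i, by rw [← this, boxOf_boxExp]⟩
    · rintro ⟨h0, rfl⟩
      rw [contentUnit, boxExp_boxOf h0 hv]
  have h2 : ∀ s : Finset (S → ℕ), (∑ b ∈ s, point (contentUnit ε b)).coeff (lat ε v) =
      if (∀ i, 0 ≤ v i) ∧ boxOf S v ∈ s then 1 else 0 := by
    intro s
    induction s using Finset.induction_on with
    | empty => simp
    | insert b s hb ih =>
      rw [Finset.sum_insert hb, MonoidAlgebra.coeff_add, Finsupp.add_apply, ih, h1]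
      by_cases hbv : b = boxOf S v
      · subst hbv
        simp [hb]
      · simp [hbv, Ne.symm hbv]
  rw [boxChar, h2, vacancy]
  by_cases h0 : ∀ i, 0 ≤ v i <;> by_cases hm : boxOf S v ∈ lam <;> simp [h0, hm, hv]

lemma adamsChar_eq_sum (S : Finset (Fin 4)) :
    adamsChar ε S = ∑ T ∈ S.powerset, (-1) ^ T.card * point (qProd ε T) := by
  have h : ∀ T : Finset (Fin 4), ∏ i ∈ T, point (qUnit ε i) = point (qProd ε T) := by
    intro T
    induction T using Finset.induction_on with
    | empty => simp [qProd, point_one]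
    | insert a T ha ih => rw [Finset.prod_insert ha, ih, point_mul, qProd, qProd,
        Finset.prod_insert ha]
  unfold adamsChar
  simp only [sub_eq_neg_add]
  rw [Finset.prod_add]
  refine Finset.sum_congr rfl fun T _ => ?_
  rw [Finset.prod_neg, h, Finset.prod_const_one, mul_one]

lemma coeff_finset_sum {ι : Type*} (s : Finset ι) (f : ι → Character) (x : ℂˣ) :
    (∑ i ∈ s, f i).coeff x = ∑ i ∈ s, (f i).coeff x := by
  classical
  induction s using Finset.induction_on with
  | empty => simp
  | insert a s ha ih =>
    rw [Finset.sum_insert ha, Finset.sum_insert ha, MonoidAlgebra.coeff_add, Finsupp.add_apply, ih]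

lemma coeff_neg_one_pow_mul (n : ℕ) (M : Character) (x : ℂˣ) :
    ((-1) ^ n * M).coeff x = (-1) ^ n * M.coeff x := by
  rcases neg_one_pow_eq_or Character n with h | h <;>
  rcases Nat.even_or_odd n with h' | h' <;> simp [h'.neg_one_pow]

lemma adamsChar_mul_coeff (S : Finset (Fin 4)) (M : Character) (x : ℂˣ) :
    (adamsChar ε S * M).coeff x =
      ∑ T ∈ S.powerset, (-1) ^ T.card * M.coeff ((qProd ε T)⁻¹ * x) := by
  rw [adamsChar_eq_sum, Finset.sum_mul, coeff_finset_sum]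
  refine Finset.sum_congr rfl fun T _ => ?_
  rw [mul_assoc, coeff_neg_one_pow_mul, point_mul_coeff]

lemma shapeChar_coeff_eq_zero (lam : Finset (S → ℕ)) {x : ℂˣ}
    (hx : ¬ ∃ v, SuppIn S v ∧ x = lat ε v) : (shapeChar ε lam).coeff x = 0 := by
  rw [shapeChar, MonoidAlgebra.coeff_sub, Finsupp.sub_apply, adamsChar_mul_coeff, coeff_one,
    if_neg, Finset.sum_eq_zero, sub_zero]
  · intro T hT
    rw [boxChar_coeff_eq_zero, mul_zero]
    rintro ⟨v, hv, hv'⟩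
    refine hx ⟨v + stepSet T, hv.add_stepSet (Finset.mem_powerset.1 hT), ?_⟩
    rw [lat_add, ← hv', lat_stepSet]
    simp
  · rintro rfl
    exact hx ⟨0, fun _ _ => rfl, lat_zero.symm⟩

/-- In coefficients this says that `P_S` times the generating function of the orthant `ℕ ^ S` is
`1`; the alternating sum factorises over the directions. -/
lemma sum_nonneg_indicator {v : Fin 4 → ℤ} (hv : SuppIn S v) :
    ∑ T ∈ S.powerset, (-1 : ℤ) ^ T.card * (if ∀ i, 0 ≤ (v - stepSet T) i then 1 else 0) =
      if v = 0 then 1 else 0 := by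
  have h1 : ∏ i ∈ S, (-(if 0 ≤ v i - 1 then 1 else 0 : ℤ) + if 0 ≤ v i then 1 else 0) =
      if v = 0 then 1 else 0 := by
    have : ∀ i, (-(if 0 ≤ v i - 1 then 1 else 0 : ℤ) + if 0 ≤ v i then 1 else 0) =
        if v i = 0 then 1 else 0 := by
      intro i
      split_ifs <;> omega
    rw [Finset.prod_congr rfl fun i _ => this i, Finset.prod_ite_zero, Finset.prod_const_one]
    congr 1
    rw [eq_iff_iff]
    constructor
    · intro h
      funext i
      by_cases hi : i ∈ S
      · exact h i hi
      · exact hv i hi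
    · rintro rfl i _
      rfl
  rw [← h1, Finset.prod_add]
  refine Finset.sum_congr rfl fun T hT => ?_
  rw [Finset.prod_neg, Finset.prod_ite_zero, Finset.prod_ite_zero, Finset.prod_const_one,
    Finset.prod_const_one, mul_assoc]
  congr 1
  have hT' := Finset.mem_powerset.1 hT
  rw [ite_zero_mul_ite_zero, mul_one]
  congr 1
  rw [eq_iff_iff]
  rw [and_comm]
  constructor
  · intro h
    refine ⟨fun i hi => ?_, fun i hi => ?_⟩
    · have := h i
      simp only [Pi.sub_apply, stepSet] at this
      rw [Finset.mem_sdiff] at hi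
      simpa [hi.2] using this
    · have := h i
      simpa [stepSet, hi] using this
  · rintro ⟨h2, h3⟩ i
    by_cases hi : i ∈ T
    · simpa [stepSet, hi] using h3 i hi
    · by_cases hi' : i ∈ S
      · simpa [stepSet, hi] using h2 i (Finset.mem_sdiff.2 ⟨hi', hi⟩)
      · simp [stepSet, hi, hv i hi']

/-- Boxes of the partition are the orthant minus the vacant boxes, and `P_S` times the orthant is
`1`. So the boundary character is `P_S` applied to the vacancies: an alternating sum over the
corners of a unit cube. -/
lemma Generic.shapeChar_coeff (h : Generic ε) {e : Fin 4} (he : e ∉ S) (lam : Finset (S → ℕ))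
    {v : Fin 4 → ℤ} (hv : SuppIn S v) :
    (shapeChar ε lam).coeff (lat ε v) =
      ∑ T ∈ S.powerset, (-1 : ℤ) ^ T.card * vacancy lam (v - stepSet T) := by
  rw [shapeChar, MonoidAlgebra.coeff_sub, Finsupp.sub_apply, adamsChar_mul_coeff, coeff_one]
  have h1 : (if lat ε v = 1 then 1 else 0 : ℤ) = if v = 0 then 1 else 0 := by
    congr 1
    rw [eq_iff_iff, ← lat_zero (ε := ε)]
    exact ⟨fun h' => h.lat_injOn he hv (fun _ _ => rfl) h', fun h' => by rw [h']⟩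
  rw [h1, ← sum_nonneg_indicator hv, ← Finset.sum_sub_distrib]
  refine Finset.sum_congr rfl fun T hT => ?_
  have h2 : (qProd ε T)⁻¹ * lat ε v = lat ε (v - stepSet T) := by
    rw [lat_sub, lat_stepSet, mul_comm]
  rw [h2, h.boxChar_coeff he lam (hv.sub_stepSet (Finset.mem_powerset.1 hT)), ← mul_sub]
  congr 1
  ring

/-- A box which can be added to a partition. -/
def Addable (lam : Finset (S → ℕ)) (b : S → ℕ) : Prop :=
  b ∉ lam ∧ IsLowerSet (insert b lam : Set (S → ℕ))

/-- A box which can be removed from a partition. -/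
def Removable (lam : Finset (S → ℕ)) (b : S → ℕ) : Prop :=
  b ∈ lam ∧ IsLowerSet ((lam : Set (S → ℕ)) \ {b})

/-- Being a corner is a local property: any box strictly below `b` lies below some `b - e_i`, so
only the nearest neighbours matter. -/
lemma addable_iff {lam : Finset (S → ℕ)} (hl : IsLowerSet (lam : Set (S → ℕ))) (b : S → ℕ) :
    Addable lam b ↔ vacancy lam (boxExp b) = 1 ∧
      ∀ i ∈ S, vacancy lam (boxExp b - stepSet {i}) = 0 := by
  constructor
  · rintro ⟨hb, hlow⟩
    refine ⟨vacancy_eq_one.2 ⟨boxExp_nonneg b, suppIn_boxExp b, by rwa [boxOf_boxExp]⟩, ?_⟩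
    intro i hi
    by_contra hne
    have h1 : vacancy lam (boxExp b - stepSet {i}) = 1 := by
      have := vacancy_nonneg lam (boxExp b - stepSet {i})
      have := vacancy_le_one lam (boxExp b - stepSet {i})
      omega
    obtain ⟨h0, hs, hn⟩ := vacancy_eq_one.1 h1
    have hle : boxOf S (boxExp b - stepSet {i}) ≤ b := by
      intro j
      simp only [boxOf, Pi.sub_apply, boxExp, j.2, dif_pos, stepSet]
      split_ifs <;> simp
    rcases hlow hle (Set.mem_insert _ _) with h | h
    · have h2 := congrFun h ⟨i, hi⟩
      have h3 := h0 i
      simp only [boxOf, Pi.sub_apply, boxExp, hi, dif_pos, stepSet, Finset.mem_singleton,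
        if_true] at h2 h3
      omega
    · exact hn h
  · rintro ⟨h1, h2⟩
    have hb := (vacancy_eq_one.1 h1).2.2
    rw [boxOf_boxExp] at hb
    refine ⟨hb, ?_⟩
    intro x y hyx hx
    rcases hx with rfl | hx
    · by_cases hyx' : y = x
      · exact Or.inl hyx'
      · refine Or.inr ?_
        obtain ⟨i, hi⟩ : ∃ i, y i < x i := by
          by_contra! hc
          exact hyx' (le_antisymm hyx hc)
        have h3 := h2 i i.2
        have h4 : boxOf S (boxExp x - stepSet {i.1}) ∈ lam := by
          by_contra hc
          have : vacancy lam (boxExp x - stepSet {i.1}) = 1 := by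
            refine vacancy_eq_one.2 ⟨fun j => ?_, (suppIn_boxExp x).sub_stepSet
              (Finset.singleton_subset_iff.2 i.2), hc⟩
            by_cases hj : j = i.1
            · subst hj
              simp only [Pi.sub_apply, boxExp, i.2, dif_pos, stepSet, Finset.mem_singleton,
                if_true]
              have : x ⟨i.1, i.2⟩ = x i := rfl
              omega
            · simpa [stepSet, hj] using boxExp_nonneg x j
          omega
        refine hl (fun j => ?_) h4
        simp only [boxOf, Pi.sub_apply, boxExp, j.2, dif_pos, stepSet, Finset.mem_singleton]
        have hj : y j ≤ x j := hyx j
        have hj' : x ⟨j.1, j.2⟩ = x j := rfl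
        split_ifs with hji
        · have : j = i := Subtype.ext hji
          subst this
          omega
        · omega
    · exact Or.inr (hl hyx hx)

lemma removable_iff {lam : Finset (S → ℕ)} (hl : IsLowerSet (lam : Set (S → ℕ))) (b : S → ℕ) :
    Removable lam b ↔ vacancy lam (boxExp b) = 0 ∧
      ∀ i ∈ S, vacancy lam (boxExp b + stepSet {i}) = 1 := by
  have hb0 : vacancy lam (boxExp b) = 0 ↔ b ∈ lam := by
    have h1 : vacancy lam (boxExp b) = 1 ↔ b ∉ lam := by
      rw [vacancy_eq_one, boxOf_boxExp]
      exact ⟨fun h => h.2.2, fun h => ⟨boxExp_nonneg b, suppIn_boxExp b, h⟩⟩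
    have := vacancy_nonneg lam (boxExp b)
    have := vacancy_le_one lam (boxExp b)
    constructor
    · intro h
      by_contra hc
      have := h1.2 hc
      omega
    · intro h
      by_contra hc
      exact h1.1 (by omega) h
  rw [hb0]
  constructor
  · rintro ⟨hb, hlow⟩
    refine ⟨hb, fun i hi => vacancy_eq_one.2 ⟨fun j => ?_, (suppIn_boxExp b).add_stepSet
      (Finset.singleton_subset_iff.2 hi), fun hc => ?_⟩⟩
    · have := boxExp_nonneg b j
      simp only [Pi.add_apply, stepSet]
      split_ifs <;> omega
    · have hne : boxOf S (boxExp b + stepSet {i}) ≠ b := by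
        intro h
        have := congrFun h ⟨i, hi⟩
        simp only [boxOf, Pi.add_apply, boxExp, hi, dif_pos, stepSet, Finset.mem_singleton,
          if_true] at this
        omega
      have hle : b ≤ boxOf S (boxExp b + stepSet {i}) := by
        intro j
        simp only [boxOf, Pi.add_apply, boxExp, j.2, dif_pos, stepSet]
        change b j ≤ _
        have : b ⟨j.1, j.2⟩ = b j := rfl
        split_ifs <;> omega
      exact (hlow hle ⟨hc, hne⟩).2 rfl
  · rintro ⟨hb, h2⟩
    refine ⟨hb, ?_⟩
    rintro x y hyx ⟨hx, hxb⟩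
    refine ⟨hl hyx hx, ?_⟩
    rintro rfl
    obtain ⟨i, hi⟩ : ∃ i, y i < x i := by
      by_contra! hc
      exact hxb (le_antisymm hc hyx)
    refine (vacancy_eq_one.1 (h2 i i.2)).2.2 (hl (fun j => ?_) hx)
    simp only [boxOf, Pi.add_apply, boxExp, j.2, dif_pos, stepSet, Finset.mem_singleton]
    have hj := hyx j
    have hj' : y ⟨j.1, j.2⟩ = y j := rfl
    split_ifs with hji
    · have : j = i := Subtype.ext hji
      subst this
      omega
    · simp only [] at hj
      omega

end Shape

end

/-! ### Boundary characters in two and three directions -/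

section

open Character

section Shape

variable {ε : Fin 4 → ℂ} {S : Finset (Fin 4)} {lam : Finset (S → ℕ)}

lemma addable_boxOf (hl : IsLowerSet (lam : Set (S → ℕ))) {v : Fin 4 → ℤ} (h1 : vacancy lam v = 1)
    (h2 : ∀ i ∈ S, vacancy lam (v - stepSet {i}) = 0) :
    Addable lam (boxOf S v) ∧ boxExp (boxOf S v) = v := by
  have hv := vacancy_eq_one.1 h1
  have h3 := boxExp_boxOf hv.1 hv.2.1
  rw [addable_iff hl, h3]
  exact ⟨⟨h1, h2⟩, rfl⟩

lemma removable_boxOf (hl : IsLowerSet (lam : Set (S → ℕ))) {v : Fin 4 → ℤ} (hS : 2 ≤ S.card)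
    (hv : SuppIn S v) (h1 : vacancy lam v = 0)
    (h2 : ∀ i ∈ S, vacancy lam (v + stepSet {i}) = 1) :
    Removable lam (boxOf S v) ∧ boxExp (boxOf S v) = v := by
  have h0 : ∀ i, 0 ≤ v i := by
    intro i
    by_cases hi : i ∈ S
    -- Nonnegativity of the coordinate `i` is read off from the neighbour in another direction,
    -- which does not change this coordinate.
    · obtain ⟨j, hj, hji⟩ := Finset.exists_mem_ne hS i
      have := (vacancy_eq_one.1 (h2 j hj)).1 i
      simpa [stepSet, Ne.symm hji] using this
    · exact (hv i hi).ge
  have h3 := boxExp_boxOf h0 hv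
  rw [removable_iff hl, h3]
  exact ⟨⟨h1, h2⟩, rfl⟩

lemma stepSet_insert {a : Fin 4} {T : Finset (Fin 4)} (ha : a ∉ T) :
    stepSet (insert a T) = stepSet {a} + stepSet T := by
  funext i
  simp only [stepSet, Finset.mem_insert, Finset.mem_singleton, Pi.add_apply]
  by_cases h : i = a
  · subst h
    simp [ha]
  · simp [h]

lemma contentUnit_mul_qProd (b : S → ℕ) :
    contentUnit ε b * qProd ε S = lat ε (boxExp b + stepSet S) := by
  rw [lat_add, lat_stepSet, contentUnit]

/-- The coefficients of the boundary of a Young diagram. -/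
lemma Generic.shapeChar_coeff_pair (h : Generic ε) {a b e : Fin 4} (hab : a ≠ b)
    (hS : S = {a, b}) (he : e ∉ S) (hl : IsLowerSet (lam : Set (S → ℕ))) (x : ℂˣ) :
    -1 ≤ (shapeChar ε lam).coeff x ∧ (shapeChar ε lam).coeff x ≤ 1 ∧
      ((shapeChar ε lam).coeff x = 1 ↔ ∃ s, Addable lam s ∧ x = contentUnit ε s) ∧
      ((shapeChar ε lam).coeff x = -1 ↔
        ∃ s, Removable lam s ∧ x = contentUnit ε s * qProd ε S) ∧
      ((shapeChar ε lam).coeff x ≠ 0 → ∃ v, x = lat ε v ∧ SuppIn S v ∧ vacancy lam v = 1 ∧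
        vacancy lam (v - stepSet S) = 0) := by
  have hcard : 2 ≤ S.card := by rw [hS, Finset.card_pair hab]
  have haS : a ∈ S := by simp [hS]
  have hbS : b ∈ S := by simp [hS]
  have key : ∀ v, SuppIn S v → (shapeChar ε lam).coeff (lat ε v) =
      vacancy lam v - vacancy lam (v - stepSet {a}) - vacancy lam (v - stepSet {b}) +
        vacancy lam (v - stepSet S) := by
    intro v hv
    rw [h.shapeChar_coeff he lam hv]
    have : ∀ f : Finset (Fin 4) → ℤ, ∑ T ∈ S.powerset, f T = f ∅ + f {b} + (f {a} + f {a, b}) := by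
      intro f
      rw [hS, Finset.sum_powerset_insert (by simpa using hab), ← insert_empty_eq b,
        Finset.sum_powerset_insert (by simp), Finset.sum_powerset_insert (by simp)]
      simp
    have hc2 : S.card = 2 := by rw [hS, Finset.card_pair hab]
    rw [this, ← hS, hc2]
    simp only [Finset.card_empty, Finset.card_singleton, stepSet_empty, sub_zero]
    ring
  have hmem : ∀ i ∈ S, i = a ∨ i = b := by
    intro i hi
    simpa [hS] using hi
  have hst : stepSet S = stepSet {a} + stepSet {b} := by
    rw [hS, stepSet_insert (by simpa using hab)]
  have hA : ∀ s, Addable lam s → (shapeChar ε lam).coeff (contentUnit ε s) = 1 := by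
    intro s hs
    rw [addable_iff hl] at hs
    have h1 := hs.2 a haS
    have h2 := hs.2 b hbS
    have h3 := vacancy_nonneg lam (boxExp s - stepSet S)
    have h4 : vacancy lam (boxExp s - stepSet S) ≤ vacancy lam (boxExp s - stepSet {a}) := by
      refine vacancy_mono hl (fun i => ?_) ((suppIn_boxExp s).sub_stepSet (by simpa using haS))
      simp only [hst, Pi.sub_apply, Pi.add_apply]
      have : 0 ≤ stepSet {b} i := by unfold stepSet; split_ifs <;> decide
      omega
    rw [contentUnit, key _ (suppIn_boxExp s)]
    omega
  have hR : ∀ s, Removable lam s →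
      (shapeChar ε lam).coeff (contentUnit ε s * qProd ε S) = -1 := by
    intro s hs
    rw [removable_iff hl] at hs
    have h1 := hs.2 a haS
    have h2 := hs.2 b hbS
    have h4 : vacancy lam (boxExp s + stepSet {a}) ≤ vacancy lam (boxExp s + stepSet S) := by
      refine vacancy_mono hl (fun i => ?_) ((suppIn_boxExp s).add_stepSet subset_rfl)
      simp only [hst, Pi.add_apply]
      have : 0 ≤ stepSet {b} i := by unfold stepSet; split_ifs <;> decide
      omega
    have h5 := vacancy_le_one lam (boxExp s + stepSet S)
    rw [contentUnit_mul_qProd, key _ ((suppIn_boxExp s).add_stepSet subset_rfl)]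
    have e1 : boxExp s + stepSet S - stepSet {a} = boxExp s + stepSet {b} := by rw [hst]; abel
    have e2 : boxExp s + stepSet S - stepSet {b} = boxExp s + stepSet {a} := by rw [hst]; abel
    rw [e1, e2, add_sub_cancel_right]
    omega
  by_cases hx : ∃ v, SuppIn S v ∧ x = lat ε v
  swap
  · have h0 := shapeChar_coeff_eq_zero lam hx
    refine ⟨by omega, by omega, ⟨fun h1 => by omega, ?_⟩, ⟨fun h1 => by omega, ?_⟩, fun h1 =>
      (h1 h0).elim⟩
    · rintro ⟨s, hs, rfl⟩
      exact hA s hs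
    · rintro ⟨s, hs, rfl⟩
      exact hR s hs
  obtain ⟨v, hv, rfl⟩ := hx
  have hk := key v hv
  -- Monotonicity leaves few patterns for the four vacancies of the unit square. The coefficient is
  -- `1` exactly at an outer corner, `-1` exactly at an inner corner, and a nonzero value forces `v`
  -- vacant and `v - (1, 1)` not vacant.
  have m1 : vacancy lam (v - stepSet {a}) ≤ vacancy lam v := vacancy_mono hl (fun i => by
    have : 0 ≤ stepSet {a} i := by unfold stepSet; split_ifs <;> decide
    simp only [Pi.sub_apply]; omega) hv
  have m2 : vacancy lam (v - stepSet {b}) ≤ vacancy lam v := vacancy_mono hl (fun i => by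
    have : 0 ≤ stepSet {b} i := by unfold stepSet; split_ifs <;> decide
    simp only [Pi.sub_apply]; omega) hv
  have m3 : vacancy lam (v - stepSet S) ≤ vacancy lam (v - stepSet {a}) :=
    vacancy_mono hl (fun i => by
      have : 0 ≤ stepSet {b} i := by unfold stepSet; split_ifs <;> decide
      simp only [hst, Pi.sub_apply, Pi.add_apply]; omega) (hv.sub_stepSet (by simpa using haS))
  have m4 : vacancy lam (v - stepSet S) ≤ vacancy lam (v - stepSet {b}) :=
    vacancy_mono hl (fun i => by
      have : 0 ≤ stepSet {a} i := by unfold stepSet; split_ifs <;> decide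
      simp only [hst, Pi.sub_apply, Pi.add_apply]; omega) (hv.sub_stepSet (by simpa using hbS))
  have n1 := vacancy_nonneg lam (v - stepSet S)
  have n2 := vacancy_le_one lam v
  refine ⟨by omega, by omega, ⟨fun h1 => ?_, ?_⟩, ⟨fun h1 => ?_, ?_⟩, fun h1 => ?_⟩
  · have := addable_boxOf (v := v) hl (by omega) (fun i hi => by
      rcases hmem i hi with rfl | rfl <;> omega)
    exact ⟨_, this.1, by rw [contentUnit, this.2]⟩
  · rintro ⟨s, hs, hs'⟩
    rw [hs']
    exact hA s hs
  · have e1 : v - stepSet S + stepSet {a} = v - stepSet {b} := by rw [hst]; abel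
    have e2 : v - stepSet S + stepSet {b} = v - stepSet {a} := by rw [hst]; abel
    have := removable_boxOf (v := v - stepSet S) hl hcard (hv.sub_stepSet subset_rfl) (by omega)
      (fun i hi => by
        rcases hmem i hi with rfl | rfl
        · rw [e1]; omega
        · rw [e2]; omega)
    exact ⟨_, this.1, by rw [contentUnit_mul_qProd, this.2, sub_add_cancel]⟩
  · rintro ⟨s, hs, hs'⟩
    rw [hs']
    exact hR s hs
  · exact ⟨v, rfl, hv, by omega, by omega⟩

/-- The boundary of a Young diagram meets every diagonal at most once. -/
lemma Generic.eq_zero_of_diagonal (h : Generic ε) {a b e : Fin 4} (hab : a ≠ b)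
    (hS : S = {a, b}) (he : e ∉ S) (hl : IsLowerSet (lam : Set (S → ℕ))) {x : ℂˣ} {m : ℤ}
    (h1 : (shapeChar ε lam).coeff x ≠ 0)
    (h2 : (shapeChar ε lam).coeff (x * qProd ε S ^ m) ≠ 0) : m = 0 := by
  have aux : ∀ (x : ℂˣ) (m : ℤ), (shapeChar ε lam).coeff x ≠ 0 →
      (shapeChar ε lam).coeff (x * qProd ε S ^ m) ≠ 0 → m ≤ 0 := by
    intro x m h1 h2
    obtain ⟨v, rfl, hv, hv1, -⟩ := (h.shapeChar_coeff_pair hab hS he hl x).2.2.2.2 h1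
    obtain ⟨w, hw, hw', -, hw0⟩ := (h.shapeChar_coeff_pair hab hS he hl _).2.2.2.2 h2
    have hvw : w = v + m • stepSet S := by
      refine h.lat_injOn he hw' (fun i hi => ?_) ?_
      · simp [stepSet, hi, hv i hi]
      · have : lat ε (m • stepSet S) = qProd ε S ^ m := by
          rw [← lat_stepSet]
          simp [lat, zpow_mul', Finset.prod_zpow]
        rw [← hw, lat_add, this]
    by_contra hm
    -- If `m > 0` then `w - (1, 1)` still dominates `v`, hence would be vacant.
    have : vacancy lam v ≤ vacancy lam (w - stepSet S) := by
      refine vacancy_mono hl (fun i => ?_) (hw'.sub_stepSet subset_rfl)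
      rw [hvw]
      simp only [stepSet, Pi.add_apply, Pi.sub_apply, Pi.smul_apply, smul_eq_mul]
      split_ifs <;> omega
    omega
  refine le_antisymm (aux x m h1 h2) ?_
  have := aux (x * qProd ε S ^ m) (-m) h2 (by simpa using h1)
  omega

/-- The positive coefficients of the boundary of a plane partition. -/
lemma Generic.shapeChar_coeff_triple (h : Generic ε) {a b c e : Fin 4} (hab : a ≠ b) (hac : a ≠ c)
    (hbc : b ≠ c) (hS : S = {a, b, c}) (he : e ∉ S) (hl : IsLowerSet (lam : Set (S → ℕ))) (x : ℂˣ) :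
    (shapeChar ε lam).coeff x ≤ 1 ∧
      ((shapeChar ε lam).coeff x = 1 ↔ ∃ s, (Addable lam s ∧ x = contentUnit ε s) ∨
        (Removable lam s ∧ x = contentUnit ε s * qProd ε S)) := by
  have hcard : 2 ≤ S.card := by
    rw [hS, Finset.card_insert_of_notMem (by simp [hab, hac]), Finset.card_pair hbc]
    decide
  have haS : a ∈ S := by simp [hS]
  have hbS : b ∈ S := by simp [hS]
  have hcS : c ∈ S := by simp [hS]
  have hst : stepSet S = stepSet {a} + stepSet {b} + stepSet {c} := by
    rw [hS, stepSet_insert (by simp [hab, hac]), stepSet_insert (by simpa using hbc), add_assoc]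
  have key : ∀ v, SuppIn S v → (shapeChar ε lam).coeff (lat ε v) =
      vacancy lam v - vacancy lam (v - stepSet {a}) - vacancy lam (v - stepSet {b})
        - vacancy lam (v - stepSet {c}) + vacancy lam (v - stepSet {a} - stepSet {b}) +
        vacancy lam (v - stepSet {a} - stepSet {c}) + vacancy lam (v - stepSet {b} - stepSet {c}) -
        vacancy lam (v - stepSet S) := by
    intro v hv
    rw [h.shapeChar_coeff he lam hv]
    have : ∀ f : Finset (Fin 4) → ℤ, ∑ T ∈ S.powerset, f T =
        (f ∅ + f {c} + (f {b} + f {b, c})) + (f {a} + f {a, c} + (f {a, b} + f {a, b, c})) := by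
      intro f
      rw [hS, Finset.sum_powerset_insert (by simp [hab, hac]),
        Finset.sum_powerset_insert (by simpa using hbc),
        Finset.sum_powerset_insert (by simpa using hbc), ← insert_empty_eq c]
      simp only [Finset.sum_powerset_insert (Finset.notMem_empty c)]
      simp
    rw [this, ← hS, stepSet_insert (a := b) (T := {c}) (by simpa using hbc),
      stepSet_insert (a := a) (T := {c}) (by simpa using hac),
      stepSet_insert (a := a) (T := {b}) (by simpa using hab), Finset.card_pair hbc,
      Finset.card_pair hac, Finset.card_pair hab]
    have hc3 : S.card = 3 := by
      rw [hS, Finset.card_insert_of_notMem (by simp [hab, hac]), Finset.card_pair hbc]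
    rw [hc3]
    simp only [Finset.card_empty, Finset.card_singleton, stepSet_empty, sub_zero, ← sub_sub]
    ring
  have hmem : ∀ i ∈ S, i = a ∨ i = b ∨ i = c := by
    intro i hi
    simpa [hS] using hi
  have hp : ∀ i j, 0 ≤ stepSet {i} j := by
    intro i j
    unfold stepSet
    split_ifs <;> decide
  have mono : ∀ (v w : Fin 4 → ℤ), SuppIn S w → (∀ j, v j ≤ w j) →
      vacancy lam v ≤ vacancy lam w := fun v w hw hvw => vacancy_mono hl hvw hw
  have hA : ∀ s, Addable lam s → (shapeChar ε lam).coeff (contentUnit ε s) = 1 := by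
    intro s hs
    rw [addable_iff hl] at hs
    have h1 := hs.2 a haS
    have h2 := hs.2 b hbS
    have h3 := hs.2 c hcS
    have sb := suppIn_boxExp s
    have sa := sb.sub_stepSet (T := {a}) (by simpa using haS)
    have sc := sb.sub_stepSet (T := {b}) (by simpa using hbS)
    have z1 := mono (boxExp s - stepSet {a} - stepSet {b}) _ sa
      (fun j => by have := hp b j; simp only [Pi.sub_apply]; omega)
    have z2 := mono (boxExp s - stepSet {a} - stepSet {c}) _ sa
      (fun j => by have := hp c j; simp only [Pi.sub_apply]; omega)
    have z3 := mono (boxExp s - stepSet {b} - stepSet {c}) _ sc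
      (fun j => by have := hp c j; simp only [Pi.sub_apply]; omega)
    have z4 := mono (boxExp s - stepSet S) _ sa (fun j => by
      have := hp c j; have := hp b j; simp only [hst, Pi.sub_apply, Pi.add_apply]; omega)
    have y1 := vacancy_nonneg lam (boxExp s - stepSet {a} - stepSet {b})
    have y2 := vacancy_nonneg lam (boxExp s - stepSet {a} - stepSet {c})
    have y3 := vacancy_nonneg lam (boxExp s - stepSet {b} - stepSet {c})
    have y4 := vacancy_nonneg lam (boxExp s - stepSet S)
    rw [contentUnit, key _ sb]
    omega
  have hR : ∀ s, Removable lam s →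
      (shapeChar ε lam).coeff (contentUnit ε s * qProd ε S) = 1 := by
    intro s hs
    rw [removable_iff hl] at hs
    have sb := (suppIn_boxExp s).add_stepSet (T := S) subset_rfl
    rw [contentUnit_mul_qProd, key _ sb, add_sub_cancel_right]
    have one : ∀ i ∈ S, ∀ w, SuppIn S w → (∀ j, (boxExp s + stepSet {i}) j ≤ w j) →
        vacancy lam w = 1 := by
      intro i hi w hw hiw
      have h1 := hs.2 i hi
      have h2 := mono _ w hw hiw
      have h3 := vacancy_le_one lam w
      omega
    have sub : ∀ i ∈ S, ∀ w, SuppIn S w → SuppIn S (w - stepSet {i}) := fun i hi w hw =>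
      hw.sub_stepSet (by simpa using hi)
    have e : ∀ j, stepSet S j = stepSet {a} j + stepSet {b} j + stepSet {c} j := fun j => by
      rw [hst]; rfl
    rw [one a haS _ sb, one b hbS _ (sub a haS _ sb), one a haS _ (sub b hbS _ sb),
      one a haS _ (sub c hcS _ sb), one c hcS _ (sub b hbS _ (sub a haS _ sb)),
      one b hbS _ (sub c hcS _ (sub a haS _ sb)), one a haS _ (sub c hcS _ (sub b hbS _ sb)), hs.1]
    · norm_num
    all_goals
      intro j
      have := hp a j
      have := hp b j
      have := hp c j
      have := e j
      simp only [Pi.sub_apply, Pi.add_apply]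
      omega
  by_cases hx : ∃ v, SuppIn S v ∧ x = lat ε v
  swap
  · have h0 := shapeChar_coeff_eq_zero lam hx
    refine ⟨by omega, ⟨fun h1 => by omega, ?_⟩⟩
    rintro ⟨s, ⟨hs, rfl⟩ | ⟨hs, rfl⟩⟩
    · exact hA s hs
    · exact hR s hs
  obtain ⟨v, hv, rfl⟩ := hx
  have hk := key v hv
  have sa := hv.sub_stepSet (T := {a}) (by simpa using haS)
  have sb := hv.sub_stepSet (T := {b}) (by simpa using hbS)
  have sc := hv.sub_stepSet (T := {c}) (by simpa using hcS)
  have d1 : ∀ (w : Fin 4 → ℤ) (i : Fin 4), SuppIn S w →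
      vacancy lam (w - stepSet {i}) ≤ vacancy lam w := fun w i hw =>
    mono _ _ hw fun j => by have := hp i j; simp only [Pi.sub_apply]; omega
  have c1 := d1 v a hv
  have c2 := d1 v b hv
  have c3 := d1 v c hv
  have c4 := d1 _ b sa
  have c5 := d1 _ c sa
  have c6 := d1 _ c sb
  have e1 : v - stepSet {a} - stepSet {b} = v - stepSet {b} - stepSet {a} := by abel
  have e2 : v - stepSet {a} - stepSet {c} = v - stepSet {c} - stepSet {a} := by abel
  have e3 : v - stepSet {b} - stepSet {c} = v - stepSet {c} - stepSet {b} := by abel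
  have c7 := d1 _ a sb
  have c8 := d1 _ a sc
  have c9 := d1 _ b sc
  rw [← e1] at c7
  rw [← e2] at c8
  rw [← e3] at c9
  have f1 : v - stepSet {a} - stepSet {b} = v - stepSet S + stepSet {c} := by rw [hst]; abel
  have f2 : v - stepSet {a} - stepSet {c} = v - stepSet S + stepSet {b} := by rw [hst]; abel
  have f3 : v - stepSet {b} - stepSet {c} = v - stepSet S + stepSet {a} := by rw [hst]; abel
  have g1 := vacancy_le_one lam v
  have g2 := vacancy_nonneg lam (v - stepSet S)
  have up : ∀ i ∈ S, vacancy lam (v - stepSet S) ≤ vacancy lam (v - stepSet S + stepSet {i}) :=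
    fun i hi => mono _ _ ((hv.sub_stepSet subset_rfl).add_stepSet (by simpa using hi)) fun j => by
      have := hp i j; simp only [Pi.add_apply]; omega
  have u1 := up c hcS
  have u2 := up b hbS
  have u3 := up a haS
  rw [← f1] at u1
  rw [← f2] at u2
  rw [← f3] at u3
  refine ⟨by omega, ⟨fun h1 => ?_, ?_⟩⟩
  -- By monotonicity a coefficient `1` allows two patterns on the eight corners of the cube: only
  -- `v` is vacant, or only `v - (1, 1, 1)` is not. A single neighbour tells them apart.
  · by_cases h0 : vacancy lam (v - stepSet {a}) = 0
    · have := addable_boxOf (v := v) hl (by omega) (fun i hi => by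
        rcases hmem i hi with rfl | rfl | rfl <;> omega)
      exact ⟨_, Or.inl ⟨this.1, by rw [contentUnit, this.2]⟩⟩
    · have := removable_boxOf (v := v - stepSet S) hl hcard (hv.sub_stepSet subset_rfl) (by omega)
        (fun i hi => by
          rcases hmem i hi with rfl | rfl | rfl
          · rw [← f3]; omega
          · rw [← f2]; omega
          · rw [← f1]; omega)
      exact ⟨_, Or.inr ⟨this.1, by rw [contentUnit_mul_qProd, this.2, sub_add_cancel]⟩⟩
  · rintro ⟨s, ⟨hs, hs'⟩ | ⟨hs, hs'⟩⟩
    · rw [hs']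
      exact hA s hs
    · rw [hs']
      exact hR s hs

/-- A box addable to a partition is not diagonally above a removable box. -/
lemma Addable.ne_removable (hl : IsLowerSet (lam : Set (S → ℕ))) (hS : 2 ≤ S.card) {s t : S → ℕ}
    (hs : Addable lam s) (ht : Removable lam t) : boxExp s ≠ boxExp t + stepSet S := by
  intro hst
  rw [addable_iff hl] at hs
  rw [removable_iff hl] at ht
  obtain ⟨i, hi, j, hj, hij⟩ := Finset.one_lt_card.1 hS
  have h1 := hs.2 i hi
  have h2 := ht.2 j hj
  -- If `s` were `t + (1, …, 1)`, then `t + e_j ≤ s - e_i` for two distinct directions, although the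
  -- former is vacant and the latter is not.
  have h3 : vacancy lam (boxExp t + stepSet {j}) ≤ vacancy lam (boxExp s - stepSet {i}) := by
    refine vacancy_mono hl (fun k => ?_) ((suppIn_boxExp s).sub_stepSet (by simpa using hi))
    rw [hst]
    simp only [stepSet, Pi.add_apply, Pi.sub_apply, Finset.mem_singleton]
    have : k = j → k ∈ S := by rintro rfl; exact hj
    have : k = i → k ∈ S := by rintro rfl; exact hi
    have : k = i → k ≠ j := by rintro rfl; exact hij
    split_ifs <;> first | omega | (exfalso; tauto)
  omega

/-! ### Finiteness -/

/-- A lower set containing `b` contains the segments below `b` in every direction, so all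
coordinates are bounded by the number of boxes. -/
lemma Partition.finite_card_le (S : Finset (Fin 4)) (n : ℕ) :
    {lam : Partition S | lam.1.card ≤ n}.Finite := by
  have h1 : {lam : Finset (S → ℕ) | lam ⊆ Finset.Icc 0 fun _ => n}.Finite :=
    (Finset.finite_toSet (Finset.powerset (Finset.Icc (0 : S → ℕ) fun _ => n))).subset
      fun lam hl => Finset.mem_coe.2 (Finset.mem_powerset.2 hl)
  refine Set.Finite.of_finite_image (f := Subtype.val) (h1.subset ?_) Subtype.val_injective.injOn
  rintro _ ⟨lam, hlam, rfl⟩ b hb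
  rw [Finset.mem_Icc]
  refine ⟨fun _ => Nat.zero_le _, fun i => ?_⟩
  have h2 : (Finset.range (b i + 1)).image (fun k => Function.update b i k) ⊆ lam.1 := by
    intro x hx
    obtain ⟨k, hk, rfl⟩ := Finset.mem_image.1 hx
    refine lam.2 (fun j => ?_) hb
    by_cases hj : j = i
    · subst hj
      simpa using Nat.lt_succ_iff.1 (Finset.mem_range.1 hk)
    · simp [hj]
  have h3 := Finset.card_le_card h2
  rw [Finset.card_image_of_injective _ (Function.update_injective b i), Finset.card_range] at h3
  exact (Nat.le_succ _).trans (h3.trans hlam)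

/-- A box with all coordinates at least `m` forces a hook with two arms of length `m`. The factor
`2` is essential for the finiteness in the facet-vertex case, where `|λ|` grows along with the depth
of the box. -/
lemma Partition.card_ge_of_mem {a b : S} (hab : a ≠ b) (lam : Partition S) {s : S → ℕ} {m : ℕ}
    (hm : ∀ i, m ≤ s i) (hs : s ∈ lam.1) : 2 * m + 1 ≤ lam.1.card := by
  have h2 : (Finset.range (m + 1)).image (fun k => Function.update (fun _ => 0) a k) ∪
      (Finset.Icc 1 m).image (fun k => Function.update (fun _ => 0) b k) ⊆ lam.1 := by
    have aux : ∀ (c : S) (k : ℕ), k ≤ m → Function.update (fun _ => 0) c k ∈ lam.1 := by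
      intro c k hk
      refine lam.2 (fun j => ?_) hs
      by_cases hj : j = c
      · subst hj
        simpa using hk.trans (hm j)
      · simp [hj]
    intro x hx
    rcases Finset.mem_union.1 hx with hx | hx <;> obtain ⟨k, hk, rfl⟩ := Finset.mem_image.1 hx
    · exact aux a k (Nat.lt_succ_iff.1 (Finset.mem_range.1 hk))
    · exact aux b k (Finset.mem_Icc.1 hk).2
  have h3 := Finset.card_le_card h2
  rw [Finset.card_union_of_disjoint,
    Finset.card_image_of_injective _ (Function.update_injective _ a),
    Finset.card_image_of_injective _ (Function.update_injective _ b), Finset.card_range,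
    Nat.card_Icc] at h3
  · omega
  · rw [Finset.disjoint_left]
    intro x hx hx'
    obtain ⟨k, hk, rfl⟩ := Finset.mem_image.1 hx
    obtain ⟨l, hl, hl'⟩ := Finset.mem_image.1 hx'
    have := congrFun hl' b
    rw [Function.update_self, Function.update_of_ne hab.symm] at this
    have := (Finset.mem_Icc.1 hl).1
    omega

end Shape

end

/-! ### Index calculus -/

section

namespace Character

lemma index_add (M N : Character) : index (M + N) = index M * index N := prod_add _ M N

lemma index_sub (M N : Character) : index (M - N) = index M / index N := prod_sub _ M N

lemma signedDet_add (M N : Character) : signedDet (M + N) = signedDet M * signedDet N :=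
  prod_add _ M N

lemma signedDet_neg (M : Character) : signedDet (-M) = (signedDet M)⁻¹ := prod_neg _ M

lemma signedDet_sub (M N : Character) : signedDet (M - N) = signedDet M / signedDet N :=
  prod_sub _ M N

lemma signedDet_point (v : ℂˣ) : signedDet (point v) = -v := prod_point _ v

lemma signedDet_one : signedDet 1 = -1 := signedDet_point 1

lemma signedDet_zero : signedDet 0 = 1 := prod_zero _

lemma index_zero : index 0 = 1 := prod_zero _

lemma index_point (v : ℂˣ) : index (point v) = facUnit v := prod_point _ v

lemma signedDet_dual (M : Character) : signedDet (dual M) = (signedDet M)⁻¹ := by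
  induction M using induction with
  | h0 => simp [signedDet_zero]
  | hadd v M h => rw [map_add, signedDet_add, h, signedDet_add, dual_point, signedDet_point,
      signedDet_point, mul_inv, inv_neg]
  | hsub v M h => rw [map_sub, signedDet_sub, h, signedDet_sub, dual_point, signedDet_point,
      signedDet_point, inv_div', inv_neg, div_eq_mul_inv]

lemma signedDet_point_mul (v : ℂˣ) (M : Character) :
    signedDet (point v * M) = v ^ deg M * signedDet M := by
  induction M using induction with
  | h0 => simp [signedDet_zero]
  | hadd w M h => rw [mul_add, signedDet_add, h, signedDet_add, point_mul, signedDet_point,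
      signedDet_point, map_add, deg_point, zpow_add_one, ← mul_neg]; exact mul_mul_mul_comm _ _ _ _
  | hsub w M h => rw [mul_sub, signedDet_sub, h, signedDet_sub, point_mul, signedDet_point,
      signedDet_point, map_sub, deg_point, zpow_sub_one, ← mul_neg, ← div_eq_mul_inv]
                  exact mul_div_mul_comm _ _ _ _

/-- The two halves of `(1 - v) M` have the same signed determinant except for the rescaling by `v`,
so only the degree of `M` survives. -/
lemma signedDet_one_sub_mul (v : ℂˣ) (M : Character) :
    signedDet ((1 - point v) * M) = v ^ (-deg M) := by
  rw [sub_mul, one_mul, signedDet_sub, signedDet_point_mul, zpow_neg]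
  simp

/-- `1 - v = (1 - v⁻¹)(-v)`, except that at `v = 1` both omitted factors count as `1` and the `-v =
-1` must be compensated. -/
lemma facUnit_inv (v : ℂˣ) : facUnit v = facUnit v⁻¹ * (-v) * if v = 1 then -1 else 1 := by
  ext
  by_cases h : v = 1
  · subst h
    simp [coe_facUnit]
  · have h' : v⁻¹ ≠ 1 := by simpa using h
    rw [if_neg h, mul_one, Units.val_mul, coe_facUnit, coe_facUnit, fac_of_ne h, fac_of_ne h']
    have := v.ne_zero
    push_cast
    field_simp
    ring

/-- The index of an antisymmetric character. -/
lemma index_sub_dual (M : Character) :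
    index (M - dual M) = signedDet M * (-1) ^ M.coeff 1 := by
  induction M using induction with
  | h0 => simp [signedDet_zero, index_zero]
  | hadd v M h =>
    -- Each point contributes the ratio of `1 - v` to `1 - v⁻¹`, that is `-v`, with one extra sign
    -- for each occurrence of `v = 1`.
    have e : M + point v - dual (M + point v) = (M - dual M) + (point v - point v⁻¹) := by
      rw [map_add, dual_point]; ring
    rw [e, index_add, h, index_sub, index_point, index_point, facUnit_inv, signedDet_add,
      signedDet_point, MonoidAlgebra.coeff_add, Finsupp.add_apply, coeff_point, zpow_add,
      mul_assoc (facUnit v⁻¹), mul_div_cancel_left]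
    split_ifs <;> simp <;> rw [mul_right_comm]
  | hsub v M h =>
    have e : M - point v - dual (M - point v) = (M - dual M) - (point v - point v⁻¹) := by
      rw [map_sub, dual_point]; ring
    rw [e, index_sub, h, index_sub, index_point, index_point, facUnit_inv, signedDet_sub,
      signedDet_point, MonoidAlgebra.coeff_sub, Finsupp.sub_apply, coeff_point, zpow_sub,
      mul_assoc (facUnit v⁻¹), mul_div_cancel_left]
    split_ifs <;> simp [div_eq_mul_inv] <;> rw [mul_right_comm]

lemma index_eq_of_eq_add {X Y M : Character} (h : X = Y + (M - dual M)) :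
    index X = index Y * (signedDet M * (-1) ^ M.coeff 1) := by
  rw [h, index_add, index_sub_dual]

lemma coeff_sub_apply (M N : Character) (v : ℂˣ) : (M - N).coeff v = M.coeff v - N.coeff v := by
  rw [MonoidAlgebra.coeff_sub, Finsupp.sub_apply]

lemma coeff_add_apply (M N : Character) (v : ℂˣ) : (M + N).coeff v = M.coeff v + N.coeff v := by
  rw [MonoidAlgebra.coeff_add, Finsupp.add_apply]

lemma coeff_neg_apply (M : Character) (v : ℂˣ) : (-M).coeff v = -M.coeff v := by
  rw [MonoidAlgebra.coeff_neg, Finsupp.neg_apply]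

end Character

open Character

variable {ε : Fin 4 → ℂ} {S : Finset (Fin 4)}

/-- Factor by factor, `q (1 - q⁻¹) = -(1 - q)`. -/
lemma dual_adamsChar (S : Finset (Fin 4)) :
    point (qProd ε S) * dual (adamsChar ε S) = (-1) ^ S.card * adamsChar ε S := by
  induction S using Finset.induction_on with
  | empty => simp [qProd, adamsChar, point_one]
  | insert a S ha ih =>
    rw [qProd, adamsChar, Finset.prod_insert ha, Finset.prod_insert ha, Finset.card_insert_of_notMem
      ha, map_mul, ← point_mul, map_sub, map_one, dual_point]
    change point (qUnit ε a) * point (qProd ε S) * ((1 - point (qUnit ε a)⁻¹) *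
      dual (adamsChar ε S)) = (-1) ^ (S.card + 1) * ((1 - point (qUnit ε a)) * adamsChar ε S)
    have e : point (qUnit ε a) * point (qUnit ε a)⁻¹ = 1 := by
      rw [point_mul, mul_inv_cancel, point_one]
    linear_combination (point (qUnit ε a) - 1) * ih - point (qProd ε S) * dual (adamsChar ε S) * e

lemma deg_adamsChar (hS : S.Nonempty) : deg (adamsChar ε S) = 0 := by
  obtain ⟨i, hi⟩ := hS
  rw [adamsChar, ← Finset.mul_prod_erase S _ hi]
  simp

/-- One factor `1 - q_i` reduces the determinant to a power of `q_i` given by a degree, and a second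
factor makes this degree zero. -/
lemma signedDet_adamsChar_mul (hS : 2 ≤ S.card) (M : Character) :
    signedDet (adamsChar ε S * M) = 1 := by
  obtain ⟨i, hi, j, hj, hij⟩ := Finset.one_lt_card.1 hS
  have hne : (S.erase i).Nonempty := ⟨j, Finset.mem_erase.2 ⟨hij.symm, hj⟩⟩
  rw [adamsChar, ← Finset.mul_prod_erase S _ hi, mul_assoc, signedDet_one_sub_mul, map_mul]
  change _ ^ (-(deg (adamsChar ε (S.erase i)) * _)) = _
  rw [deg_adamsChar hne]
  simp

lemma deg_shapeChar (hS : S.Nonempty) (lam : Finset (S → ℕ)) : deg (shapeChar ε lam) = 1 := by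
  simp [shapeChar, deg_adamsChar hS]

lemma signedDet_shapeChar (hS : 2 ≤ S.card) (lam : Finset (S → ℕ)) :
    signedDet (shapeChar ε lam) = -1 := by
  rw [shapeChar, signedDet_sub, signedDet_one, signedDet_adamsChar_mul hS, div_one]

lemma boxChar_insert {lam : Finset (S → ℕ)} {s : S → ℕ} (hs : s ∉ lam) :
    boxChar ε (insert s lam) = boxChar ε lam + point (contentUnit ε s) := by
  rw [boxChar, Finset.sum_insert hs, add_comm, boxChar]

lemma shapeChar_insert {lam : Finset (S → ℕ)} {s : S → ℕ} (hs : s ∉ lam) :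
    shapeChar ε (insert s lam) =
      shapeChar ε lam - adamsChar ε S * point (contentUnit ε s) := by
  rw [shapeChar, boxChar_insert hs, shapeChar]
  ring

/-! ### The `U(1)` partition functions as indices -/

/-- The character whose index is the Nekrasov factor. -/
def nekChar (ε : Fin 4 → ℂ) (lam : Finset (S → ℕ)) : Character :=
  point (qProd ε S) * boxChar ε lam + dual (boxChar ε lam) -
    adamsChar ε S * (boxChar ε lam * dual (boxChar ε lam))

lemma index_point_mul_boxChar (v : ℂˣ) (lam : Finset (S → ℕ)) :
    (index (point v * boxChar ε lam) : ℂ) = ∏ x ∈ lam, fac (v * content ε x) := by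
  rw [boxChar, Finset.mul_sum, index, prod_sum, Units.coe_prod]
  refine Finset.prod_congr rfl fun x _ => ?_
  rw [point_mul, prod_point, coe_facUnit, Units.val_mul, coe_contentUnit]

lemma index_point_mul_dual_boxChar (v : ℂˣ) (lam : Finset (S → ℕ)) :
    (index (point v * dual (boxChar ε lam)) : ℂ) = ∏ x ∈ lam, fac (v / content ε x) := by
  rw [boxChar, map_sum, Finset.mul_sum, index, prod_sum, Units.coe_prod]
  refine Finset.prod_congr rfl fun x _ => ?_
  rw [dual_point, point_mul, prod_point, coe_facUnit, Units.val_mul, Units.val_inv_eq_inv_val,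
    coe_contentUnit, div_eq_mul_inv]

lemma index_mul_boxChar_mul_dual (M : Character) (lam : Finset (S → ℕ)) :
    index (M * (boxChar ε lam * dual (boxChar ε lam))) = ∏ x ∈ lam, ∏ y ∈ lam,
      index (M * point (contentUnit ε x * (contentUnit ε y)⁻¹)) := by
  rw [boxChar, map_sum, Finset.sum_mul_sum, Finset.mul_sum, index, prod_sum]
  refine Finset.prod_congr rfl fun x _ => ?_
  rw [Finset.mul_sum, prod_sum]
  refine Finset.prod_congr rfl fun y _ => ?_
  rw [dual_point, point_mul]
  rfl

lemma coe_mul_inv_contentUnit (x y : S → ℕ) :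
    ((contentUnit ε x * (contentUnit ε y)⁻¹ : ℂˣ) : ℂ) = content ε x / content ε y := by
  rw [Units.val_mul, Units.val_inv_eq_inv_val, coe_contentUnit, coe_contentUnit, div_eq_mul_inv]

lemma index_eq_strucS {a b : Fin 4} (hab : a ≠ b) (v : ℂˣ) :
    (index (-(adamsChar ε {a, b} * point v)) : ℂ) = strucS ε a b v := by
  have e : -(adamsChar ε {a, b} * point v) = point (qUnit ε a * v) + point (qUnit ε b * v) -
      (point v + point (qUnit ε a * qUnit ε b * v)) := by
    rw [adamsChar, Finset.prod_pair hab]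
    simp only [← point_mul]
    ring
  rw [e, index_sub, index_add, index_add]
  simp only [index_point, strucS]
  push_cast
  rfl

lemma nekrasov_eq_index {a b : Fin 4} (hab : a ≠ b) (v : ℂˣ)
    (lam : Finset (({a, b} : Finset (Fin 4)) → ℕ)) :
    nekrasov ε a b v lam = index (point v * nekChar ε lam) := by
  have e : point v * nekChar ε lam = point (qProd ε {a, b} * v) * boxChar ε lam +
      point v * dual (boxChar ε lam) +
      -(adamsChar ε {a, b} * point v) * (boxChar ε lam * dual (boxChar ε lam)) := by
    rw [nekChar, ← point_mul]
    ring
  rw [e, index_add, index_add, Units.val_mul, Units.val_mul, index_point_mul_boxChar,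
    index_point_mul_dual_boxChar, index_mul_boxChar_mul_dual, nekrasov, Units.coe_prod]
  congr 1
  · congr 1
    refine Finset.prod_congr rfl fun x _ => ?_
    rw [qProd, Finset.prod_pair hab]
    push_cast
    rw [coe_qUnit, coe_qUnit, mul_assoc _ (v : ℂ)]
  · refine Finset.prod_congr rfl fun x _ => ?_
    rw [Units.coe_prod]
    refine Finset.prod_congr rfl fun y _ => ?_
    rw [neg_mul, mul_assoc, point_mul, index_eq_strucS hab, Units.val_mul,
      coe_mul_inv_contentUnit, mul_div_assoc]

/-- The D4 partition function, computed with a direction `c` outside `S`. -/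
def edgeCoeff (ε : Fin 4 → ℂ) (c : Fin 4) (lam : Finset (S → ℕ)) : ℂˣ :=
  (qUnit ε c ^ lam.card)⁻¹ * index ((point (qUnit ε c) - 1) * nekChar ε lam)

lemma ZD4_eq {a b : Fin 4} (hab : a ≠ b) (lam : Finset (({a, b} : Finset (Fin 4)) → ℕ)) :
    ZD4 ε a b lam = edgeCoeff ε ((({a, b} : Finset (Fin 4))ᶜ).inf id) lam := by
  have h1 := nekrasov_eq_index (ε := ε) hab (qUnit ε ((({a, b} : Finset (Fin 4))ᶜ).inf id)) lam
  have h2 := nekrasov_eq_index (ε := ε) hab 1 lam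
  rw [point_one, one_mul, Units.val_one] at h2
  rw [coe_qUnit] at h1
  simp only [ZD4]
  rw [h1, h2, edgeCoeff, sub_mul, one_mul, index_sub]
  push_cast
  rfl

/-- The D6 partition function. -/
def facetCoeff (ε : Fin 4 → ℂ) (a : Fin 4) (lam : Finset (S → ℕ)) : ℂˣ :=
  index ((point (qUnit ε a) - 1) * dual (boxChar ε lam) +
    adamsChar ε S * (boxChar ε lam * dual (boxChar ε lam)))

/-- The bilinear terms of `nekChar` regroup, through `q_S dual P_S = P_S`, into `y`: the dual
boundary recentred at the new box. The ratio thus takes the form in which the residues are also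
expressed. -/
lemma edgeCoeff_insert (hS : S.card = 2) (c : Fin 4) {lam : Finset (S → ℕ)} {s : S → ℕ}
    (hs : s ∉ lam) {y : Character} (hy : y = point (contentUnit ε s) * dual (shapeChar ε lam)) :
    edgeCoeff ε c (insert s lam) = edgeCoeff ε c lam * ((qUnit ε c)⁻¹ *
      index ((1 - point (qUnit ε c)) * (-(point (qProd ε S) * y) - dual y + adamsChar ε S))) := by
  have hσ : point (contentUnit ε s) * point (contentUnit ε s)⁻¹ = 1 := by
    rw [point_mul, mul_inv_cancel, point_one]
  have hd := dual_adamsChar (ε := ε) S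
  rw [hS, neg_one_sq, one_mul] at hd
  have e : (point (qUnit ε c) - 1) * nekChar ε (insert s lam) =
      (point (qUnit ε c) - 1) * nekChar ε lam +
      (1 - point (qUnit ε c)) * (-(point (qProd ε S) * y) - dual y + adamsChar ε S) := by
    rw [hy, nekChar, nekChar, boxChar_insert hs, shapeChar]
    simp only [map_add, map_sub, map_mul, map_one, dual_point, dual_dual]
    linear_combination (1 - point (qUnit ε c)) * adamsChar ε S * hσ -
      (1 - point (qUnit ε c)) * point (contentUnit ε s) * dual (boxChar ε lam) * hd
  rw [edgeCoeff, e, index_add, edgeCoeff, Finset.card_insert_of_notMem hs, pow_succ, mul_inv]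
  exact mul_mul_mul_comm _ _ _ _

/-- As for edges, but with three directions, where `q_S = q_a⁻¹` and `q_S dual P_S = -P_S`. The
first two terms come from the framing factor of the new box. -/
lemma facetCoeff_insert (hS : S.card = 3) {a : Fin 4} (ha : qProd ε S * qUnit ε a = 1)
    {lam : Finset (S → ℕ)} {s : S → ℕ}
    (hs : s ∉ lam) {y : Character} (hy : y = point (contentUnit ε s) * dual (shapeChar ε lam)) :
    facetCoeff ε a (insert s lam) = facetCoeff ε a lam *
      index (point (qUnit ε a) * point (contentUnit ε s)⁻¹ -
        point (qUnit ε a)⁻¹ * point (contentUnit ε s) + point (qUnit ε a)⁻¹ * y - dual y +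
        adamsChar ε S) := by
  have hσ : point (contentUnit ε s) * point (contentUnit ε s)⁻¹ = 1 := by
    rw [point_mul, mul_inv_cancel, point_one]
  have hd := dual_adamsChar (ε := ε) S
  rw [hS, eq_inv_of_mul_eq_one_left ha] at hd
  rw [facetCoeff, facetCoeff, ← index_add]
  congr 1
  rw [hy, boxChar_insert hs, shapeChar]
  simp only [map_add, map_sub, map_mul, map_one, dual_point, dual_dual]
  linear_combination adamsChar ε S * hσ + point (contentUnit ε s) * dual (boxChar ε lam) * hd

lemma qProd_mul_qProd_compl (h : Generic ε) (S : Finset (Fin 4)) :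
    qProd ε S * qProd ε Sᶜ = 1 := by
  rw [qProd, qProd, Finset.prod_mul_prod_compl]
  ext
  rw [Units.coe_prod]
  exact h.prod_q

lemma qProd_compl_mul (h : Generic ε) (a : Fin 4) : qProd ε {a}ᶜ * qUnit ε a = 1 := by
  have := qProd_mul_qProd_compl h {a}
  rwa [qProd, Finset.prod_singleton, mul_comm] at this

/-- Since the four parameters multiply to `1`, the products of two and three of the `q_i` in the
expansion of `P_ā` are `q_a⁻¹ q_k⁻¹` and `q_a⁻¹`. -/
lemma index_eq_strucG (h : Generic ε) (a : Fin 4) (v : ℂˣ) :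
    (index (adamsChar ε {a}ᶜ * point v) : ℂ) = (strucG ε a v)⁻¹ := by
  obtain ⟨b, c, d, hbc, hbd, hcd, hS⟩ : ∃ b c d : Fin 4, b ≠ c ∧ b ≠ d ∧ c ≠ d ∧
      ({a}ᶜ : Finset (Fin 4)) = {b, c, d} := by
    revert a
    decide
  have hp : ∀ {M : Type} [CommMonoid M] (f : Fin 4 → M),
      ∏ i ∈ ({a}ᶜ : Finset (Fin 4)), f i = f b * f c * f d := by
    intro M _ f
    rw [hS, Finset.prod_insert (by simp [hbc, hbd]), Finset.prod_pair hcd, mul_assoc]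
  have hq : point (qUnit ε b) * point (qUnit ε c) * point (qUnit ε d) * point (qUnit ε a) = 1 := by
    have := qProd_compl_mul h a
    rw [qProd, hp] at this
    simp only [point_mul, this, point_one]
  have hinv : ∀ i, point (qUnit ε i) * point (qUnit ε i)⁻¹ = 1 := fun i => by
    rw [point_mul, mul_inv_cancel, point_one]
  have e : adamsChar ε {a}ᶜ * point v =
      (point v + (point ((qUnit ε a)⁻¹ * (qUnit ε b)⁻¹ * v) + point ((qUnit ε a)⁻¹ * (qUnit ε c)⁻¹ * v) +
        point ((qUnit ε a)⁻¹ * (qUnit ε d)⁻¹ * v))) -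
      (point ((qUnit ε a)⁻¹ * v) + (point (qUnit ε b * v) + point (qUnit ε c * v) +
        point (qUnit ε d * v))) := by
    rw [adamsChar, hp]
    simp only [← point_mul]
    have e1 : point (qUnit ε b) * point (qUnit ε c) * point (qUnit ε d) = point (qUnit ε a)⁻¹ := by
      linear_combination point (qUnit ε a)⁻¹ * hq - point (qUnit ε b) * point (qUnit ε c) *
        point (qUnit ε d) * hinv a
    have e2 : point (qUnit ε b) * point (qUnit ε c) =
        point (qUnit ε a)⁻¹ * point (qUnit ε d)⁻¹ := by
      linear_combination point (qUnit ε d)⁻¹ * e1 - point (qUnit ε b) * point (qUnit ε c) * hinv d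
    have e3 : point (qUnit ε b) * point (qUnit ε d) =
        point (qUnit ε a)⁻¹ * point (qUnit ε c)⁻¹ := by
      linear_combination point (qUnit ε c)⁻¹ * e1 - point (qUnit ε b) * point (qUnit ε d) * hinv c
    have e4 : point (qUnit ε c) * point (qUnit ε d) =
        point (qUnit ε a)⁻¹ * point (qUnit ε b)⁻¹ := by
      linear_combination point (qUnit ε b)⁻¹ * e1 - point (qUnit ε c) * point (qUnit ε d) * hinv b
    linear_combination point v * (e2 + e3 + e4 - e1)
  rw [e, index_sub]
  simp only [index_add, index_point, strucG, hp]
  push_cast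
  simp only [coe_facUnit]
  push_cast
  simp only [coe_qUnit, inv_div]

lemma ZD6_eq (h : Generic ε) (a : Fin 4) (lam : Finset (({a}ᶜ : Finset (Fin 4)) → ℕ)) :
    ZD6 ε a lam = facetCoeff ε a lam := by
  have h1 := index_point_mul_dual_boxChar (ε := ε) (qUnit ε a) lam
  have h2 := index_point_mul_dual_boxChar (ε := ε) 1 lam
  rw [point_one, one_mul, Units.val_one] at h2
  rw [coe_qUnit] at h1
  rw [facetCoeff, index_add, index_mul_boxChar_mul_dual, sub_mul, one_mul, index_sub,
    Units.val_mul, Units.val_div_eq_div_val, h1, h2, ZD6, Finset.prod_div_distrib, Units.coe_prod]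
  congr 1
  refine Finset.prod_congr rfl fun x _ => ?_
  rw [Units.coe_prod]
  refine Finset.prod_congr rfl fun y _ => ?_
  rw [index_eq_strucG h, coe_mul_inv_contentUnit]

/-- Boundaries are supported on monomials in the directions `S`; modulo the diagonal relation, the
exponents in two directions outside `S` must then agree. This excludes the point `1` when the signs
of antisymmetric terms are computed. -/
lemma shapeChar_coeff_of_not (lam : Finset (S → ℕ)) {v : Fin 4 → ℤ} (h : Generic ε)
    {e i : Fin 4} (he : e ∉ S) (hi : i ∉ S) (hv : v e ≠ v i) :
    (shapeChar ε lam).coeff (lat ε v) = 0 := by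
  refine shapeChar_coeff_eq_zero lam ?_
  rintro ⟨w, hw, hvw⟩
  have := h.lat_eq.1 hvw e i
  rw [hw e he, hw i hi] at this
  omega

lemma deg_boxChar (lam : Finset (S → ℕ)) : deg (boxChar ε lam) = lam.card := by
  simp [boxChar]

/-- The D4 partition function does not depend on the direction outside `S` used to define it. -/
lemma edgeCoeff_symm (h : Generic ε) (hS : S.card = 2) {c d : Fin 4} (hcd : c ≠ d)
    (hSc : Sᶜ = {c, d}) (lam : Finset (S → ℕ)) : edgeCoeff ε c lam = edgeCoeff ε d lam := by
  have hcS : c ∉ S := by rw [← Finset.mem_compl, hSc]; simp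
  have hdS : d ∉ S := by rw [← Finset.mem_compl, hSc]; simp
  have hd := dual_adamsChar (ε := ε) S
  rw [hS, neg_one_sq, one_mul] at hd
  have hq := qProd_mul_qProd_compl h S
  rw [hSc] at hq
  have hq' : qProd ε {c, d} = qUnit ε c * qUnit ε d := by rw [qProd, Finset.prod_pair hcd]
  rw [hq'] at hq
  have hqp : point (qProd ε S) * (point (qUnit ε c) * point (qUnit ε d)) = 1 := by
    rw [point_mul, point_mul, hq, point_one]
  have hinv : ∀ i, point (qUnit ε i) * point (qUnit ε i)⁻¹ = 1 := fun i => by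
    rw [point_mul, mul_inv_cancel, point_one]
  -- The Nekrasov character is self-dual up to `q_c q_d = q_S⁻¹`.
  have hN : dual (nekChar ε lam) = point (qUnit ε c) * point (qUnit ε d) * nekChar ε lam := by
    have hS' : point (qProd ε S)⁻¹ = point (qUnit ε c) * point (qUnit ε d) := by
      rw [point_mul, inv_eq_of_mul_eq_one_right hq]
    simp only [nekChar, map_add, map_sub, map_mul, dual_point, dual_dual, hS']
    linear_combination (-boxChar ε lam + dual (adamsChar ε S) * (boxChar ε lam * dual (boxChar ε lam))) * hqp
      - (point (qUnit ε c) * point (qUnit ε d)) * (boxChar ε lam * dual (boxChar ε lam)) * hd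
  have hdeg : deg (nekChar ε lam) = 2 * lam.card := by
    simp [nekChar, deg_boxChar, deg_adamsChar (Finset.card_pos.1 (by omega) : S.Nonempty)]
    ring
  have hdet : signedDet (nekChar ε lam) = qProd ε S ^ lam.card := by
    rw [nekChar, signedDet_sub, signedDet_add, signedDet_point_mul, signedDet_dual,
      signedDet_adamsChar_mul (by omega), deg_boxChar]
    simp
  -- The absence of the point `1` means that the antisymmetric term brings no extra sign.
  have hc0 : (point (qUnit ε c) * nekChar ε lam).coeff 1 = 0 := by
    rw [point_mul_coeff, mul_one]
    have e : nekChar ε lam = point (qProd ε S) * boxChar ε lam +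
        dual (boxChar ε lam) * shapeChar ε lam := by
      rw [nekChar, shapeChar]
      ring
    have hb : ∀ v : Fin 4 → ℤ, v c ≠ v d → (boxChar ε lam).coeff (lat ε v) = 0 := by
      intro v hv
      refine boxChar_coeff_eq_zero lam ?_
      rintro ⟨w, hw, hvw⟩
      have := h.lat_eq.1 hvw c d
      rw [hw c hcS, hw d hdS] at this
      omega
    have hqc : (qUnit ε c)⁻¹ = lat ε (-Pi.single c 1) := by rw [lat_neg, lat_single, zpow_one]
    rw [e, coeff_add_apply, point_mul_coeff, hqc, ← lat_stepSet, ← lat_neg, ← lat_add, hb,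
      zero_add, boxChar, map_sum, Finset.sum_mul, coeff_finset_sum, Finset.sum_eq_zero]
    · intro x _
      rw [dual_point, point_mul_coeff, inv_inv, contentUnit, ← lat_add,
        shapeChar_coeff_of_not lam h hcS hdS]
      simp [boxExp, hcS, hdS, Pi.single_eq_of_ne hcd.symm]
    · simp [stepSet, hcS, hdS, Pi.single_eq_of_ne hcd.symm]
  -- Exchanging `c` and `d` changes the character by `K - dual K` with `K = q_c · nekChar`, whose
  -- index is a monomial; it accounts for the different prefactors `q_c^{-|λ|}` and `q_d^{-|λ|}`.
  have e : (point (qUnit ε c) - 1) * nekChar ε lam = (point (qUnit ε d) - 1) * nekChar ε lam +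
      (point (qUnit ε c) * nekChar ε lam - dual (point (qUnit ε c) * nekChar ε lam)) := by
    rw [map_mul, dual_point, hN]
    linear_combination point (qUnit ε d) * nekChar ε lam * hinv c
  rw [edgeCoeff, edgeCoeff, index_eq_of_eq_add e, hc0, signedDet_point_mul, hdeg, hdet, zpow_zero,
    mul_one, eq_inv_of_mul_eq_one_left hq, inv_pow, mul_pow, mul_comm 2, zpow_mul, zpow_natCast]
  have comm : ∀ X Y I : ℂˣ, X⁻¹ * (I * (X ^ (2 : ℤ) * (X * Y)⁻¹)) = Y⁻¹ * I := by
    intro X Y I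
    ext
    push_cast
    have := X.ne_zero
    have := Y.ne_zero
    field_simp
  exact comm _ _ _

end

/-! ### Merged operators and the exchange with a screening charge -/

section

open Character

variable {ε : Fin 4 → ℂ} {S : Finset (Fin 4)}

lemma VertexOp.merge_eq {V V' W W' : VertexOp} {z : ℂˣ}
    (hκ : ∀ n ≠ 0, V.κ n + (z : ℂ) ^ (-n) * V'.κ n = W.κ n + (z : ℂ) ^ (-n) * W'.κ n)
    (hp : V.p = W.p) (hp' : V.p' = W.p') (hc : V.c + V'.c = W.c + W'.c)
    (hc' : V.c' + V'.c' = W.c' + W'.c') (hd : V.d + V'.d = W.d + W'.d)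
    (hd' : V.d' + V'.d' = W.d' + W'.d') : V.merge V' z = W.merge W' z := by
  simp only [VertexOp.merge, VertexOp.mk.injEq]
  refine ⟨?_, hp, hp', hc, hc', hd, hd'⟩
  funext n
  split_ifs with hn
  · rfl
  · exact hκ n hn

section Dress

variable (V : VertexOp) (lam : Finset (S → ℕ))

@[simp] lemma dress_opA_p : (V.dress opA lam (logContent ε)).p = V.p := by
  simp [VertexOp.dress, VertexOp.scale, opA]

@[simp] lemma dress_opA_p' : (V.dress opA lam (logContent ε)).p' = V.p' := by
  simp [VertexOp.dress, VertexOp.scale, opA]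

@[simp] lemma dress_opA_c : (V.dress opA lam (logContent ε)).c = V.c - lam.card := by
  simp [VertexOp.dress, VertexOp.scale, opA]

@[simp] lemma dress_opA_c' : (V.dress opA lam (logContent ε)).c' = V.c' := by
  simp [VertexOp.dress, VertexOp.scale, opA]

@[simp] lemma dress_opA_d : (V.dress opA lam (logContent ε)).d = V.d := by
  simp [VertexOp.dress, VertexOp.scale, opA]

@[simp] lemma dress_opA_d' : (V.dress opA lam (logContent ε)).d' = V.d' := by
  simp [VertexOp.dress, VertexOp.scale, opA]

lemma dress_opA_insert_kappa {lam : Finset (S → ℕ)} {s : S → ℕ} (hs : s ∉ lam) (n : ℤ) :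
    (V.dress opA (insert s lam) (logContent ε)).κ n =
      (V.dress opA lam (logContent ε)).κ n - (contentUnit ε s : ℂ) ^ (-n) := by
  simp only [VertexOp.dress, VertexOp.scale, opA, mul_one, exp_neg_mul_logContent]
  rw [Finset.sum_insert hs]
  ring

end Dress

/-- A partition with a box added. -/
def Partition.add (lam : Partition S) (s : S → ℕ) (hs : Addable lam.1 s) : Partition S :=
  ⟨insert s lam.1, by simpa using hs.2⟩

/-- A partition with a box removed. -/
def Partition.remove (lam : Partition S) (s : S → ℕ) (hs : Removable lam.1 s) : Partition S :=
  ⟨lam.1.erase s, by simpa using hs.2⟩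

lemma Addable.removable_insert {lam : Partition S} {s : S → ℕ} (hs : Addable lam.1 s) :
    Removable (insert s lam.1) s := by
  refine ⟨Finset.mem_insert_self _ _, ?_⟩
  have : ((insert s lam.1 : Finset (S → ℕ)) : Set (S → ℕ)) \ {s} = lam.1 := by
    ext x
    simp only [Finset.coe_insert, Set.mem_sdiff, Set.mem_insert_iff, Finset.mem_coe,
      Set.mem_singleton_iff]
    constructor
    · tauto
    · intro hx
      refine ⟨Or.inr hx, ?_⟩
      rintro rfl
      exact hs.1 hx
  rw [this]
  exact lam.2

lemma Removable.addable_erase {lam : Partition S} {s : S → ℕ} (hs : Removable lam.1 s) :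
    Addable (lam.1.erase s) s := by
  refine ⟨Finset.notMem_erase _ _, ?_⟩
  have : (insert s (lam.1.erase s : Finset (S → ℕ)) : Set (S → ℕ)) = lam.1 := by
    rw [← Finset.coe_insert, Finset.insert_erase hs.1]
  rw [this]
  exact lam.2

lemma coeff_point_mul_dual (w : ℂˣ) (M : Character) (x : ℂˣ) :
    (point w * dual M).coeff x = M.coeff (w * x⁻¹) := by
  rw [point_mul_coeff, coeff_dual, mul_inv, inv_inv]

lemma point_mul_inv (v : ℂˣ) : point v * point v⁻¹ = 1 := by
  rw [point_mul, mul_inv_cancel, point_one]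

section VertexExchange

/-- The matching of the poles of a product of a `qq`-character with a screening charge: a box is
added to the partition, and the screening current is moved back by one step. -/
def VertexMatch (ε : Fin 4 → ℂ) (e : Fin 4) (u : ℂˣ) (i j : Partition S × ℤ) : Prop :=
  ∃ s, Addable i.1.1 s ∧ j.1.1 = insert s i.1.1 ∧ j.2 = i.2 - 1 ∧
    u = qUnit ε e ^ (i.2 - 1) * (contentUnit ε s)⁻¹

lemma opS_scale_kappa (e : Fin 4) (k n : ℤ) : ((opS ε e).scale ((k : ℂ) * ε e)).κ n =
    ((qUnit ε e ^ k : ℂˣ) : ℂ) ^ (-n) / (1 - q ε e ^ (-n)) := by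
  rw [opS_kappa, ev_point, adamsP, Finset.prod_singleton]

lemma Generic.opS_scale_c (h : Generic ε) (e : Fin 4) (k : ℤ) :
    ((opS ε e).scale ((k : ℂ) * ε e)).c = -k := by
  have := h.eps_ne_zero e
  simp only [VertexOp.scale, opS]
  field_simp
  ring

/-- The oscillators of `S_e(q_e x)` are those of `:S_e(x) A(x)⁻¹:`. Moving the screening current
back by one step therefore releases a factor `A`, which at this value of `u` sits at `χ(s) x` and
cancels the `A⁻¹` of the added box. -/
lemma Generic.merge_vertexMatch (h : Generic ε) (V : VertexOp) (e : Fin 4) {u : ℂˣ}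
    {i j : Partition S × ℤ} (hij : VertexMatch ε e u i j) :
    (V.dress opA j.1.1 (logContent ε)).merge ((opS ε e).scale ((j.2 : ℂ) * ε e)) u⁻¹ =
      (V.dress opA i.1.1 (logContent ε)).merge ((opS ε e).scale ((i.2 : ℂ) * ε e)) u⁻¹ := by
  obtain ⟨s, hs, h1, h2, hu⟩ := hij
  refine VertexOp.merge_eq (fun n hn => ?_) (by simp) (by simp) ?_ ?_ ?_ ?_
  · rw [h1, h2, dress_opA_insert_kappa V hs.1, opS_scale_kappa, opS_scale_kappa, hu]
    have hq : 1 - q ε e ^ (-n) ≠ 0 := h.one_sub_ne_zero e (neg_ne_zero.2 hn)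
    have hk : qUnit ε e ^ i.2 = qUnit ε e ^ (i.2 - 1) * qUnit ε e := by
      rw [← zpow_add_one, sub_add_cancel]
    have hw := (qUnit ε e ^ (i.2 - 1)).ne_zero
    have hs0 := (contentUnit ε s).ne_zero
    rw [hk]
    generalize qUnit ε e ^ (i.2 - 1) = w at hw
    push_cast
    rw [coe_qUnit, mul_zpow]
    simp only [mul_inv, inv_inv, mul_zpow, inv_zpow', neg_neg]
    have e1 : (w : ℂ) ^ n * (w : ℂ) ^ (-n) = 1 := by
      rw [← zpow_add₀ hw]; simp
    field_simp
    linear_combination (1 - q ε e ^ (-n)) * (contentUnit ε s : ℂ) ^ (-n) * e1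
  · rw [h.opS_scale_c, h.opS_scale_c, dress_opA_c, dress_opA_c, h1, h2,
      Finset.card_insert_of_notMem hs.1]
    push_cast
    ring
  all_goals simp [VertexOp.scale, opS]

/-- The commutation of a sum over partitions with a screening charge, from the cancellation of
residues when a box is added. -/
theorem Generic.commuteUpTo_vertex (h : Generic ε) {e : Fin 4} (he : ∃ i, i ∉ S) {V : VertexOp}
    {Z : Partition S → ℂ} {C : ℂ} {μ ν τ : ℤ} (M : Partition S × ℤ → Character)
    (hex : ∀ i : Partition S × ℤ, Exchange ε C μ ν τ (V.dress opA i.1.1 (logContent ε))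
      ((opS ε e).scale ((i.2 : ℂ) * ε e)) (M i))
    (hpole : ∀ (i : Partition S × ℤ) u, (M i).coeff u = -1 ↔
      (∃ s, Addable i.1.1 s ∧ u = qUnit ε e ^ (i.2 - 1) * (contentUnit ε s)⁻¹) ∨
      ∃ s, Removable i.1.1 s ∧ u = qUnit ε e ^ i.2 * (contentUnit ε s)⁻¹)
    (hdisj : ∀ (lam : Partition S) s t, Addable lam.1 s → Removable lam.1 t →
      contentUnit ε t ≠ qUnit ε e * contentUnit ε s)
    (hres : ∀ (i j : Partition S × ℤ) u, VertexMatch ε e u i j →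
      Z i.1 * (Complex.exp (-i.2 * V.d) * index (point u⁻¹ * M i)) +
        Z j.1 * (Complex.exp (-j.2 * V.d) * index (point u⁻¹ * M j)) = 0)
    (hfin : ∀ (N : ℤ) u, {i : Partition S × ℤ | (i.1.1.card : ℤ) + i.2 = N ∧ ∃ s ∈ i.1.1,
      u = qUnit ε e ^ i.2 * (contentUnit ε s)⁻¹}.Finite) :
    CommuteUpTo ε C μ ν ⟨Partition S, fun lam => (lam.1.card : ℤ), Z,
      fun lam => V.dress opA lam.1 (logContent ε)⟩ (qqChar ε (.vertex e)) := by
  obtain ⟨o, ho⟩ := he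
  have hinj : ∀ {s t : S → ℕ} {w : ℂˣ}, w * (contentUnit ε s)⁻¹ = w * (contentUnit ε t)⁻¹ →
      s = t := fun {s t w} hst =>
    h.contentUnit_injective ho (inv_injective (mul_left_cancel hst))
  have hsrc : ∀ (i : Partition S × ℤ) u,
      (∃ s, Addable i.1.1 s ∧ u = qUnit ε e ^ (i.2 - 1) * (contentUnit ε s)⁻¹) ↔
        ∃ j, VertexMatch ε e u i j := by
    intro i u
    constructor
    · rintro ⟨s, hs, hu⟩
      exact ⟨(i.1.add s hs, i.2 - 1), s, hs, rfl, rfl, hu⟩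
    · rintro ⟨j, s, hs, -, -, hu⟩
      exact ⟨s, hs, hu⟩
  have htgt : ∀ (i : Partition S × ℤ) u,
      (∃ s, Removable i.1.1 s ∧ u = qUnit ε e ^ i.2 * (contentUnit ε s)⁻¹) ↔
        ∃ j, VertexMatch ε e u j i := by
    intro i u
    constructor
    · rintro ⟨s, hs, hu⟩
      refine ⟨(i.1.remove s hs, i.2 + 1), s, hs.addable_erase, ?_, ?_, ?_⟩
      · exact (Finset.insert_erase hs.1).symm
      · simp
      · simpa using hu
    · rintro ⟨j, s, hs, h1, h2, hu⟩
      refine ⟨s, ?_, by rw [h2, hu]⟩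
      rw [h1]
      exact hs.removable_insert
  refine commuteUpTo_of_matching (T' := qqChar ε (.vertex e)) h.sum (τ := τ)
    (P := -(1 / ε e)) (P' := 0) M hex (fun _ => rfl) (fun _ => rfl) (VertexMatch ε e) ?_ ?_ ?_ ?_
    ?_ ?_ ?_ ?_
  · intro u (i : Partition S × ℤ)
    exact (hpole i u).trans (or_congr (hsrc i u) (htgt i u))
  · rintro u i j j' ⟨s, hs, h1, h2, hu⟩ ⟨t, ht, h1', h2', hu'⟩
    obtain rfl := hinj (hu.symm.trans hu')
    exact Prod.ext (Subtype.ext (h1.trans h1'.symm)) (h2.trans h2'.symm)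
  · rintro u (i : Partition S × ℤ) (i' : Partition S × ℤ) (j : Partition S × ℤ)
      ⟨s, hs, h1, h2, hu⟩ ⟨t, ht, h1', h2', hu'⟩
    have h3 : i.2 = i'.2 := by omega
    rw [h3] at hu
    obtain rfl := hinj (hu.symm.trans hu')
    refine Prod.ext (Subtype.ext ?_) h3
    rw [← Finset.erase_insert hs.1, ← h1, h1', Finset.erase_insert ht.1]
  -- An index that is source and target for the same `u` would have an addable `s` and a removable
  -- `t` with `χ(t) = q_e χ(s)`.
  · intro u i j k hij hki
    obtain ⟨s, hs, hu⟩ := (hsrc i u).2 ⟨j, hij⟩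
    obtain ⟨t, ht, hu'⟩ := (htgt i u).2 ⟨k, hki⟩
    refine hdisj i.1 s t hs ht ?_
    rw [hu, zpow_sub_one] at hu'
    have : (qUnit ε e)⁻¹ * (contentUnit ε s)⁻¹ = (contentUnit ε t)⁻¹ :=
      mul_left_cancel (by rw [← mul_assoc]; exact hu')
    rw [← mul_inv] at this
    exact (inv_injective this).symm
  · rintro u (i : Partition S × ℤ) (j : Partition S × ℤ) ⟨s, hs, h1, h2, -⟩
    change (i.1.1.card : ℤ) + i.2 = (j.1.1.card : ℤ) + j.2
    rw [h1, h2, Finset.card_insert_of_notMem hs.1]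
    push_cast
    ring
  · intro u i j hij
    exact h.merge_vertexMatch V e hij
  · intro u i j hij
    have := hres i j u hij
    have hc : ∀ k : ℤ, (((qqChar ε (.vertex e)).op k).c * V.d +
        ((qqChar ε (.vertex e)).op k).c' * V.d') = -k * V.d := by
      intro k
      change ((opS ε e).scale ((k : ℂ) * ε e)).c * V.d + _ = _
      rw [h.opS_scale_c]
      simp [qqChar, VertexOp.scale, opS]
    have hr : ∀ i : Partition S × ℤ, residue ⟨Partition S, fun lam => (lam.1.card : ℤ), Z,
        fun lam => V.dress opA lam.1 (logContent ε)⟩ (qqChar ε (.vertex e)) (M i) u i =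
        Z i.1 * (Complex.exp (-i.2 * V.d) * index (point u⁻¹ * M i)) := by
      intro i
      rw [← hc]
      change Z i.1 * 1 * (Complex.exp (_ * (V.dress opA i.1.1 (logContent ε)).d +
        _ * (V.dress opA i.1.1 (logContent ε)).d') * _) = _
      rw [mul_one, dress_opA_d, dress_opA_d']
    exact (congrArg₂ (· + ·) (hr i) (hr j)).trans this
  · intro N u
    -- Poles from removable boxes are covered by `hfin`. A pole from an addable box has a partner
    -- covered by `hfin`, which has at least as many boxes and determines the index of the current.
    refine ((hfin N u).union ((hfin N u).biUnion fun j _ =>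
      (Partition.finite_card_le S j.1.1.card).prod (Set.finite_singleton (j.2 + 1)))).subset ?_
    rintro (i : Partition S × ℤ) ⟨hi, hi'⟩
    rcases (hpole i u).1 hi' with ⟨s, hs, hu⟩ | ⟨s, hs, hu⟩
    · refine Or.inr (Set.mem_biUnion (x := (i.1.add s hs, i.2 - 1)) ⟨?_, s,
        Finset.mem_insert_self _ _, hu⟩ ⟨?_, ?_⟩)
      · change ((insert s i.1.1).card : ℤ) + (i.2 - 1) = N
        rw [← hi, Finset.card_insert_of_notMem hs.1]
        change _ = (i.1.1.card : ℤ) + i.2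
        push_cast
        ring
      · exact Finset.card_le_card (Finset.subset_insert _ _)
      · simp
    · exact Or.inl ⟨hi, s, hs.1, hu⟩

end VertexExchange

end

section

open Character

variable {ε : Fin 4 → ℂ} {S : Finset (Fin 4)}

lemma qUnit_eq_lat (c : Fin 4) : qUnit ε c = lat ε (Pi.single c 1) := by
  rw [lat_single, zpow_one]

/-! ### Edges and vertices -/

section EdgeVertex

variable {a b c d : Fin 4}

lemma compl_insert_of_compl (hSc : Sᶜ = {c, d}) (hcd : c ≠ d) : (S ∪ {c})ᶜ = {d} := by
  rw [Finset.compl_union, hSc]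
  ext i
  simp only [Finset.mem_inter, Finset.mem_insert, Finset.mem_singleton, Finset.mem_compl]
  constructor
  · tauto
  · rintro rfl
    exact ⟨Or.inr rfl, hcd.symm⟩

lemma exchangeChar_edge_vertex (hS : S.card = 2) (hSc : Sᶜ = {c, d}) (hcd : c ≠ d)
    (u : Character) (w : ℂˣ) : exchangeChar ε S {c} u (point w) =
      (1 - point (qUnit ε d)) * (point (qProd ε S * w) * dual u) := by
  rw [exchangeChar, compl_insert_of_compl hSc hcd, hS, adamsChar, Finset.prod_singleton, neg_one_sq,
    one_mul, ← point_mul]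
  ring

lemma qProd_mul_of_compl (h : Generic ε) (hSc : Sᶜ = {c, d}) (hcd : c ≠ d) :
    qProd ε S * (qUnit ε c * qUnit ε d) = 1 := by
  rw [← qProd_mul_qProd_compl h S, hSc]
  simp [qProd, Finset.prod_pair hcd]

lemma exchangeChar_edge_vertex_coeff (hS : S.card = 2) (hSc : Sᶜ = {c, d}) (hcd : c ≠ d)
    (u : Character) (w x : ℂˣ) : (exchangeChar ε S {c} u (point w)).coeff x =
      u.coeff (qProd ε S * w * x⁻¹) - u.coeff (qProd ε S * w * x⁻¹ * qUnit ε d) := by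
  rw [exchangeChar_edge_vertex hS hSc hcd, sub_mul, one_mul, coeff_sub_apply,
    point_mul_coeff (qUnit ε d), coeff_point_mul_dual, coeff_point_mul_dual, mul_inv, inv_inv]
  congr 2
  rw [mul_comm (qUnit ε d), ← mul_assoc]

/-- Multiplication by `q_d` destroys the equality of the exponents at `c` and `d`. Hence the two
terms of `exchangeChar_edge_vertex_coeff` never overlap, and the poles are simple. -/
lemma Generic.shapeChar_coeff_mul_qUnit (h : Generic ε) (hSc : Sᶜ = {c, d}) (hcd : c ≠ d)
    (lam : Finset (S → ℕ)) {x : ℂˣ} (hx : (shapeChar ε lam).coeff x ≠ 0) :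
    (shapeChar ε lam).coeff (x * qUnit ε d) = 0 := by
  have hcS : c ∉ S := by rw [← Finset.mem_compl, hSc]; simp
  have hdS : d ∉ S := by rw [← Finset.mem_compl, hSc]; simp
  by_cases h' : ∃ v, SuppIn S v ∧ x = lat ε v
  · obtain ⟨v, hv, rfl⟩ := h'
    rw [qUnit_eq_lat, ← lat_add, shapeChar_coeff_of_not lam h hcS hdS]
    simp [hv c hcS, hv d hdS, Pi.single_eq_of_ne hcd]
  · exact (hx (shapeChar_coeff_eq_zero lam h')).elim

lemma exchange_edge_vertex (h : Generic ε) (hab : a ≠ b) (hS : S = {a, b}) (hSc : Sᶜ = {c, d})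
    (hcd : c ≠ d) (V : VertexOp) (hV : ∀ n, V.κ n = 1 / adamsP ε S (-n)) (hp : V.p = 0)
    (hp' : V.p' = 0) (hd : V.d = 0) (hd' : V.d' = 0) (hc' : V.c' = ε c * ε d) (lam : Partition S)
    (k : ℤ) : Exchange ε 1 0 0 0 (V.dress opA lam.1 (logContent ε))
      ((opS ε c).scale ((k : ℂ) * ε c))
      (exchangeChar ε S {c} (shapeChar ε lam.1) (point (qUnit ε c ^ k))) := by
  have hcS : c ∉ S := by rw [← Finset.mem_compl, hSc]; simp
  have hcard : S.card = 2 := by rw [hS, Finset.card_pair hab]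
  have hdeg : deg (exchangeChar ε S {c} (shapeChar ε lam.1) (point (qUnit ε c ^ k))) = 0 := by
    rw [exchangeChar_edge_vertex hcard hSc hcd]
    simp
  refine ⟨?_, ?_, ?_, ?_, ?_, ?_⟩
  · exact h.contraction_exchangeChar (Finset.disjoint_singleton_right.2 hcS)
      (fun n hn => h.dress_kappa V hV lam.1 n hn) (fun n _ => opS_kappa c k n)
  · rw [hdeg]
    simp [hp, hp']
  · simp [hd, hd']
  · rw [hdeg]; rfl
  -- The zero mode `ε_c ε_d` of the D4 operator meets the shift `-1 / ε_c` of the screening current,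
  -- giving the phase `q_d⁻¹`; this is the signed determinant of `1 - q_d` times a character of
  -- degree one.
  · have h2 : V.c' * -(1 / ε c) = -ε d := by
      have := h.eps_ne_zero c
      rw [hc']
      field_simp
    have h3 : V.c' * -(1 / ε c) = ((opS ε c).scale ((k : ℂ) * ε c)).d' * V.c' := mul_comm _ _
    rw [exchangeChar_edge_vertex hcard hSc hcd, signedDet_one_sub_mul, map_mul, deg_point, deg_dual,
      deg_shapeChar (Finset.card_pos.1 (by omega))]
    simp only [dress_opA_d, dress_opA_d', dress_opA_c, dress_opA_c', hd, hd', mul_zero, sub_zero]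
    have h4 : (V.c - (lam.1.card : ℂ)) * ((opS ε c).scale ((k : ℂ) * ε c)).d +
        V.c' * ((opS ε c).scale ((k : ℂ) * ε c)).d' = -ε d := by
      rw [mul_comm V.c', ← h3, h2]
      simp [VertexOp.scale, opS]
    rw [h4, Complex.exp_neg]
    simp [q]
  · intro x
    rw [exchangeChar_edge_vertex_coeff hcard hSc hcd]
    have h1 := h.shapeChar_coeff_pair hab hS hcS lam.2 (qProd ε S * qUnit ε c ^ k * x⁻¹)
    have h2 := h.shapeChar_coeff_pair hab hS hcS lam.2
      (qProd ε S * qUnit ε c ^ k * x⁻¹ * qUnit ε d)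
    by_cases h0 : (shapeChar ε lam.1).coeff (qProd ε S * qUnit ε c ^ k * x⁻¹) = 0
    · omega
    · have := h.shapeChar_coeff_mul_qUnit hSc hcd lam.1 h0
      omega

/-- The first term equals `-1` at removable boxes; the second is subtracted, so it contributes `-1`
at addable ones. The relation `q_S q_c q_d = 1` lowers the power of `q_c` by one in the addable
case. -/
lemma pole_edge_vertex (h : Generic ε) (hab : a ≠ b) (hS : S = {a, b}) (hSc : Sᶜ = {c, d})
    (hcd : c ≠ d) (lam : Partition S) (k : ℤ) (u : ℂˣ) :
    (exchangeChar ε S {c} (shapeChar ε lam.1) (point (qUnit ε c ^ k))).coeff u = -1 ↔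
      (∃ s, Addable lam.1 s ∧ u = qUnit ε c ^ (k - 1) * (contentUnit ε s)⁻¹) ∨
      ∃ s, Removable lam.1 s ∧ u = qUnit ε c ^ k * (contentUnit ε s)⁻¹ := by
  have hcS : c ∉ S := by rw [← Finset.mem_compl, hSc]; simp
  have hcard : S.card = 2 := by rw [hS, Finset.card_pair hab]
  have hq := qProd_mul_of_compl h hSc hcd
  rw [exchangeChar_edge_vertex_coeff hcard hSc hcd]
  have h1 := h.shapeChar_coeff_pair hab hS hcS lam.2 (qProd ε S * qUnit ε c ^ k * u⁻¹)
  have h2 := h.shapeChar_coeff_pair hab hS hcS lam.2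
    (qProd ε S * qUnit ε c ^ k * u⁻¹ * qUnit ε d)
  have h3 : (shapeChar ε lam.1).coeff (qProd ε S * qUnit ε c ^ k * u⁻¹) ≠ 0 →
      (shapeChar ε lam.1).coeff (qProd ε S * qUnit ε c ^ k * u⁻¹ * qUnit ε d) = 0 :=
    h.shapeChar_coeff_mul_qUnit hSc hcd lam.1
  have e1 : ∀ s : S → ℕ, qProd ε S * qUnit ε c ^ k * u⁻¹ * qUnit ε d = contentUnit ε s ↔
      u = qUnit ε c ^ (k - 1) * (contentUnit ε s)⁻¹ := by
    intro s
    have : qProd ε S * qUnit ε c ^ k * u⁻¹ * qUnit ε d = qUnit ε c ^ (k - 1) * u⁻¹ := by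
      have e : qUnit ε c ^ k = qUnit ε c ^ (k - 1) * qUnit ε c := by
        rw [← zpow_add_one, sub_add_cancel]
      rw [e]
      calc _ = qProd ε S * (qUnit ε c * qUnit ε d) * (qUnit ε c ^ (k - 1) * u⁻¹) := by
            simp only [mul_comm, mul_left_comm, mul_assoc]
        _ = _ := by rw [hq, one_mul]
    rw [this, mul_inv_eq_iff_eq_mul, eq_mul_inv_iff_mul_eq, mul_comm u, eq_comm]
  have e2 : ∀ s : S → ℕ, qProd ε S * qUnit ε c ^ k * u⁻¹ = contentUnit ε s * qProd ε S ↔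
      u = qUnit ε c ^ k * (contentUnit ε s)⁻¹ := by
    intro s
    rw [mul_assoc, mul_comm (contentUnit ε s), mul_right_inj, mul_inv_eq_iff_eq_mul,
      eq_mul_inv_iff_mul_eq, mul_comm u, eq_comm]
  have h4 := h1.2.2.2.1
  have h5 := h2.2.2.1
  simp only [e1] at h5
  simp only [e2] at h4
  rw [← h4, ← h5]
  by_cases h0 : (shapeChar ε lam.1).coeff (qProd ε S * qUnit ε c ^ k * u⁻¹) = 0
  · omega
  · have := h3 h0
    omega

/-- The residues cancel when a box is added to a Young diagram. -/
lemma residue_edge_vertex (h : Generic ε) (hab : a ≠ b) (hS : S = {a, b}) (hSc : Sᶜ = {c, d})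
    (hcd : c ≠ d) (lam : Partition S) {s : S → ℕ} (hs : Addable lam.1 s) (k : ℤ) :
    edgeCoeff ε c (insert s lam.1) *
      index (point (qUnit ε c ^ (k - 1) * (contentUnit ε s)⁻¹)⁻¹ *
        exchangeChar ε S {c} (shapeChar ε (insert s lam.1)) (point (qUnit ε c ^ (k - 1)))) =
    -(edgeCoeff ε c lam.1 * index (point (qUnit ε c ^ (k - 1) * (contentUnit ε s)⁻¹)⁻¹ *
        exchangeChar ε S {c} (shapeChar ε lam.1) (point (qUnit ε c ^ k)))) := by
  have hcS : c ∉ S := by rw [← Finset.mem_compl, hSc]; simp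
  have hdS : d ∉ S := by rw [← Finset.mem_compl, hSc]; simp
  have hcard : S.card = 2 := by rw [hS, Finset.card_pair hab]
  have hne : S.Nonempty := Finset.card_pos.1 (by omega)
  have hq := qProd_mul_of_compl h hSc hcd
  have hqp : point (qProd ε S) * (point (qUnit ε c) * point (qUnit ε d)) = 1 := by
    rw [point_mul, point_mul, hq, point_one]
  have hdual := dual_adamsChar (ε := ε) S
  rw [hcard, neg_one_sq, one_mul] at hdual
  obtain ⟨y, hy⟩ : ∃ y, y = point (contentUnit ε s) * dual (shapeChar ε lam.1) := ⟨_, rfl⟩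
  have hy1 : y.coeff 1 = 1 := by
    rw [hy, coeff_point_mul_dual, inv_one, mul_one]
    exact (h.shapeChar_coeff_pair hab hS hcS lam.2 _).2.2.1.2 ⟨s, hs, rfl⟩
  have hyc : y.coeff (qUnit ε c) = 0 := by
    rw [hy, coeff_point_mul_dual, qUnit_eq_lat, contentUnit, ← lat_neg, ← lat_add]
    refine shapeChar_coeff_of_not lam.1 h hcS hdS ?_
    simp [boxExp, hcS, hdS, Pi.single_eq_of_ne hcd.symm]
  have hyd : deg y = 1 := by simp [hy, deg_shapeChar hne]
  have hic := point_mul_inv (qUnit ε c)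
  have hid := point_mul_inv (qUnit ε d)
  have his := point_mul_inv (contentUnit ε s)
  have hiw := point_mul_inv (qUnit ε c ^ (k - 1))
  have hk : point (qUnit ε c ^ k) = point (qUnit ε c ^ (k - 1)) * point (qUnit ε c) := by
    rw [point_mul, ← zpow_add_one, sub_add_cancel]
  have hcd' : point (qProd ε S) * point (qUnit ε c) = point (qUnit ε d)⁻¹ := by
    linear_combination point (qUnit ε d)⁻¹ * hqp - point (qProd ε S) * point (qUnit ε c) * hid
  have hdc' : point (qProd ε S) * point (qUnit ε d) = point (qUnit ε c)⁻¹ := by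
    linear_combination point (qUnit ε c)⁻¹ * hqp - point (qProd ε S) * point (qUnit ε d) * hic
  have e1 : point (qUnit ε c ^ (k - 1) * (contentUnit ε s)⁻¹)⁻¹ *
      exchangeChar ε S {c} (shapeChar ε lam.1) (point (qUnit ε c ^ k)) =
      (point (qUnit ε d)⁻¹ - 1) * y := by
    rw [exchangeChar_edge_vertex hcard hSc hcd, ← point_mul, hk, mul_inv, inv_inv, ← point_mul, hy]
    generalize point (qUnit ε c ^ (k - 1)) = P at *
    generalize point (qUnit ε c ^ (k - 1))⁻¹ = P' at *
    linear_combination point (contentUnit ε s) * dual (shapeChar ε lam.1) * (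
      point (qProd ε S) * point (qUnit ε c) * (1 - point (qUnit ε d)) * hiw +
      (1 - point (qUnit ε d)) * hcd' - hid)
  have e2 : point (qUnit ε c ^ (k - 1) * (contentUnit ε s)⁻¹)⁻¹ *
      exchangeChar ε S {c} (shapeChar ε (insert s lam.1)) (point (qUnit ε c ^ (k - 1))) =
      (1 - point (qUnit ε d)) * (point (qProd ε S) * y - adamsChar ε S) := by
    rw [exchangeChar_edge_vertex hcard hSc hcd, ← point_mul, mul_inv, inv_inv, ← point_mul, hy,
      shapeChar_insert hs.1, map_sub, map_mul, dual_point]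
    generalize point (qUnit ε c ^ (k - 1)) = P at *
    generalize point (qUnit ε c ^ (k - 1))⁻¹ = P' at *
    linear_combination (1 - point (qUnit ε d)) * (point (qProd ε S) * point (contentUnit ε s) *
      (dual (shapeChar ε lam.1) - dual (adamsChar ε S) * point (contentUnit ε s)⁻¹) * hiw -
      point (qProd ε S) * dual (adamsChar ε S) * his - hdual)
  -- `X` and `Y` express the change of the partition function together with the change of the
  -- residue as antisymmetric terms. `X` has index `-q_c`, cancelling the `q_c⁻¹` of
  -- `edgeCoeff_insert` and leaving the sign `-1`; `Y` contributes `1`.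
  obtain ⟨X, hX⟩ : ∃ X, X = (1 - point (qUnit ε c)⁻¹) * y := ⟨_, rfl⟩
  obtain ⟨Y, hYdef⟩ : ∃ Y, Y = point (qUnit ε c) * adamsChar ε S := ⟨_, rfl⟩
  have e3 : (1 - point (qUnit ε c)) * (-(point (qProd ε S) * y) - dual y + adamsChar ε S) +
      (1 - point (qUnit ε d)) * (point (qProd ε S) * y - adamsChar ε S) =
      (point (qUnit ε d)⁻¹ - 1) * y + (X - dual X) - (Y - dual Y) := by
    have hA : dual (adamsChar ε S) = point (qUnit ε c) * point (qUnit ε d) * adamsChar ε S := by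
      linear_combination point (qUnit ε c) * point (qUnit ε d) * hdual -
        dual (adamsChar ε S) * hqp
    rw [hX, hYdef]
    simp only [map_mul, map_sub, map_one, dual_point, inv_inv, hA]
    linear_combination (hcd' - hdc') * y - point (qUnit ε d) * adamsChar ε S * hic
  have iX : signedDet X * (-1) ^ X.coeff 1 = -qUnit ε c := by
    rw [hX, signedDet_one_sub_mul, hyd, sub_mul, one_mul, coeff_sub_apply, point_mul_coeff, hy1,
      inv_inv, mul_one, hyc]
    simp
  have iY : signedDet Y * (-1) ^ Y.coeff 1 = 1 := by
    have : Y.coeff 1 = 0 := by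
      -- The Adams character is read as the boundary of a one-box partition, so that its support is
      -- controlled by `shapeChar_coeff_of_not`.
      have e : adamsChar ε S = 1 - shapeChar ε ({0} : Finset (S → ℕ)) := by
        have : boxChar ε ({0} : Finset (S → ℕ)) = 1 := by
          rw [boxChar, Finset.sum_singleton, contentUnit]
          have : boxExp (0 : S → ℕ) = 0 := by
            funext i
            simp [boxExp]
          rw [this, lat_zero, point_one]
        rw [shapeChar, this]
        ring
      rw [hYdef, point_mul_coeff, mul_one, e, coeff_sub_apply, coeff_one, qUnit_eq_lat, ← lat_neg,
        shapeChar_coeff_of_not _ h hcS hdS, if_neg, sub_zero]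
      · rw [h.lat_eq_one]
        intro h'
        have := h' c d
        simp [Pi.single_eq_of_ne hcd.symm] at this
      · simp [Pi.single_eq_of_ne hcd.symm]
    rw [this, hYdef, mul_comm, mul_comm (point _), zpow_zero, one_mul, signedDet_adamsChar_mul
      (by omega)]
  rw [edgeCoeff_insert hcard c hs.1 hy, e1, e2]
  have e4 := congrArg index e3
  rw [index_add, index_sub, index_add, index_sub_dual, index_sub_dual, iX, iY, div_one] at e4
  calc _ = edgeCoeff ε c lam.1 * (qUnit ε c)⁻¹ * (index _ * index _) := by
        rw [← mul_assoc, ← mul_assoc, mul_assoc _ (index _)]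
    _ = _ := by
      rw [e4]
      ext
      push_cast
      have := (qUnit ε c).ne_zero
      field_simp

theorem commuteUpTo_edge_vertex (h : Generic ε) {a b : Fin 4} (hab : a < b) {c : Fin 4}
    (hc : c ∉ ({a, b} : Finset (Fin 4))) :
    CommuteUpTo ε 1 0 0 (qqChar ε (.edge a b hab)) (qqChar ε (.vertex c)) := by
  obtain ⟨d, hcd, hSc⟩ : ∃ d, c ≠ d ∧ ({a, b} : Finset (Fin 4))ᶜ = {c, d} := by
    revert a b c
    decide
  have hcard : ({a, b} : Finset (Fin 4)).card = 2 := Finset.card_pair hab.ne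
  have hdS : d ∉ ({a, b} : Finset (Fin 4)) := by rw [← Finset.mem_compl, hSc]; simp
  -- The definition uses the smallest direction outside the edge; the residue computation needs the
  -- direction `c` of the screening charge, and the coefficient does not depend on the choice.
  have hZ : ∀ lam, ZD4 ε a b lam = edgeCoeff ε c lam := by
    intro lam
    rw [ZD4_eq hab.ne, hSc, Finset.inf_insert, Finset.inf_singleton, id_eq, id_eq]
    rcases le_total c d with h' | h'
    · rw [inf_eq_left.2 h']
    · rw [inf_eq_right.2 h', edgeCoeff_symm h hcard hcd hSc]
  suffices hs : CommuteUpTo ε 1 ((0 : ℤ) : ℂ) ((0 : ℤ) : ℂ) (qqChar ε (.edge a b hab))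
      (qqChar ε (.vertex c)) by
    rwa [Int.cast_zero] at hs
  refine h.commuteUpTo_vertex (V := opX ε a b) (e := c) ⟨c, hc⟩ (τ := 0)
    (Z := fun lam => ZD4 ε a b lam.1)
    (fun i => exchangeChar ε {a, b} {c} (shapeChar ε i.1.1) (point (qUnit ε c ^ i.2)))
    (fun i => ?_) (fun i u => ?_) ?_ ?_ ?_
  · exact exchange_edge_vertex h hab.ne rfl hSc hcd _ (fun _ => rfl) rfl rfl rfl rfl
      (by rw [opX, hSc]; exact Finset.prod_pair hcd) i.1 i.2
  · exact pole_edge_vertex h hab.ne rfl hSc hcd i.1 i.2 u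
  · intro lam s t _ _ hst
    rw [contentUnit, contentUnit, qUnit_eq_lat, ← lat_add, h.lat_eq] at hst
    have := hst c d
    simp [boxExp, hc, hdS, Pi.single_eq_of_ne hcd.symm] at this
  · rintro i j u ⟨s, hs, h1, h2, rfl⟩
    have := congrArg Units.val (residue_edge_vertex h hab.ne rfl hSc hcd i.1 hs i.2)
    push_cast at this
    simp only [hZ, opX, mul_zero, Complex.exp_zero, one_mul, h1, h2]
    rw [this]
    ring
  · intro N u
    -- Comparing the exponents in the directions `c` and `d` shows that `u` determines `k`; the
    -- level then bounds the number of boxes.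
    refine Set.Finite.subset (s := ⋃ k ∈ {k : ℤ | ∃ s : ({a, b} : Finset (Fin 4)) → ℕ,
      u = qUnit ε c ^ k * (contentUnit ε s)⁻¹}, {lam : Partition {a, b} | lam.1.card ≤
        (N - k).toNat} ×ˢ {k}) ?_ ?_
    · refine Set.Finite.biUnion (Set.Subsingleton.finite ?_) fun k _ =>
        (Partition.finite_card_le _ _).prod (Set.finite_singleton k)
      rintro k ⟨s, hs⟩ l ⟨t, ht⟩
      rw [hs, contentUnit, contentUnit, ← lat_neg, ← lat_neg, ← lat_single, ← lat_single,
        ← lat_add, ← lat_add, h.lat_eq] at ht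
      have := ht c d
      simp [boxExp, hc, hdS, Pi.single_eq_of_ne hcd.symm] at this
      omega
    · rintro ⟨lam, k⟩ ⟨hN, s, -, hs⟩
      refine Set.mem_biUnion (x := k) ⟨s, hs⟩ ⟨?_, rfl⟩
      simp only at hN
      change lam.1.card ≤ _
      omega

end EdgeVertex

end

section

open Character

variable {ε : Fin 4 → ℂ}

/-! ### Facets and vertices -/

lemma compl_singleton_eq_triple (a : Fin 4) : ∃ b c d : Fin 4, b ≠ c ∧ b ≠ d ∧ c ≠ d ∧
    ({a}ᶜ : Finset (Fin 4)) = {b, c, d} := by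
  revert a
  decide

lemma card_compl_singleton (a : Fin 4) : ({a}ᶜ : Finset (Fin 4)).card = 3 := by
  rw [Finset.card_compl, Finset.card_singleton, Fintype.card_fin]

lemma notMem_compl_singleton (a : Fin 4) : a ∉ ({a}ᶜ : Finset (Fin 4)) := by simp

lemma exchangeChar_facet_vertex (a : Fin 4) (u : Character) (w : ℂˣ) :
    exchangeChar ε {a}ᶜ {a} u (point w) = -(point (qProd ε {a}ᶜ * w) * dual u) := by
  have : (({a}ᶜ : Finset (Fin 4)) ∪ {a})ᶜ = ∅ := by
    rw [Finset.compl_eq_empty_iff, Finset.union_comm, Finset.union_compl]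
  rw [exchangeChar, this, card_compl_singleton, adamsChar, Finset.prod_empty, ← point_mul]
  ring

lemma exchangeChar_facet_vertex_coeff (a : Fin 4) (u : Character) (w x : ℂˣ) :
    (exchangeChar ε {a}ᶜ {a} u (point w)).coeff x = -u.coeff (qProd ε {a}ᶜ * w * x⁻¹) := by
  rw [exchangeChar_facet_vertex, coeff_neg_apply, coeff_point_mul_dual]

lemma exchange_facet_vertex (h : Generic ε) (a : Fin 4) (lam : Partition {a}ᶜ) (k : ℤ) :
    Exchange ε 1 0 0 1 ((opW ε a).dress opA lam.1 (logContent ε))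
      ((opS ε a).scale ((k : ℂ) * ε a))
      (exchangeChar ε {a}ᶜ {a} (shapeChar ε lam.1) (point (qUnit ε a ^ k))) := by
  have hcard := card_compl_singleton a
  have hne : ({a}ᶜ : Finset (Fin 4)).Nonempty := Finset.card_pos.1 (by omega)
  have ha := h.eps_ne_zero a
  have hdeg : deg (exchangeChar ε {a}ᶜ {a} (shapeChar ε lam.1) (point (qUnit ε a ^ k))) = -1 := by
    rw [exchangeChar_facet_vertex]
    simp [deg_shapeChar hne]
  refine ⟨?_, ?_, ?_, ?_, ?_, ?_⟩
  · exact h.contraction_exchangeChar (by simp)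
      (fun n hn => h.dress_kappa _ (fun _ => rfl) lam.1 n hn) (fun n _ => opS_kappa a k n)
  · rw [hdeg]
    simp [opW, opS, VertexOp.scale, ha]
  · simp [opW, opS, VertexOp.scale, ha]
  · rw [hdeg]; rfl
  -- The total phase is `-q_a^{1-k}`; its sign is the `π i` of `log (-q_a)`.
  · have h4 : ((opW ε a).dress opA lam.1 (logContent ε)).c *
        ((opS ε a).scale ((k : ℂ) * ε a)).d +
        ((opW ε a).dress opA lam.1 (logContent ε)).c' * ((opS ε a).scale ((k : ℂ) * ε a)).d' -
        ((opS ε a).scale ((k : ℂ) * ε a)).c * ((opW ε a).dress opA lam.1 (logContent ε)).d -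
        ((opS ε a).scale ((k : ℂ) * ε a)).c' * ((opW ε a).dress opA lam.1 (logContent ε)).d' =
        ε a + Real.pi * Complex.I - k * ε a := by
      rw [h.opS_scale_c]
      simp only [dress_opA_d, dress_opA_d', dress_opA_c']
      simp only [opW, opS, VertexOp.scale]
      field_simp
      ring
    have h5 : (qUnit ε a : ℂˣ) ^ k = Units.mk0 (Complex.exp (k * ε a)) (Complex.exp_ne_zero _) := by
      ext
      rw [Units.val_zpow_eq_zpow_val, coe_qUnit, q, ← Complex.exp_int_mul]
      rfl
    rw [h4, exchangeChar_facet_vertex, signedDet_neg, signedDet_point_mul, signedDet_dual,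
      signedDet_shapeChar (by omega), deg_dual, deg_shapeChar hne,
      eq_inv_of_mul_eq_one_left (qProd_compl_mul h a), h5, one_mul, Complex.exp_sub,
      Complex.exp_add, Complex.exp_pi_mul_I]
    simp [q]
    field_simp
  · intro x
    obtain ⟨b, c, d, hbc, hbd, hcd, hS⟩ := compl_singleton_eq_triple a
    rw [exchangeChar_facet_vertex_coeff]
    have := (h.shapeChar_coeff_triple hbc hbd hcd hS (notMem_compl_singleton a) lam.2
      (qProd ε {a}ᶜ * qUnit ε a ^ k * x⁻¹)).1
    omega

/-- No directions are left over, so the exchange character is minus a rescaled dual boundary. Its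
poles are the coefficients `1` of the boundary, which for plane partitions comprise both the addable
and the removable boxes. -/
lemma pole_facet_vertex (h : Generic ε) (a : Fin 4) (lam : Partition {a}ᶜ) (k : ℤ) (u : ℂˣ) :
    (exchangeChar ε {a}ᶜ {a} (shapeChar ε lam.1) (point (qUnit ε a ^ k))).coeff u = -1 ↔
      (∃ s, Addable lam.1 s ∧ u = qUnit ε a ^ (k - 1) * (contentUnit ε s)⁻¹) ∨
      ∃ s, Removable lam.1 s ∧ u = qUnit ε a ^ k * (contentUnit ε s)⁻¹ := by
  obtain ⟨b, c, d, hbc, hbd, hcd, hS⟩ := compl_singleton_eq_triple a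
  have h1 := (h.shapeChar_coeff_triple hbc hbd hcd hS (notMem_compl_singleton a) lam.2
    (qProd ε {a}ᶜ * qUnit ε a ^ k * u⁻¹)).2
  have hq := qProd_compl_mul h a
  have e1 : ∀ s : (({a}ᶜ : Finset (Fin 4)) → ℕ), qProd ε {a}ᶜ * qUnit ε a ^ k * u⁻¹ =
      contentUnit ε s ↔ u = qUnit ε a ^ (k - 1) * (contentUnit ε s)⁻¹ := by
    intro s
    rw [eq_inv_of_mul_eq_one_left hq, mul_comm (qUnit ε a)⁻¹, ← zpow_sub_one,
      mul_inv_eq_iff_eq_mul, eq_mul_inv_iff_mul_eq, mul_comm u, eq_comm]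
  have e2 : ∀ s : (({a}ᶜ : Finset (Fin 4)) → ℕ), qProd ε {a}ᶜ * qUnit ε a ^ k * u⁻¹ =
      contentUnit ε s * qProd ε {a}ᶜ ↔ u = qUnit ε a ^ k * (contentUnit ε s)⁻¹ := by
    intro s
    rw [mul_assoc, mul_comm (contentUnit ε s), mul_right_inj, mul_inv_eq_iff_eq_mul,
      eq_mul_inv_iff_mul_eq, mul_comm u, eq_comm]
  simp only [e1, e2] at h1
  rw [exchangeChar_facet_vertex_coeff, neg_inj, h1]
  constructor
  · rintro ⟨s, h' | h'⟩
    exacts [Or.inl ⟨s, h'⟩, Or.inr ⟨s, h'⟩]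
  · rintro (⟨s, h'⟩ | ⟨s, h'⟩)
    exacts [⟨s, Or.inl h'⟩, ⟨s, Or.inr h'⟩]

/-- The residues cancel when a box is added to a plane partition. -/
lemma residue_facet_vertex (h : Generic ε) (a : Fin 4) (lam : Partition {a}ᶜ)
    {s : ({a}ᶜ : Finset (Fin 4)) → ℕ} (hs : Addable lam.1 s) (k : ℤ) :
    facetCoeff ε a (insert s lam.1) * (qUnit ε a ^ (k - 1) *
      index (point (qUnit ε a ^ (k - 1) * (contentUnit ε s)⁻¹)⁻¹ *
        exchangeChar ε {a}ᶜ {a} (shapeChar ε (insert s lam.1)) (point (qUnit ε a ^ (k - 1))))) =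
    -(facetCoeff ε a lam.1 * (qUnit ε a ^ k *
      index (point (qUnit ε a ^ (k - 1) * (contentUnit ε s)⁻¹)⁻¹ *
        exchangeChar ε {a}ᶜ {a} (shapeChar ε lam.1) (point (qUnit ε a ^ k))))) := by
  obtain ⟨b, c, d, hbc, hbd, hcd, hS⟩ := compl_singleton_eq_triple a
  have hcard := card_compl_singleton a
  have hne : ({a}ᶜ : Finset (Fin 4)).Nonempty := Finset.card_pos.1 (by omega)
  have hq := qProd_compl_mul h a
  have hq' := eq_inv_of_mul_eq_one_left hq
  have hdual := dual_adamsChar (ε := ε) {a}ᶜ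
  rw [hcard, hq'] at hdual
  obtain ⟨y, hy⟩ : ∃ y, y = point (contentUnit ε s) * dual (shapeChar ε lam.1) := ⟨_, rfl⟩
  have hy1 : y.coeff 1 = 1 := by
    rw [hy, coeff_point_mul_dual, inv_one, mul_one]
    exact (h.shapeChar_coeff_triple hbc hbd hcd hS (notMem_compl_singleton a) lam.2 _).2.2
      ⟨s, Or.inl ⟨hs, rfl⟩⟩
  have hia := point_mul_inv (qUnit ε a)
  have his := point_mul_inv (contentUnit ε s)
  have hiw := point_mul_inv (qUnit ε a ^ (k - 1))
  have hk : point (qUnit ε a ^ k) = point (qUnit ε a ^ (k - 1)) * point (qUnit ε a) := by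
    rw [point_mul, ← zpow_add_one, sub_add_cancel]
  have e1 : point (qUnit ε a ^ (k - 1) * (contentUnit ε s)⁻¹)⁻¹ *
      exchangeChar ε {a}ᶜ {a} (shapeChar ε lam.1) (point (qUnit ε a ^ k)) = -y := by
    rw [exchangeChar_facet_vertex, ← point_mul, hk, mul_inv, inv_inv, ← point_mul, hy, hq']
    generalize point (qUnit ε a ^ (k - 1)) = P at *
    generalize point (qUnit ε a ^ (k - 1))⁻¹ = P' at *
    linear_combination -point (contentUnit ε s) * dual (shapeChar ε lam.1) * (
      point (qUnit ε a) * point (qUnit ε a)⁻¹ * hiw + hia)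
  have e2 : point (qUnit ε a ^ (k - 1) * (contentUnit ε s)⁻¹)⁻¹ *
      exchangeChar ε {a}ᶜ {a} (shapeChar ε (insert s lam.1)) (point (qUnit ε a ^ (k - 1))) =
      -(point (qUnit ε a)⁻¹ * y) - adamsChar ε {a}ᶜ := by
    rw [exchangeChar_facet_vertex, ← point_mul, mul_inv, inv_inv, ← point_mul, hy,
      shapeChar_insert hs.1, map_sub, map_mul, dual_point, hq']
    generalize point (qUnit ε a ^ (k - 1)) = P at *
    generalize point (qUnit ε a ^ (k - 1))⁻¹ = P' at *
    linear_combination -point (qUnit ε a)⁻¹ * point (contentUnit ε s) *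
      (dual (shapeChar ε lam.1) - dual (adamsChar ε {a}ᶜ) * point (contentUnit ε s)⁻¹) * hiw +
      point (qUnit ε a)⁻¹ * dual (adamsChar ε {a}ᶜ) * his + hdual
  -- The residues differ by the antisymmetric parts of `X` and of `y`, with indices `-q_a / χ(s)`
  -- and `χ(s)`. The product `-q_a` compensates the change from `q_a^k` to `q_a^{k-1}` in the phase
  -- and gives the sign.
  obtain ⟨X, hX⟩ : ∃ X, X = point (qUnit ε a * (contentUnit ε s)⁻¹) := ⟨_, rfl⟩
  have e3 : (point (qUnit ε a) * point (contentUnit ε s)⁻¹ -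
        point (qUnit ε a)⁻¹ * point (contentUnit ε s) + point (qUnit ε a)⁻¹ * y - dual y +
        adamsChar ε {a}ᶜ) + (-(point (qUnit ε a)⁻¹ * y) - adamsChar ε {a}ᶜ) =
      -y + (X - dual X) + (y - dual y) := by
    rw [hX, dual_point, mul_inv, inv_inv, ← point_mul, ← point_mul]
    ring
  have iX : signedDet X * (-1) ^ X.coeff 1 = -(qUnit ε a * (contentUnit ε s)⁻¹) := by
    rw [hX, signedDet_point, coeff_point, if_neg, zpow_zero, mul_one]
    rw [qUnit_eq_lat, contentUnit, ← lat_neg, ← lat_add, h.lat_eq_one]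
    -- The exponent of `X` is `1` in direction `a` and at most `0` in direction `b`, so it is not on
    -- the diagonal.
    intro h'
    have h1 := h' a b
    have hba : b ∈ ({a}ᶜ : Finset (Fin 4)) := by simp [hS]
    have hab : b ≠ a := by simpa using hba
    have := boxExp_nonneg s b
    have h3 : boxExp s a = 0 := suppIn_boxExp s a (notMem_compl_singleton a)
    simp only [Pi.add_apply, Pi.neg_apply, Pi.single_eq_same, Pi.single_eq_of_ne hab, h3] at h1
    omega
  have iY : signedDet y * (-1) ^ y.coeff 1 = contentUnit ε s := by
    rw [hy1, hy, signedDet_point_mul, deg_dual, deg_shapeChar hne, signedDet_dual,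
      signedDet_shapeChar (by omega)]
    simp
  rw [facetCoeff_insert hcard hq hs.1 hy, e1, e2]
  have e4 := congrArg index e3
  rw [index_add (-y + (X - dual X)), index_add (-y), index_sub_dual, index_sub_dual, iX, iY] at e4
  have hk' : qUnit ε a ^ k = qUnit ε a ^ (k - 1) * qUnit ε a := by
    rw [← zpow_add_one, sub_add_cancel]
  calc _ = facetCoeff ε a lam.1 * (qUnit ε a ^ (k - 1)) * index (_ + _) := by
        rw [index_add _ (-(point (qUnit ε a)⁻¹ * y) - adamsChar ε {a}ᶜ), mul_assoc,
          mul_left_comm (index _), ← mul_assoc]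
    _ = _ := by
      rw [e4, hk']
      generalize qUnit ε a ^ (k - 1) = w
      ext
      push_cast
      have := (contentUnit ε s).ne_zero
      field_simp

theorem commuteUpTo_facet_vertex (h : Generic ε) (a : Fin 4) :
    CommuteUpTo ε 1 0 0 (qqChar ε (.facet a)) (qqChar ε (.vertex a)) := by
  obtain ⟨b, c, d, hbc, hbd, hcd, hS⟩ := compl_singleton_eq_triple a
  have hcard := card_compl_singleton a
  have haS := notMem_compl_singleton a
  have hbS : b ∈ ({a}ᶜ : Finset (Fin 4)) := by simp [hS]
  have hcS : c ∈ ({a}ᶜ : Finset (Fin 4)) := by simp [hS]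
  have hba : b ≠ a := by simpa using hbS
  suffices hs : CommuteUpTo ε 1 ((0 : ℤ) : ℂ) ((0 : ℤ) : ℂ) (qqChar ε (.facet a))
      (qqChar ε (.vertex a)) by
    rwa [Int.cast_zero] at hs
  refine h.commuteUpTo_vertex (V := opW ε a) (e := a) ⟨a, haS⟩ (τ := 1)
    (Z := fun lam => ZD6 ε a lam.1)
    (fun i => exchangeChar ε {a}ᶜ {a} (shapeChar ε i.1.1) (point (qUnit ε a ^ i.2)))
    (fun i => exchange_facet_vertex h a i.1 i.2) (fun i u => pole_facet_vertex h a i.1 i.2 u)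
    ?_ ?_ ?_
  -- Since `q_a⁻¹ = q_b q_c q_d`, the excluded equality puts `s` at `t + (1, 1, 1)`.
  · intro lam s t hs ht hst
    refine hs.ne_removable lam.2 (by omega) ht ?_
    refine h.lat_injOn haS (suppIn_boxExp s) ((suppIn_boxExp t).add_stepSet subset_rfl) ?_
    rw [← contentUnit_mul_qProd, hst, mul_comm (qUnit ε a), mul_assoc, mul_comm (qUnit ε a),
      qProd_compl_mul h, mul_one]
    rfl
  · rintro i j u ⟨s, hs, h1, h2, rfl⟩
    have := congrArg Units.val (residue_facet_vertex h a i.1 hs i.2)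
    have hexp : ∀ k : ℤ, Complex.exp (-k * (opW ε a).d) = ((qUnit ε a ^ k : ℂˣ) : ℂ) := by
      intro k
      rw [Units.val_zpow_eq_zpow_val, coe_qUnit, q, ← Complex.exp_int_mul]
      simp [opW]
    simp only [hexp, ZD6_eq h, h1, h2]
    simp only [Units.val_mul, Units.val_neg] at this
    rw [this]
    ring
  · intro N u
    by_cases hne : ∃ (k : ℤ) (s : ({a}ᶜ : Finset (Fin 4)) → ℕ),
        u = qUnit ε a ^ k * (contentUnit ε s)⁻¹
    swap
    · refine Set.Finite.subset Set.finite_empty ?_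
      rintro i ⟨-, s, -, hs⟩
      exact hne ⟨_, s, hs⟩
    obtain ⟨k₀, s₀, h₀⟩ := hne
    -- Here `u` does not determine `k`: boxes along a diagonal, with `s i + k` fixed, give the same
    -- point. Nonnegativity of `s` bounds `k` above. Below, a box of depth `k₀ - k` needs at least
    -- `2 (k₀ - k) + 1` boxes while the level allows `N - k`, so `k` is bounded by about `2 k₀ - N`.
    refine Set.Finite.subset (s := ⋃ k ∈ Set.Icc (min k₀ (2 * k₀ - N)) (k₀ + s₀ ⟨b, hbS⟩),
      {lam : Partition {a}ᶜ | lam.1.card ≤ (N - k).toNat} ×ˢ {k}) ?_ ?_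
    · exact Set.Finite.biUnion (Set.finite_Icc _ _) fun k _ =>
        (Partition.finite_card_le _ _).prod (Set.finite_singleton k)
    · rintro ⟨lam, k⟩ ⟨hN, s, hs, hu⟩
      simp only at hN hu
      refine Set.mem_biUnion (x := k) ?_ ⟨?_, rfl⟩
      · rw [hu, contentUnit, contentUnit, ← lat_neg, ← lat_neg, ← lat_single, ← lat_single,
          ← lat_add, ← lat_add, h.lat_eq] at h₀
        have key : ∀ i : ({a}ᶜ : Finset (Fin 4)), (s i : ℤ) + k = s₀ i + k₀ := by
          intro i
          have hia : i.1 ≠ a := fun h' =>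
            Finset.mem_compl.1 i.2 (Finset.mem_singleton.2 h')
          have := h₀ i a
          have ei : ∀ t : ({a}ᶜ : Finset (Fin 4)) → ℕ, boxExp t i = t i := fun t => by
            rw [boxExp, dif_pos i.2]
          have ea : ∀ t : ({a}ᶜ : Finset (Fin 4)) → ℕ, boxExp t a = 0 := fun t =>
            suppIn_boxExp t a haS
          simp only [Pi.add_apply, Pi.neg_apply, Pi.single_eq_same, Pi.single_eq_of_ne hia, ei,
            ea] at this
          omega
        have hm := Partition.card_ge_of_mem (a := ⟨b, hbS⟩) (b := ⟨c, hcS⟩)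
          (fun h' => hbc (congrArg Subtype.val h')) lam (m := (k₀ - k).toNat)
          (fun i => by have := key i; omega) hs
        have := key ⟨b, hbS⟩
        rw [Set.mem_Icc]
        omega
      · change lam.1.card ≤ _
        omega

end

section

open Character

variable {ε : Fin 4 → ℂ}

/-! ### Two vertices -/

section VertexVertex

variable {a b : Fin 4}

lemma exchangeChar_vertex_vertex (w w' : ℂˣ) : exchangeChar ε {a} {b} (point w) (point w') =
    -(point (qUnit ε a * w⁻¹ * w') * adamsChar ε ({a} ∪ {b})ᶜ) := by
  rw [exchangeChar, Finset.card_singleton, qProd, Finset.prod_singleton, dual_point, ← point_mul,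
    ← point_mul]
  ring

lemma adamsChar_pair_coeff (h : Generic ε) {c d o : Fin 4} (hcd : c ≠ d) (hc : c ≠ o) (hd : d ≠ o)
    (x : ℂˣ) : (adamsChar ε {c, d}).coeff x ≤ 1 ∧
      ((adamsChar ε {c, d}).coeff x = 1 ↔ x = 1 ∨ x = qUnit ε c * qUnit ε d) := by
  have e : adamsChar ε {c, d} = 1 - point (qUnit ε c) - point (qUnit ε d) +
      point (qUnit ε c * qUnit ε d) := by
    rw [adamsChar, Finset.prod_pair hcd, ← point_mul]
    ring
  have hl : ∀ v : Fin 4 → ℤ, v c ≠ v o → lat ε v ≠ 1 := fun v hv h' => hv (h.lat_eq_one.1 h' c o)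
  have hl' : ∀ v : Fin 4 → ℤ, v d ≠ v o → lat ε v ≠ 1 := fun v hv h' => hv (h.lat_eq_one.1 h' d o)
  have h1 : qUnit ε c ≠ 1 := by
    rw [qUnit_eq_lat]
    exact hl _ (by simp [Pi.single_eq_of_ne hc.symm])
  have h2 : qUnit ε d ≠ 1 := by
    rw [qUnit_eq_lat]
    exact hl' _ (by simp [Pi.single_eq_of_ne hd.symm])
  have h3 : qUnit ε c * qUnit ε d ≠ 1 := by
    rw [qUnit_eq_lat, qUnit_eq_lat, ← lat_add]
    exact hl _ (by simp [Pi.single_eq_of_ne hc.symm, Pi.single_eq_of_ne hd.symm,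
      Pi.single_eq_of_ne hcd])
  have h4 : qUnit ε c * qUnit ε d ≠ qUnit ε c := by simpa using h2
  have h5 : qUnit ε c * qUnit ε d ≠ qUnit ε d := by simpa using h1
  rw [e, coeff_add_apply, coeff_sub_apply, coeff_sub_apply, coeff_one, coeff_point, coeff_point,
    coeff_point]
  by_cases e1 : x = 1
  · subst e1
    simp [h1, h2, h3]
  by_cases e2 : x = qUnit ε c * qUnit ε d
  · subst e2
    simp [h3, Ne.symm h4, Ne.symm h5]
  simp only [e1, if_false, Ne.symm e2, e2, or_self, iff_false]
  split_ifs <;> simp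

lemma signedDet_adamsChar_pair {c d : Fin 4} (hcd : c ≠ d) :
    signedDet (adamsChar ε {c, d}) = 1 := by
  rw [← mul_one (adamsChar ε {c, d}), signedDet_adamsChar_mul (Finset.card_pair hcd).ge]

/-- With `c, d` the two other directions, the contraction has the two poles of `P_{cd}⁻¹`, whose
ratio is `q_c q_d = (q_a q_b)⁻¹`. The move `(k, l) ↦ (k - 1, l + 1)` shifts them by `q_a q_b`, so
the second pole of the partner falls on the first pole of the original term. -/
theorem commuteUpTo_vertex_vertex (h : Generic ε) (hab : a ≠ b) :
    CommuteUpTo ε 1 0 0 (qqChar ε (.vertex a)) (qqChar ε (.vertex b)) := by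
  obtain ⟨c, d, hcd, hS, hca, hda, hcb, hdb⟩ : ∃ c d : Fin 4, c ≠ d ∧
      (({a} : Finset (Fin 4)) ∪ {b})ᶜ = {c, d} ∧ c ≠ a ∧ d ≠ a ∧ c ≠ b ∧ d ≠ b := by
    revert a b
    decide
  have hG := adamsChar_pair_coeff h hcd hca hda
  have hM : ∀ k l : ℤ, exchangeChar ε {a} {b} (point (qUnit ε a ^ k)) (point (qUnit ε b ^ l)) =
      -(point (qUnit ε a ^ (1 - k) * qUnit ε b ^ l) * adamsChar ε {c, d}) := by
    intro k l
    rw [exchangeChar_vertex_vertex, hS, zpow_sub, zpow_one]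
  have hMc : ∀ (k l : ℤ) (x : ℂˣ), (exchangeChar ε {a} {b} (point (qUnit ε a ^ k))
      (point (qUnit ε b ^ l))).coeff x =
        -(adamsChar ε {c, d}).coeff ((qUnit ε a ^ (1 - k) * qUnit ε b ^ l)⁻¹ * x) := by
    intro k l x
    rw [hM, coeff_neg_apply, point_mul_coeff]
  have hq : qUnit ε a * qUnit ε b * (qUnit ε c * qUnit ε d) = 1 := by
    have := qProd_mul_qProd_compl h ({a} ∪ {b})
    rw [hS, qProd, qProd, Finset.prod_pair hcd, ← Finset.insert_eq, Finset.prod_pair hab] at this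
    exact this
  have hpole : ∀ (u : ℂˣ) (k l : ℤ), (exchangeChar ε {a} {b} (point (qUnit ε a ^ k))
      (point (qUnit ε b ^ l))).coeff u = -1 ↔ u = qUnit ε a ^ (1 - k) * qUnit ε b ^ l ∨
        u = qUnit ε a ^ (-k) * qUnit ε b ^ (l - 1) := by
    intro u k l
    rw [hMc, neg_inj, (hG _).2, inv_mul_eq_one, inv_mul_eq_iff_eq_mul,
      eq_inv_of_mul_eq_one_right hq, zpow_sub, zpow_sub_one, zpow_neg, zpow_one, mul_inv,
      eq_comm (b := u)]
    have e : qUnit ε a * (qUnit ε a ^ k)⁻¹ * qUnit ε b ^ l * ((qUnit ε a)⁻¹ * (qUnit ε b)⁻¹) =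
        (qUnit ε a ^ k)⁻¹ * (qUnit ε b ^ l * (qUnit ε b)⁻¹) := by
      generalize qUnit ε a ^ k = A
      generalize qUnit ε b ^ l = B
      calc _ = qUnit ε a * (qUnit ε a)⁻¹ * (A⁻¹ * (B * (qUnit ε b)⁻¹)) := by
            simp only [mul_comm, mul_left_comm, mul_assoc]
        _ = _ := by rw [mul_inv_cancel, one_mul]
    rw [e]
  have hex : ∀ k l : ℤ, Exchange ε 1 0 0 0 ((opS ε a).scale ((k : ℂ) * ε a))
      ((opS ε b).scale ((l : ℂ) * ε b))
      (exchangeChar ε {a} {b} (point (qUnit ε a ^ k)) (point (qUnit ε b ^ l))) := by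
    intro k l
    have hdeg : deg (exchangeChar ε {a} {b} (point (qUnit ε a ^ k)) (point (qUnit ε b ^ l))) =
        0 := by
      rw [hM, map_neg, map_mul, deg_adamsChar (Finset.insert_nonempty _ _)]
      simp
    refine ⟨?_, ?_, ?_, ?_, ?_, ?_⟩
    · exact h.contraction_exchangeChar (by simpa using hab) (fun n _ => opS_kappa a k n)
        (fun n _ => opS_kappa b l n)
    · rw [hdeg]
      simp [opS, VertexOp.scale]
    · simp [opS, VertexOp.scale]
    · rw [hdeg]; rfl
    · rw [hM, signedDet_neg, signedDet_point_mul, deg_adamsChar (Finset.insert_nonempty _ _),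
        signedDet_adamsChar_pair hcd]
      simp [opS, VertexOp.scale]
    · intro x
      have := (hG ((qUnit ε a ^ (1 - k) * qUnit ε b ^ l)⁻¹ * x)).1
      rw [hMc]
      omega
  have hmatch : ∀ (u : ℂˣ) (i : ℤ × ℤ),
      (exchangeChar ε {a} {b} (point (qUnit ε a ^ i.1)) (point (qUnit ε b ^ i.2))).coeff u = -1 ↔
      (∃ j : ℤ × ℤ, u = qUnit ε a ^ (1 - i.1) * qUnit ε b ^ i.2 ∧ j.1 = i.1 - 1 ∧ j.2 = i.2 + 1) ∨
      ∃ j : ℤ × ℤ, u = qUnit ε a ^ (1 - j.1) * qUnit ε b ^ j.2 ∧ i.1 = j.1 - 1 ∧ i.2 = j.2 + 1 := by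
    rintro u ⟨k, l⟩
    refine (hpole u k l).trans (or_congr ?_ ?_)
    · exact ⟨fun hu => ⟨(k - 1, l + 1), hu, rfl, rfl⟩, fun ⟨_, hu, _⟩ => hu⟩
    · constructor
      · intro hu
        refine ⟨(k + 1, l - 1), ?_, (add_sub_cancel_right _ _).symm, (sub_add_cancel _ _).symm⟩
        rw [hu]
        congr 2
        ring
      · rintro ⟨⟨k', l'⟩, hu, rfl, rfl⟩
        rw [hu]
        congr 2
        · ring
        · ring
  suffices hs : CommuteUpTo ε 1 ((0 : ℤ) : ℂ) ((0 : ℤ) : ℂ) (qqChar ε (.vertex a))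
      (qqChar ε (.vertex b)) by
    rwa [Int.cast_zero] at hs
  refine commuteUpTo_of_matching (T := qqChar ε (.vertex a)) (T' := qqChar ε (.vertex b)) h.sum
    (τ := 0) (P := -(1 / ε b)) (P' := 0)
    (fun i : ℤ × ℤ => exchangeChar ε {a} {b} (point (qUnit ε a ^ i.1)) (point (qUnit ε b ^ i.2)))
    ?_ (fun _ => rfl) (fun _ => rfl)
    (fun u (i : ℤ × ℤ) (j : ℤ × ℤ) => u = qUnit ε a ^ (1 - i.1) * qUnit ε b ^ i.2 ∧
      j.1 = i.1 - 1 ∧ j.2 = i.2 + 1) ?_ ?_ ?_ ?_ ?_ ?_ ?_ ?_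
  · exact fun i => hex i.1 i.2
  · exact hmatch
  · rintro u (i : ℤ × ℤ) (j : ℤ × ℤ) (j' : ℤ × ℤ) ⟨-, h1, h2⟩ ⟨-, h3, h4⟩
    exact Prod.ext (h1.trans h3.symm) (h2.trans h4.symm)
  · rintro u (i : ℤ × ℤ) (i' : ℤ × ℤ) (j : ℤ × ℤ) ⟨-, h1, h2⟩ ⟨-, h3, h4⟩
    exact Prod.ext (by omega) (by omega)
  · rintro u (i : ℤ × ℤ) (j : ℤ × ℤ) (k : ℤ × ℤ) ⟨h1, -, -⟩ ⟨h2, h3, h4⟩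
    rw [h1, h3, h4, ← lat_single, ← lat_single, ← lat_single, ← lat_single, ← lat_add, ← lat_add,
      h.lat_eq] at h2
    have := h2 a c
    simp [Pi.single_eq_of_ne hca, Pi.single_eq_of_ne hcb, Pi.single_eq_of_ne hab] at this
  · rintro u (i : ℤ × ℤ) (j : ℤ × ℤ) ⟨-, h1, h2⟩
    change i.1 + i.2 = j.1 + j.2
    omega
  · rintro u (i : ℤ × ℤ) (j : ℤ × ℤ) ⟨hu, h1, h2⟩
    refine VertexOp.merge_eq (V := (opS ε a).scale ((j.1 : ℂ) * ε a))
      (V' := (opS ε b).scale ((j.2 : ℂ) * ε b)) (W := (opS ε a).scale ((i.1 : ℂ) * ε a))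
      (W' := (opS ε b).scale ((i.2 : ℂ) * ε b)) (fun n hn => ?_) rfl rfl ?_ ?_ rfl rfl
    · rw [opS_scale_kappa, opS_scale_kappa, opS_scale_kappa, opS_scale_kappa, hu, h1, h2]
      have ha : 1 - q ε a ^ (-n) ≠ 0 := h.one_sub_ne_zero a (neg_ne_zero.2 hn)
      have hb : 1 - q ε b ^ (-n) ≠ 0 := h.one_sub_ne_zero b (neg_ne_zero.2 hn)
      have hka : qUnit ε a ^ i.1 = qUnit ε a ^ (i.1 - 1) * qUnit ε a := by
        rw [← zpow_add_one, sub_add_cancel]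
      have hk' : qUnit ε a ^ (1 - i.1) = (qUnit ε a ^ (i.1 - 1))⁻¹ := by
        rw [← zpow_neg, neg_sub]
      rw [hk', hka, zpow_add_one]
      have hw := (qUnit ε a ^ (i.1 - 1)).ne_zero
      have hw' := (qUnit ε b ^ i.2).ne_zero
      generalize qUnit ε a ^ (i.1 - 1) = w at *
      generalize qUnit ε b ^ i.2 = w' at *
      push_cast
      simp only [coe_qUnit, mul_zpow, mul_inv, inv_inv, inv_zpow', neg_neg]
      have e1 : (w' : ℂ) ^ n * (w' : ℂ) ^ (-n) = 1 := by
        rw [← zpow_add₀ hw']; simp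
      field_simp
      linear_combination (-(1 - q ε b ^ (-n)) * (1 - q ε a ^ (-n))) * e1
    · rw [h.opS_scale_c, h.opS_scale_c, h.opS_scale_c, h.opS_scale_c, h1, h2]
      push_cast
      ring
    · simp [VertexOp.scale, opS]
  · rintro u (i : ℤ × ℤ) (j : ℤ × ℤ) ⟨hu, h1, h2⟩
    have hr : ∀ i : ℤ × ℤ, residue (qqChar ε (.vertex a)) (qqChar ε (.vertex b))
        (exchangeChar ε {a} {b} (point (qUnit ε a ^ i.1)) (point (qUnit ε b ^ i.2))) u i =
        index (point u⁻¹ * exchangeChar ε {a} {b} (point (qUnit ε a ^ i.1))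
          (point (qUnit ε b ^ i.2))) := by
      intro i
      simp [residue, qqChar, VertexOp.scale, opS]
    refine (congrArg₂ (· + ·) (hr i) (hr j)).trans ?_
    have hw := point_mul_inv (qUnit ε a ^ (1 - i.1) * qUnit ε b ^ i.2)
    have e1 : point u⁻¹ * exchangeChar ε {a} {b} (point (qUnit ε a ^ i.1))
        (point (qUnit ε b ^ i.2)) = -adamsChar ε {c, d} := by
      rw [hM, hu]
      linear_combination -adamsChar ε {c, d} * hw
    -- The characters of the two residues are `-P_{cd}` and `-dual P_{cd}`. The antisymmetric
    -- difference has signed determinant `1` and contains the point `1` once, which gives the sign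
    -- `-1`.
    have e2 : point u⁻¹ * exchangeChar ε {a} {b} (point (qUnit ε a ^ j.1))
        (point (qUnit ε b ^ j.2)) =
        -adamsChar ε {c, d} + (adamsChar ε {c, d} - dual (adamsChar ε {c, d})) := by
      have hd := dual_adamsChar (ε := ε) {c, d}
      rw [Finset.card_pair hcd, qProd, Finset.prod_pair hcd, eq_inv_of_mul_eq_one_right hq] at hd
      have e3 : qUnit ε a ^ (1 - j.1) * qUnit ε b ^ j.2 =
          qUnit ε a ^ (1 - i.1) * qUnit ε b ^ i.2 * (qUnit ε a * qUnit ε b) := by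
        have : 1 - j.1 = (1 - i.1) + 1 := by omega
        rw [this, h2, zpow_add_one, zpow_add_one]
        exact mul_mul_mul_comm _ _ _ _
      have hab' := point_mul_inv (qUnit ε a * qUnit ε b)
      rw [hM, e3, ← point_mul _ (qUnit ε a * qUnit ε b), hu]
      linear_combination (-point (qUnit ε a * qUnit ε b) * adamsChar ε {c, d}) * hw +
        point (qUnit ε a * qUnit ε b) * hd - dual (adamsChar ε {c, d}) * hab'
    rw [index_eq_of_eq_add e2, e1, signedDet_adamsChar_pair hcd, (hG 1).2.2 (Or.inl rfl)]
    simp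
  · intro N u
    refine Set.Finite.subset (s := {i : ℤ × ℤ | u = qUnit ε a ^ (1 - i.1) * qUnit ε b ^ i.2} ∪
      {i : ℤ × ℤ | u = qUnit ε a ^ (-i.1) * qUnit ε b ^ (i.2 - 1)}) ?_
      fun i hi => (hpole u i.1 i.2).1 hi.2
    refine Set.Finite.union (Set.Subsingleton.finite ?_) (Set.Subsingleton.finite ?_)
    all_goals
      rintro i hi j hj
      rw [Set.mem_ofPred_eq, ← lat_single, ← lat_single, ← lat_add] at hi hj
      rw [hi, h.lat_eq] at hj
      have h1 := hj a c
      have h2 := hj b c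
      simp [Pi.single_eq_of_ne hca, Pi.single_eq_of_ne hcb, Pi.single_eq_of_ne hab,
        Pi.single_eq_of_ne hab.symm] at h1 h2
      exact Prod.ext (by omega) (by omega)

end VertexVertex

end

section

open Character

variable {ε : Fin 4 → ℂ}

/-! ### Two edges -/

lemma coeff_dual_mul (M N : Character) (x : ℂˣ) :
    (dual M * N).coeff x = M.coeff.sum fun y n => n * N.coeff (y * x) := by
  induction M using Character.induction with
  | h0 => simp
  | hadd v M h =>
    rw [map_add, add_mul, coeff_add_apply, h, dual_point, point_mul_coeff, inv_inv,
      MonoidAlgebra.coeff_add, Finsupp.sum_add_index' (fun _ => zero_mul _)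
      (fun _ _ _ => add_mul _ _ _)]
    simp [point]
  | hsub v M h =>
    rw [map_sub, sub_mul, coeff_sub_apply, h, dual_point, point_mul_coeff, inv_inv,
      MonoidAlgebra.coeff_sub, Finsupp.sum_sub_index (fun _ _ _ => sub_mul _ _ _)]
    simp [point]

lemma coeff_dual_mul_eq_of_unique {M N : Character} {x y : ℂˣ}
    (huniq : ∀ y', M.coeff y' ≠ 0 → N.coeff (y' * x) ≠ 0 → y' = y) :
    (dual M * N).coeff x = M.coeff y * N.coeff (y * x) := by
  rw [coeff_dual_mul, Finsupp.sum, Finset.sum_eq_single y]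
  · intro y' hy' hne
    by_contra h
    exact hne (huniq y' (left_ne_zero_of_mul h) (right_ne_zero_of_mul h))
  · intro hy
    rw [Finsupp.notMem_support_iff.1 hy, zero_mul]

lemma exists_of_coeff_dual_mul_ne_zero {M N : Character} {x : ℂˣ}
    (h : (dual M * N).coeff x ≠ 0) : ∃ y, M.coeff y ≠ 0 ∧ N.coeff (y * x) ≠ 0 := by
  by_contra! hc
  refine h ?_
  rw [coeff_dual_mul, Finsupp.sum, Finset.sum_eq_zero]
  intro y _
  by_cases hy : M.coeff y = 0
  · rw [hy, zero_mul]
  · rw [hc y hy, mul_zero]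

section EdgeEdge

variable {S S' : Finset (Fin 4)} {a b c d : Fin 4}

lemma exchangeChar_edge_edge (hS : S.card = 2) (hSS : Sᶜ = S') (u u' : Character) :
    exchangeChar ε S S' u u' = point (qProd ε S) * (dual u * u') := by
  have : (S ∪ S')ᶜ = ∅ := by
    rw [Finset.compl_eq_empty_iff, ← hSS, Finset.union_compl]
  rw [exchangeChar, this, hS, adamsChar, Finset.prod_empty]
  ring

lemma lat_smul_stepSet (S : Finset (Fin 4)) (m : ℤ) : lat ε (m • stepSet S) = qProd ε S ^ m := by
  rw [← lat_stepSet]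
  simp [lat, zpow_mul', Finset.prod_zpow]

/-- Ratios of contents in complementary directions only agree along diagonals. -/
lemma Generic.diagonal_of_ratio (h : Generic ε) (hSS : Sᶜ = S') {v v' w w' : Fin 4 → ℤ}
    (hne : S.Nonempty) (hv : SuppIn S v) (hv' : SuppIn S v') (hw : SuppIn S' w) (hw' : SuppIn S' w')
    (he : lat ε w * (lat ε v)⁻¹ = lat ε w' * (lat ε v')⁻¹) :
    ∃ m : ℤ, lat ε v' = lat ε v * qProd ε S ^ m ∧ lat ε w' = lat ε w * qProd ε S ^ m := by
  obtain ⟨o, ho⟩ := hne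
  rw [← lat_sub, ← lat_sub, h.lat_eq] at he
  have hmem : ∀ i, i ∈ S → i ∉ S' := fun i hi hi' => by
    rw [← hSS, Finset.mem_compl] at hi'
    exact hi' hi
  have hmem' : ∀ i, i ∉ S' → i ∈ S := fun i hi => by
    rw [← hSS, Finset.mem_compl, not_not] at hi
    exact hi
  -- Inside `S` the exponents `w`, `w'` vanish, so equality modulo the diagonal makes `v' - v`
  -- constant there; outside `S` the roles are exchanged.
  have e1 : v' = v + (v' o - v o) • stepSet S := by
    funext i
    by_cases hi : i ∈ S
    · have := he i o
      simp only [Pi.sub_apply, hw i (hmem i hi), hw o (hmem o ho), hw' i (hmem i hi),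
        hw' o (hmem o ho)] at this
      simp [stepSet, hi]
      omega
    · simp [stepSet, hi, hv i hi, hv' i hi]
  have e2 : lat ε w' = lat ε (w + (v' o - v o) • stepSet S) := by
    rw [h.lat_eq]
    have key : ∀ i, w' i - (w + (v' o - v o) • stepSet S) i = -(v' o - v o) := by
      intro i
      by_cases hi : i ∈ S
      · simp [stepSet, hi, hw i (hmem i hi), hw' i (hmem i hi)]
      · have := he i o
        simp only [Pi.sub_apply, hv i hi, hv' i hi, hw o (hmem o ho), hw' o (hmem o ho)] at this
        simp [stepSet, hi]
        omega
    intro i j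
    rw [key, key]
  refine ⟨v' o - v o, ?_, ?_⟩
  · rw [← lat_smul_stepSet, ← lat_add, ← e1]
  · rw [e2, lat_add, lat_smul_stepSet]

/-- Two contributions to the same coefficient would differ by a move along a diagonal
(`diagonal_of_ratio`), and a boundary meets each diagonal at most once. So the convolution has a
single term. -/
lemma exchangeChar_edge_edge_coeff (h : Generic ε) (hab : a ≠ b) (hcd : c ≠ d) (hS : S = {a, b})
    (hS' : S' = {c, d}) (hSS : Sᶜ = S') (lam : Partition S) (lam' : Partition S') {x y : ℂˣ}
    (h1 : (shapeChar ε lam.1).coeff y ≠ 0)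
    (h2 : (shapeChar ε lam'.1).coeff (y * ((qProd ε S)⁻¹ * x)) ≠ 0) :
    (exchangeChar ε S S' (shapeChar ε lam.1) (shapeChar ε lam'.1)).coeff x =
      (shapeChar ε lam.1).coeff y * (shapeChar ε lam'.1).coeff (y * ((qProd ε S)⁻¹ * x)) := by
  have hcS : c ∉ S := by rw [← Finset.mem_compl, hSS, hS']; simp
  have haS : a ∉ S' := by rw [← hSS, hS]; simp
  rw [exchangeChar_edge_edge (by rw [hS, Finset.card_pair hab]) hSS, point_mul_coeff]
  refine coeff_dual_mul_eq_of_unique fun y' h1' h2' => ?_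
  obtain ⟨v, hy, hv, -⟩ := (h.shapeChar_coeff_pair hab hS hcS lam.2 _).2.2.2.2 h1
  obtain ⟨v', hy', hv', -⟩ := (h.shapeChar_coeff_pair hab hS hcS lam.2 _).2.2.2.2 h1'
  obtain ⟨w, hz, hw, -⟩ := (h.shapeChar_coeff_pair hcd hS' haS lam'.2 _).2.2.2.2 h2
  obtain ⟨w', hz', hw', -⟩ := (h.shapeChar_coeff_pair hcd hS' haS lam'.2 _).2.2.2.2 h2'
  obtain ⟨m, hm, -⟩ := h.diagonal_of_ratio hSS (by rw [hS]; simp) hv hv' hw hw' (by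
    rw [← hz, ← hz', ← hy, ← hy', mul_right_comm, mul_inv_cancel, mul_right_comm, mul_inv_cancel])
  rw [← hy, ← hy'] at hm
  rw [hm] at h1' ⊢
  rw [h.eq_zero_of_diagonal hab hS hcS lam.2 h1 h1', zpow_zero, mul_one]

/-- Boundary coefficients of Young diagrams lie in `{-1, 0, 1}`, so a product is `-1` exactly when
one corner is addable and the other removable. The relation `q_S q_{S'} = 1` absorbs the shifts at
removable corners. -/
lemma pole_edge_edge (h : Generic ε) (hab : a ≠ b) (hcd : c ≠ d) (hS : S = {a, b})
    (hS' : S' = {c, d}) (hSS : Sᶜ = S') (lam : Partition S) (lam' : Partition S') (x : ℂˣ) :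
    -1 ≤ (exchangeChar ε S S' (shapeChar ε lam.1) (shapeChar ε lam'.1)).coeff x ∧
    ((exchangeChar ε S S' (shapeChar ε lam.1) (shapeChar ε lam'.1)).coeff x = -1 ↔
      (∃ s t, Addable lam.1 s ∧ Removable lam'.1 t ∧ x = contentUnit ε t * (contentUnit ε s)⁻¹) ∨
      ∃ s t, Removable lam.1 s ∧ Addable lam'.1 t ∧
        x = contentUnit ε t * (contentUnit ε s)⁻¹) := by
  have hcS : c ∉ S := by rw [← Finset.mem_compl, hSS, hS']; simp
  have haS : a ∉ S' := by rw [← hSS, hS]; simp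
  have hq : qProd ε S * qProd ε S' = 1 := by rw [← hSS, qProd_mul_qProd_compl h]
  have hc : ∀ y, _ := fun y => h.shapeChar_coeff_pair hab hS hcS lam.2 y
  have hc' : ∀ y, _ := fun y => h.shapeChar_coeff_pair hcd hS' haS lam'.2 y
  have e1 : ∀ (s : S → ℕ) (t : S' → ℕ), contentUnit ε s * ((qProd ε S)⁻¹ * x) =
      contentUnit ε t * qProd ε S' ↔ x = contentUnit ε t * (contentUnit ε s)⁻¹ := by
    intro s t
    rw [eq_inv_of_mul_eq_one_right hq, mul_left_comm, mul_comm (contentUnit ε t), mul_right_inj,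
      eq_mul_inv_iff_mul_eq, mul_comm]
  have e2 : ∀ (s : S → ℕ) (t : S' → ℕ), contentUnit ε s * qProd ε S * ((qProd ε S)⁻¹ * x) =
      contentUnit ε t ↔ x = contentUnit ε t * (contentUnit ε s)⁻¹ := by
    intro s t
    rw [mul_assoc, mul_inv_cancel_left, eq_mul_inv_iff_mul_eq, mul_comm]
  have hmul : ∀ y, (shapeChar ε lam.1).coeff y ≠ 0 →
      (shapeChar ε lam'.1).coeff (y * ((qProd ε S)⁻¹ * x)) ≠ 0 → _ := fun y h1 h2 =>
    exchangeChar_edge_edge_coeff h hab hcd hS hS' hSS lam lam' h1 h2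
  have hval : ((∃ s t, Addable lam.1 s ∧ Removable lam'.1 t ∧
      x = contentUnit ε t * (contentUnit ε s)⁻¹) ∨ ∃ s t, Removable lam.1 s ∧ Addable lam'.1 t ∧
        x = contentUnit ε t * (contentUnit ε s)⁻¹) →
      (exchangeChar ε S S' (shapeChar ε lam.1) (shapeChar ε lam'.1)).coeff x = -1 := by
    rintro (⟨s, t, hs, ht, hx⟩ | ⟨s, t, hs, ht, hx⟩)
    · have h1 := (hc (contentUnit ε s)).2.2.1.2 ⟨s, hs, rfl⟩
      have h2 := (hc' (contentUnit ε s * ((qProd ε S)⁻¹ * x))).2.2.2.1.2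
        ⟨t, ht, (e1 s t).2 hx⟩
      rw [hmul (contentUnit ε s) (by rw [h1]; decide) (by rw [h2]; decide), h1, h2]
      rfl
    · have h1 := (hc (contentUnit ε s * qProd ε S)).2.2.2.1.2 ⟨s, hs, rfl⟩
      have h2 := (hc' (contentUnit ε s * qProd ε S * ((qProd ε S)⁻¹ * x))).2.2.1.2
        ⟨t, ht, (e2 s t).2 hx⟩
      rw [hmul (contentUnit ε s * qProd ε S) (by rw [h1]; decide) (by rw [h2]; decide), h1, h2]
      rfl
  by_cases hne : (exchangeChar ε S S' (shapeChar ε lam.1) (shapeChar ε lam'.1)).coeff x = 0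
  · rw [hne]
    refine ⟨by decide, ⟨fun h0 => by omega, fun h0 => ?_⟩⟩
    rw [← hne, hval h0]
  · obtain ⟨y, h1, h2⟩ : ∃ y, (shapeChar ε lam.1).coeff y ≠ 0 ∧
        (shapeChar ε lam'.1).coeff (y * ((qProd ε S)⁻¹ * x)) ≠ 0 := by
      rw [exchangeChar_edge_edge (by rw [hS, Finset.card_pair hab]) hSS, point_mul_coeff] at hne
      exact exists_of_coeff_dual_mul_ne_zero hne
    obtain ⟨l1, l2, hA, hR, -⟩ := hc y
    obtain ⟨l1', l2', hA', hR', -⟩ := hc' (y * ((qProd ε S)⁻¹ * x))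
    have l3 : (shapeChar ε lam.1).coeff y = 1 ∨ (shapeChar ε lam.1).coeff y = -1 := by omega
    have l4 : (shapeChar ε lam'.1).coeff (y * ((qProd ε S)⁻¹ * x)) = 1 ∨
        (shapeChar ε lam'.1).coeff (y * ((qProd ε S)⁻¹ * x)) = -1 := by omega
    refine ⟨?_, fun h0 => ?_, hval⟩
    · rw [hmul y h1 h2]
      rcases l3 with l3 | l3 <;> rcases l4 with l4 | l4 <;> rw [l3, l4] <;> decide
    · rw [hmul y h1 h2] at h0
      rcases l3 with l3 | l3
      · obtain ⟨s, hs, rfl⟩ := hA.1 l3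
        rw [l3, one_mul] at h0
        obtain ⟨t, ht, hx⟩ := hR'.1 h0
        exact Or.inl ⟨s, t, hs, ht, (e1 s t).1 hx⟩
      · obtain ⟨s, hs, rfl⟩ := hR.1 l3
        rw [l3] at h0
        obtain ⟨t, ht, hx⟩ := hA'.1 (by omega)
        exact Or.inr ⟨s, t, hs, ht, (e2 s t).1 hx⟩

/-- The residues cancel when a box is moved from one Young diagram to the other. -/
lemma residue_edge_edge (h : Generic ε) (hab : a ≠ b) (hcd : c ≠ d) (hS : S = {a, b})
    (hS' : S' = {c, d}) (hSS : Sᶜ = S') (lam : Partition S) (lam' : Partition S')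
    {s : S → ℕ} {t : S' → ℕ} (hs : Addable lam.1 s) (ht : Addable lam'.1 t) :
    edgeCoeff ε c lam.1 * edgeCoeff ε a (insert t lam'.1) *
      index (point (contentUnit ε t * (contentUnit ε s)⁻¹)⁻¹ *
        exchangeChar ε S S' (shapeChar ε lam.1) (shapeChar ε (insert t lam'.1))) =
    -(edgeCoeff ε c (insert s lam.1) * edgeCoeff ε a lam'.1 *
      index (point (contentUnit ε t * (contentUnit ε s)⁻¹)⁻¹ *
        exchangeChar ε S S' (shapeChar ε (insert s lam.1)) (shapeChar ε lam'.1))) := by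
  have hcS : c ∉ S := by rw [← Finset.mem_compl, hSS, hS']; simp
  have hdS : d ∉ S := by rw [← Finset.mem_compl, hSS, hS']; simp
  have haS : a ∉ S' := by rw [← hSS, hS]; simp
  have hbS : b ∉ S' := by rw [← hSS, hS]; simp
  have hcard : S.card = 2 := by rw [hS, Finset.card_pair hab]
  have hcard' : S'.card = 2 := by rw [hS', Finset.card_pair hcd]
  have hne : S.Nonempty := Finset.card_pos.1 (by omega)
  have hne' : S'.Nonempty := Finset.card_pos.1 (by omega)
  have hqS : qProd ε S = qUnit ε a * qUnit ε b := by rw [hS, qProd, Finset.prod_pair hab]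
  have hqS' : qProd ε S' = qUnit ε c * qUnit ε d := by rw [hS', qProd, Finset.prod_pair hcd]
  have hPS : adamsChar ε S = (1 - point (qUnit ε a)) * (1 - point (qUnit ε b)) := by
    rw [hS, adamsChar, Finset.prod_pair hab]
  have hPS' : adamsChar ε S' = (1 - point (qUnit ε c)) * (1 - point (qUnit ε d)) := by
    rw [hS', adamsChar, Finset.prod_pair hcd]
  have hSSq : qProd ε S * qProd ε S' = 1 := by rw [← hSS, qProd_mul_qProd_compl h]
  have hq : point (qUnit ε a) * point (qUnit ε b) * (point (qUnit ε c) * point (qUnit ε d)) = 1 := by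
    rw [point_mul, point_mul, point_mul, ← hqS, ← hqS', hSSq, point_one]
  have hdual := dual_adamsChar (ε := ε) S
  rw [hcard, neg_one_sq, one_mul] at hdual
  obtain ⟨y, hy⟩ : ∃ y, y = point (contentUnit ε s) * dual (shapeChar ε lam.1) := ⟨_, rfl⟩
  obtain ⟨y', hy'⟩ : ∃ y', y' = point (contentUnit ε t) * dual (shapeChar ε lam'.1) := ⟨_, rfl⟩
  have hy1 : y.coeff 1 = 1 := by
    rw [hy, coeff_point_mul_dual, inv_one, mul_one]
    exact (h.shapeChar_coeff_pair hab hS hcS lam.2 _).2.2.1.2 ⟨s, hs, rfl⟩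
  have hyc : y.coeff (qUnit ε c) = 0 := by
    rw [hy, coeff_point_mul_dual, qUnit_eq_lat, contentUnit, ← lat_neg, ← lat_add]
    refine shapeChar_coeff_of_not lam.1 h hcS hdS ?_
    simp [boxExp, hcS, hdS, Pi.single_eq_of_ne hcd.symm]
  have hyd : deg y = 1 := by simp [hy, deg_shapeChar hne]
  have hyb' : y'.coeff (qUnit ε b) = 0 := by
    rw [hy', coeff_point_mul_dual, qUnit_eq_lat, contentUnit, ← lat_neg, ← lat_add]
    refine shapeChar_coeff_of_not lam'.1 h haS hbS ?_
    simp [boxExp, haS, hbS, Pi.single_eq_of_ne hab]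
  -- This coefficient sits one diagonal step away from the addable corner `t`, where the boundary
  -- must vanish.
  have hyab' : y'.coeff (qUnit ε a * qUnit ε b) = 0 := by
    rw [hy', coeff_point_mul_dual, ← hqS, inv_eq_of_mul_eq_one_right hSSq]
    by_contra hc
    have := h.eq_zero_of_diagonal hcd hS' haS lam'.2 (x := contentUnit ε t) (m := 1) (by
      rw [(h.shapeChar_coeff_pair hcd hS' haS lam'.2 _).2.2.1.2 ⟨t, ht, rfl⟩]; decide)
      (by rwa [zpow_one])
    omega
  have hyd' : deg y' = 1 := by simp [hy', deg_shapeChar hne']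
  have his := point_mul_inv (contentUnit ε s)
  have hit := point_mul_inv (contentUnit ε t)
  have e1 : point (contentUnit ε t * (contentUnit ε s)⁻¹)⁻¹ *
      exchangeChar ε S S' (shapeChar ε lam.1) (shapeChar ε (insert t lam'.1)) =
      point (qProd ε S) * y * (dual y' - adamsChar ε S') := by
    rw [exchangeChar_edge_edge hcard hSS, hy, hy', shapeChar_insert ht.1, mul_inv, inv_inv,
      ← point_mul, map_mul, dual_dual, dual_point]
    linear_combination (-point (qProd ε S) * point (contentUnit ε s) * dual (shapeChar ε lam.1) *
      adamsChar ε S') * hit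
  have e2 : point (contentUnit ε t * (contentUnit ε s)⁻¹)⁻¹ *
      exchangeChar ε S S' (shapeChar ε (insert s lam.1)) (shapeChar ε lam'.1) =
      point (qProd ε S) * y * dual y' - adamsChar ε S * dual y' := by
    rw [exchangeChar_edge_edge hcard hSS, hy, hy', shapeChar_insert hs.1, mul_inv, inv_inv,
      ← point_mul, map_mul, dual_dual, dual_point, map_sub, map_mul, dual_point]
    linear_combination (-point (contentUnit ε t)⁻¹ * shapeChar ε lam'.1) *
      (point (qProd ε S) * dual (adamsChar ε S) * his + hdual)
  -- The three terms `X`, `Y`, `Z` account for the whole difference of the two residues. Their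
  -- indices `-q_c`, `q_a⁻¹` and `1` convert the prefactor `q_c⁻¹` of one diagram into the `q_a⁻¹`
  -- of the other and supply the sign.
  obtain ⟨X, hX⟩ : ∃ X, X = (1 - point (qUnit ε c)⁻¹) * y := ⟨_, rfl⟩
  obtain ⟨Y, hY⟩ : ∃ Y, Y = point (qUnit ε b) * ((1 - point (qUnit ε a)) * dual y') := ⟨_, rfl⟩
  obtain ⟨Z, hZ⟩ : ∃ Z, Z = point (qUnit ε d) * adamsChar ε {a, c} := ⟨_, rfl⟩
  have hac : a ≠ c := by
    rintro rfl
    exact haS (by simp [hS'])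
  have e3 : (1 - point (qUnit ε c)) * (-(point (qProd ε S) * y) - dual y + adamsChar ε S) +
      (point (qProd ε S) * y * dual y' - adamsChar ε S * dual y') =
      ((1 - point (qUnit ε a)) * (-(point (qProd ε S') * y') - dual y' + adamsChar ε S') +
      point (qProd ε S) * y * (dual y' - adamsChar ε S')) + (X - dual X) + (Y - dual Y) +
      (Z - dual Z) := by
    rw [hX, hY, hZ, hPS, hPS', hqS, hqS', adamsChar, Finset.prod_pair hac]
    simp only [map_mul, map_sub, map_one, dual_point, dual_dual, inv_inv, ← point_mul]
    have ha := point_mul_inv (qUnit ε a)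
    have hb := point_mul_inv (qUnit ε b)
    have hc := point_mul_inv (qUnit ε c)
    have hd := point_mul_inv (qUnit ε d)
    generalize point (qUnit ε a)⁻¹ = ai at *
    generalize point (qUnit ε b)⁻¹ = bi at *
    generalize point (qUnit ε c)⁻¹ = ci at *
    generalize point (qUnit ε d)⁻¹ = di at *
    generalize point (qUnit ε a) = a at *
    generalize point (qUnit ε b) = b at *
    generalize point (qUnit ε c) = c at *
    generalize point (qUnit ε d) = d at *
    -- All inverses are eliminated through `q_1 q_2 q_3 q_4 = 1`, after which the identity is
    -- polynomial.
    have f1 : di = a * b * c := by linear_combination a * b * c * hd - di * hq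
    have f2 : di * ai = b * c := by linear_combination ai * f1 + b * c * ha
    have f3 : di * ci = a * b := by linear_combination ci * f1 + a * b * hc
    have f4 : di * ai * ci = b := by linear_combination ci * f2 + b * hc
    have f5 : ci = a * b * d := by linear_combination a * b * d * hc - ci * hq
    have f6 : bi = a * c * d := by linear_combination a * c * d * hb - bi * hq
    have f7 : ai * bi = c * d := by linear_combination ai * f6 + c * d * ha
    linear_combination y * (hq + f5) + y' * (f6 - f7) + (f1 - f2 - f3 + f4)
  have iX : signedDet X * (-1) ^ X.coeff 1 = -qUnit ε c := by
    rw [hX, signedDet_one_sub_mul, hyd, sub_mul, one_mul, coeff_sub_apply, point_mul_coeff, hy1,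
      inv_inv, mul_one, hyc]
    simp
  have iY : signedDet Y * (-1) ^ Y.coeff 1 = (qUnit ε a)⁻¹ := by
    have : Y.coeff 1 = 0 := by
      rw [hY, sub_mul, one_mul, mul_sub, ← mul_assoc, point_mul, coeff_sub_apply, point_mul_coeff,
        point_mul_coeff, mul_one, mul_one, coeff_dual, coeff_dual, inv_inv, inv_inv, hyb',
        mul_comm (qUnit ε b), hyab', sub_zero]
    rw [this, hY, signedDet_point_mul, signedDet_one_sub_mul, map_mul, deg_dual, hyd']
    simp
  have iZ : signedDet Z * (-1) ^ Z.coeff 1 = 1 := by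
    have hc0 : Z.coeff 1 = 0 := by
      have hn : ∀ v : Fin 4 → ℤ, v b ≠ v d → lat ε v ≠ 1 := fun v hv hv' =>
        hv (h.lat_eq_one.1 hv' b d)
      have hbd : b ≠ d := by
        rintro rfl
        exact hbS (by simp [hS'])
      have hbc : b ≠ c := by
        rintro rfl
        exact hbS (by simp [hS'])
      have had : a ≠ d := by
        rintro rfl
        exact haS (by simp [hS'])
      have e : Z = point (qUnit ε d) - point (qUnit ε d * qUnit ε a) -
          point (qUnit ε d * qUnit ε c) + point (qUnit ε d * qUnit ε a * qUnit ε c) := by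
        rw [hZ, adamsChar, Finset.prod_pair hac]
        simp only [← point_mul]
        ring
      rw [e, coeff_add_apply, coeff_sub_apply, coeff_sub_apply, coeff_point, coeff_point,
        coeff_point, coeff_point, if_neg, if_neg, if_neg, if_neg]
      · rfl
      all_goals
        simp only [qUnit_eq_lat, ← lat_add]
        refine hn _ ?_
        simp [Pi.single_eq_of_ne hbd, Pi.single_eq_of_ne hbc, Pi.single_eq_of_ne hab.symm,
          Pi.single_eq_of_ne had.symm, Pi.single_eq_of_ne hcd.symm]
    rw [hc0, hZ, mul_comm (point _), signedDet_adamsChar_mul (Finset.card_pair hac).ge]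
    simp
  rw [edgeCoeff_insert hcard c hs.1 hy, edgeCoeff_insert hcard' a ht.1 hy', e1, e2]
  generalize (1 - point (qUnit ε c)) * (-(point (qProd ε S) * y) - dual y + adamsChar ε S) = E₁ at *
  generalize point (qProd ε S) * y * dual y' - adamsChar ε S * dual y' = E₄ at *
  generalize (1 - point (qUnit ε a)) * (-(point (qProd ε S') * y') - dual y' + adamsChar ε S') =
    E₂ at *
  generalize point (qProd ε S) * y * (dual y' - adamsChar ε S') = E₃ at *
  have e4 := congrArg index e3
  rw [index_add E₁, index_add _ (Z - dual Z), index_add _ (Y - dual Y), index_add _ (X - dual X),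
    index_add E₂, index_sub_dual, index_sub_dual, index_sub_dual, iX, iY, iZ] at e4
  calc _ = edgeCoeff ε c lam.1 * edgeCoeff ε a lam'.1 * ((qUnit ε a)⁻¹ * (index E₂ * index E₃)) := by
        simp only [mul_assoc]
    _ = -(edgeCoeff ε c lam.1 * edgeCoeff ε a lam'.1 * ((qUnit ε c)⁻¹ *
        (index E₁ * index E₄))) := by
      rw [e4]
      ext
      push_cast
      have := (qUnit ε a).ne_zero
      have := (qUnit ε c).ne_zero
      field_simp
    _ = _ := by
      rw [mul_right_comm (edgeCoeff ε c lam.1) (_ * index E₁)]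
      simp only [mul_assoc]

/-- The matching of the poles of a product of the `qq`-characters of opposite edges: a box is moved
from one Young diagram to the other. -/
def EdgeMatch (ε : Fin 4 → ℂ) (u : ℂˣ) (i j : Partition S × Partition S') : Prop :=
  ∃ s t, Addable i.1.1 s ∧ j.1.1 = insert s i.1.1 ∧ Addable j.2.1 t ∧ i.2.1 = insert t j.2.1 ∧
    u = contentUnit ε t * (contentUnit ε s)⁻¹

/-- At `x' = u⁻¹ x` the points `χ(s) x` and `χ(t) x'` coincide, so it does not matter which of the
two diagrams supplies the factor `A⁻¹`. -/
lemma merge_edgeMatch (V V' : VertexOp) {u : ℂˣ} {i j : Partition S × Partition S'}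
    (hij : EdgeMatch ε u i j) :
    (V.dress opA j.1.1 (logContent ε)).merge (V'.dress opA j.2.1 (logContent ε)) u⁻¹ =
      (V.dress opA i.1.1 (logContent ε)).merge (V'.dress opA i.2.1 (logContent ε)) u⁻¹ := by
  obtain ⟨s, t, hs, h1, ht, h2, hu⟩ := hij
  refine VertexOp.merge_eq (fun n hn => ?_) (by simp) (by simp) ?_ (by simp) (by simp) (by simp)
  · have hs0 := (contentUnit ε s).ne_zero
    have ht0 := (contentUnit ε t).ne_zero
    rw [h1, h2, dress_opA_insert_kappa V hs.1, dress_opA_insert_kappa V' ht.1, hu]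
    push_cast
    have e1 : (contentUnit ε t : ℂ) ^ n * (contentUnit ε t : ℂ) ^ (-n) = 1 := by
      rw [← zpow_add₀ ht0]; simp
    simp only [mul_inv, inv_inv, mul_zpow, inv_zpow', neg_neg]
    linear_combination (contentUnit ε s : ℂ) ^ (-n) * e1
  · rw [dress_opA_c, dress_opA_c, dress_opA_c, dress_opA_c, h1, h2,
      Finset.card_insert_of_notMem hs.1, Finset.card_insert_of_notMem ht.1]
    push_cast
    ring

lemma exchange_edge_edge (h : Generic ε) (hab : a ≠ b) (hcd : c ≠ d) (hS : S = {a, b})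
    (hS' : S' = {c, d}) (hSS : Sᶜ = S') (V V' : VertexOp)
    (hV : ∀ n, V.κ n = 1 / adamsP ε S (-n)) (hV' : ∀ n, V'.κ n = 1 / adamsP ε S' (-n))
    (hp : V.p = 0) (hp' : V.p' = 0) (hd : V.d = 0) (hd' : V.d' = 0)
    (kp : V'.p = 0) (kp' : V'.p' = 0) (kd : V'.d = 0) (kd' : V'.d' = 0)
    (lam : Partition S) (lam' : Partition S') : Exchange ε (-(q ε a * q ε b)) (-1) 1 0
      (V.dress opA lam.1 (logContent ε)) (V'.dress opA lam'.1 (logContent ε))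
      (exchangeChar ε S S' (shapeChar ε lam.1) (shapeChar ε lam'.1)) := by
  have hcard : S.card = 2 := by rw [hS, Finset.card_pair hab]
  have hcard' : S'.card = 2 := by rw [hS', Finset.card_pair hcd]
  have hne : S.Nonempty := Finset.card_pos.1 (by omega)
  have hne' : S'.Nonempty := Finset.card_pos.1 (by omega)
  have hdeg : deg (dual (shapeChar ε lam.1) * shapeChar ε lam'.1) = 1 := by
    rw [map_mul, deg_dual, deg_shapeChar hne, deg_shapeChar hne', one_mul]
  have hdeg' : deg (exchangeChar ε S S' (shapeChar ε lam.1) (shapeChar ε lam'.1)) = 1 := by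
    rw [exchangeChar_edge_edge hcard hSS, map_mul, hdeg, deg_point, one_mul]
  refine ⟨?_, ?_, ?_, ?_, ?_, fun x => (pole_edge_edge h hab hcd hS hS' hSS lam lam' x).1⟩
  · refine h.contraction_exchangeChar ?_ (fun n hn => h.dress_kappa V hV lam.1 n hn)
      (fun n hn => h.dress_kappa V' hV' lam'.1 n hn)
    rw [← hSS]
    exact disjoint_compl_right
  · rw [hdeg']
    simp [hp, hp']
  · simp [kp, kp']
  · rw [hdeg']; rfl
  -- D4 operators do not shift the zero modes, so no phase arises and `C` must be the whole signed
  -- determinant: `-1` from the boundaries times `q_A` from the prefactor. The degree `1` explains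
  -- the factor `x' / x`.
  · have hdet : signedDet (dual (shapeChar ε lam.1) * shapeChar ε lam'.1) = -1 := by
      have e : dual (shapeChar ε lam.1) * shapeChar ε lam'.1 = dual (shapeChar ε lam.1) -
          adamsChar ε S' * (boxChar ε lam'.1 * dual (shapeChar ε lam.1)) := by
        rw [shapeChar, shapeChar]
        ring
      rw [e, signedDet_sub, signedDet_dual, signedDet_shapeChar hcard.ge,
        signedDet_adamsChar_mul hcard'.ge]
      simp
    have hqS : qProd ε S = qUnit ε a * qUnit ε b := by rw [hS, qProd, Finset.prod_pair hab]
    rw [exchangeChar_edge_edge hcard hSS, signedDet_point_mul, hdet, hdeg, hqS]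
    simp [hd, hd', kd, kd']

theorem commuteUpTo_edge_edge (h : Generic ε) (hab : a < b) (hcd : c < d)
    (hdisj : Disjoint ({a, b} : Finset (Fin 4)) {c, d}) :
    CommuteUpTo ε (-(q ε a * q ε b)) (-1) 1 (qqChar ε (.edge a b hab))
      (qqChar ε (.edge c d hcd)) := by
  have hSS : ({a, b} : Finset (Fin 4))ᶜ = {c, d} := by
    revert a b c d
    decide
  have hSS' : ({c, d} : Finset (Fin 4))ᶜ = {a, b} := by
    rw [← hSS, compl_compl]
  have hcS : c ∉ ({a, b} : Finset (Fin 4)) := by rw [← Finset.mem_compl, hSS]; simp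
  have haS : a ∉ ({c, d} : Finset (Fin 4)) := by rw [← Finset.mem_compl, hSS']; simp
  have hZ : ∀ lam, ZD4 ε a b lam = edgeCoeff ε c lam := by
    intro lam
    rw [ZD4_eq hab.ne, hSS, Finset.inf_insert, Finset.inf_singleton, id_eq, id_eq,
      inf_eq_left.2 hcd.le]
  have hZ' : ∀ lam, ZD4 ε c d lam = edgeCoeff ε a lam := by
    intro lam
    rw [ZD4_eq hcd.ne, hSS', Finset.inf_insert, Finset.inf_singleton, id_eq, id_eq,
      inf_eq_left.2 hab.le]
  have hpole : ∀ (i : Partition {a, b} × Partition {c, d}) (u : ℂˣ), _ := fun i u =>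
    (pole_edge_edge h hab.ne hcd.ne rfl rfl hSS i.1 i.2 u).2
  have hratio : ∀ {s s' : ({a, b} : Finset (Fin 4)) → ℕ} {t t' : ({c, d} : Finset (Fin 4)) → ℕ},
      contentUnit ε t * (contentUnit ε s)⁻¹ = contentUnit ε t' * (contentUnit ε s')⁻¹ →
      ∃ m : ℤ, contentUnit ε s' = contentUnit ε s * qProd ε {a, b} ^ m ∧
        contentUnit ε t' = contentUnit ε t * qProd ε {a, b} ^ m := fun {s s' t t'} he =>
    h.diagonal_of_ratio hSS (by simp) (suppIn_boxExp s) (suppIn_boxExp s') (suppIn_boxExp t)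
      (suppIn_boxExp t') he
  have hA : ∀ (lam : Partition {a, b}) s, Addable lam.1 s →
      (shapeChar ε lam.1).coeff (contentUnit ε s) = 1 := fun lam s hs =>
    (h.shapeChar_coeff_pair hab.ne rfl hcS lam.2 _).2.2.1.2 ⟨s, hs, rfl⟩
  have hR : ∀ (lam : Partition {a, b}) s, Removable lam.1 s →
      (shapeChar ε lam.1).coeff (contentUnit ε s * qProd ε {a, b}) = -1 := fun lam s hs =>
    (h.shapeChar_coeff_pair hab.ne rfl hcS lam.2 _).2.2.2.1.2 ⟨s, hs, rfl⟩
  have hdiag : ∀ (lam : Partition {a, b}) (x : ℂˣ) (m : ℤ), (shapeChar ε lam.1).coeff x ≠ 0 →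
      (shapeChar ε lam.1).coeff (x * qProd ε {a, b} ^ m) ≠ 0 → m = 0 := fun lam x m h1 h2 =>
    h.eq_zero_of_diagonal hab.ne rfl hcS lam.2 h1 h2
  have hsrc : ∀ (i : Partition {a, b} × Partition {c, d}) u, (∃ s t, Addable i.1.1 s ∧
      Removable i.2.1 t ∧ u = contentUnit ε t * (contentUnit ε s)⁻¹) ↔
        ∃ j, EdgeMatch ε u i j := by
    intro i u
    constructor
    · rintro ⟨s, t, hs, ht, hu⟩
      exact ⟨(i.1.add s hs, i.2.remove t ht), s, t, hs, rfl, ht.addable_erase,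
        (Finset.insert_erase ht.1).symm, hu⟩
    · rintro ⟨j, s, t, hs, -, ht, h2, hu⟩
      exact ⟨s, t, hs, h2 ▸ ht.removable_insert, hu⟩
  have htgt : ∀ (i : Partition {a, b} × Partition {c, d}) u, (∃ s t, Removable i.1.1 s ∧
      Addable i.2.1 t ∧ u = contentUnit ε t * (contentUnit ε s)⁻¹) ↔
        ∃ j, EdgeMatch ε u j i := by
    intro i u
    constructor
    · rintro ⟨s, t, hs, ht, hu⟩
      exact ⟨(i.1.remove s hs, i.2.add t ht), s, t, hs.addable_erase,
        (Finset.insert_erase hs.1).symm, ht, rfl, hu⟩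
    · rintro ⟨j, s, t, hs, h1, ht, -, hu⟩
      exact ⟨s, t, h1 ▸ hs.removable_insert, ht, hu⟩
  suffices hs : CommuteUpTo ε (-(q ε a * q ε b)) ((-1 : ℤ) : ℂ) ((1 : ℤ) : ℂ)
      (qqChar ε (.edge a b hab)) (qqChar ε (.edge c d hcd)) by
    rwa [Int.cast_neg, Int.cast_one] at hs
  refine commuteUpTo_of_matching (T := qqChar ε (.edge a b hab)) (T' := qqChar ε (.edge c d hcd))
    h.sum (τ := 0) (P := 0) (P' := 0)
    (fun i : Partition {a, b} × Partition {c, d} =>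
      exchangeChar ε {a, b} {c, d} (shapeChar ε i.1.1) (shapeChar ε i.2.1))
    ?_ ?_ ?_ (EdgeMatch ε) ?_ ?_ ?_ ?_ ?_ ?_ ?_ ?_
  · intro i
    exact exchange_edge_edge h hab.ne hcd.ne rfl rfl hSS (opX ε a b) (opX ε c d) (fun _ => rfl)
      (fun _ => rfl) rfl rfl rfl rfl rfl rfl rfl rfl i.1 i.2
  · intro j
    exact dress_opA_p (opX ε c d) j.1
  · intro j
    exact dress_opA_p' (opX ε c d) j.1
  · intro u (i : Partition {a, b} × Partition {c, d})
    exact (hpole i u).trans (or_congr (hsrc i u) (htgt i u))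
  · rintro u (i : Partition {a, b} × Partition {c, d}) (j : Partition {a, b} × Partition {c, d})
      (j' : Partition {a, b} × Partition {c, d}) ⟨s, t, hs, h1, ht, h2, hu⟩
      ⟨s', t', hs', h1', ht', h2', hu'⟩
    -- Two choices of boxes for the same `u` lie on common diagonals; the boundary of the first
    -- diagram meets its diagonal once, so they coincide.
    obtain ⟨m, hm, hm'⟩ := hratio (hu.symm.trans hu')
    have h0 : m = 0 := hdiag i.1 (contentUnit ε s) m (by rw [hA _ _ hs]; decide)
      (by rw [← hm, hA _ _ hs']; decide)
    rw [h0, zpow_zero, mul_one] at hm hm'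
    obtain rfl := h.contentUnit_injective hcS hm
    obtain rfl := h.contentUnit_injective haS hm'
    refine Prod.ext (Subtype.ext (h1.trans h1'.symm)) (Subtype.ext ?_)
    rw [← Finset.erase_insert ht.1, ← h2, h2', Finset.erase_insert ht'.1]
  · rintro u (i : Partition {a, b} × Partition {c, d}) (i' : Partition {a, b} × Partition {c, d})
      (j : Partition {a, b} × Partition {c, d}) ⟨s, t, hs, h1, ht, h2, hu⟩
      ⟨s', t', hs', h1', ht', h2', hu'⟩
    obtain ⟨m, hm, hm'⟩ := hratio (hu.symm.trans hu')
    have r1 : Removable j.1.1 s := h1 ▸ hs.removable_insert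
    have r2 : Removable j.1.1 s' := h1' ▸ hs'.removable_insert
    have h0 : m = 0 := hdiag j.1 (contentUnit ε s * qProd ε {a, b}) m (by rw [hR _ _ r1]; decide)
      (by rw [mul_right_comm, ← hm, hR _ _ r2]; decide)
    rw [h0, zpow_zero, mul_one] at hm hm'
    obtain rfl := h.contentUnit_injective hcS hm
    obtain rfl := h.contentUnit_injective haS hm'
    refine Prod.ext (Subtype.ext ?_) (Subtype.ext (h2.trans h2'.symm))
    rw [← Finset.erase_insert hs.1, ← h1, h1', Finset.erase_insert hs'.1]
  · intro u (i : Partition {a, b} × Partition {c, d}) j k hij hki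
    obtain ⟨s, t, hs, ht, hu⟩ := (hsrc i u).2 ⟨j, hij⟩
    obtain ⟨s', t', hs', ht', hu'⟩ := (htgt i u).2 ⟨k, hki⟩
    obtain ⟨m, hm, hm'⟩ := hratio (hu.symm.trans hu')
    -- An addable and a removable corner would lie on one diagonal, hence be the same boundary
    -- point, which cannot have both coefficients `1` and `-1`.
    have e : contentUnit ε s' * qProd ε {a, b} = contentUnit ε s * qProd ε {a, b} ^ (m + 1) := by
      rw [hm, zpow_add_one, mul_assoc]
    have r1 := hA _ _ hs
    have r2 := hR _ _ hs'
    have h0 := hdiag i.1 (contentUnit ε s) (m + 1) (by rw [r1]; decide)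
      (by rw [← e, r2]; decide)
    rw [e, h0, zpow_zero, mul_one, r1] at r2
    exact absurd r2 (by decide)
  · rintro u (i : Partition {a, b} × Partition {c, d}) (j : Partition {a, b} × Partition {c, d})
      ⟨s, t, hs, h1, ht, h2, -⟩
    change (i.1.1.card : ℤ) + i.2.1.card = (j.1.1.card : ℤ) + j.2.1.card
    rw [h1, h2, Finset.card_insert_of_notMem hs.1, Finset.card_insert_of_notMem ht.1]
    push_cast
    ring
  · intro u i j hij
    exact merge_edgeMatch (opX ε a b) (opX ε c d) hij
  · rintro u (i : Partition {a, b} × Partition {c, d}) (j : Partition {a, b} × Partition {c, d})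
      ⟨s, t, hs, h1, ht, h2, rfl⟩
    have key := congrArg Units.val
      (residue_edge_edge h hab.ne hcd.ne rfl rfl hSS i.1 j.2 hs ht)
    have hr : ∀ (M : Character) (u : ℂˣ) (i : Partition {a, b} × Partition {c, d}),
        residue (qqChar ε (.edge a b hab)) (qqChar ε (.edge c d hcd)) M u i =
        edgeCoeff ε c i.1.1 * edgeCoeff ε a i.2.1 * index (point u⁻¹ * M) := by
      intro M u i
      change ZD4 ε a b i.1.1 * ZD4 ε c d i.2.1 * (Complex.exp (_ *
        ((opX ε a b).dress opA i.1.1 (logContent ε)).d + _ *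
        ((opX ε a b).dress opA i.1.1 (logContent ε)).d') * _) = _
      rw [hZ, hZ', dress_opA_d, dress_opA_d']
      simp [opX]
    rw [hr, hr, h1, h2]
    simp only [Units.val_mul, Units.val_neg] at key
    rw [key]
    ring
  · intro N u
    refine ((Partition.finite_card_le {a, b} N.toNat).prod
      (Partition.finite_card_le {c, d} N.toNat)).subset ?_
    rintro (i : Partition {a, b} × Partition {c, d}) ⟨hi, -⟩
    change (i.1.1.card : ℤ) + i.2.1.card = N at hi
    refine ⟨?_, ?_⟩
    · change i.1.1.card ≤ _
      omega
    · change i.2.1.card ≤ _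
      omega

end EdgeEdge

end

section

open Character

/-! ### Rationality of the vacuum expectation values -/

/-- The power series of a rational function. -/
def IsRational (f : PowerSeries ℂ) : Prop :=
  ∃ P Q : Polynomial ℂ, P ≠ 0 ∧ (P : PowerSeries ℂ) * f = Q

lemma isRational_coe (Q : Polynomial ℂ) : IsRational Q :=
  ⟨1, Q, one_ne_zero, by simp⟩

lemma IsRational.add {f g : PowerSeries ℂ} (hf : IsRational f) (hg : IsRational g) :
    IsRational (f + g) := by
  obtain ⟨P, Q, hP, h⟩ := hf
  obtain ⟨P', Q', hP', h'⟩ := hg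
  refine ⟨P * P', P' * Q + P * Q', mul_ne_zero hP hP', ?_⟩
  push_cast
  rw [← h, ← h']
  ring

lemma isRational_sum {ι : Type*} (s : Finset ι) (f : ι → PowerSeries ℂ)
    (h : ∀ i ∈ s, IsRational (f i)) : IsRational (∑ i ∈ s, f i) := by
  refine Finset.sum_induction _ _ (fun _ _ => IsRational.add) ?_ h
  simpa using isRational_coe 0

lemma IsRational.of_C_mul {f : PowerSeries ℂ} {c : ℂ} (hc : c ≠ 0)
    (h : IsRational (PowerSeries.C c * f)) : IsRational f := by
  obtain ⟨P, Q, hP, h⟩ := h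
  refine ⟨Polynomial.C c * P, Q, mul_ne_zero (by simpa using hc) hP, ?_⟩
  rw [← h]
  push_cast
  ring

lemma constantCoeff_series (M : Character) : PowerSeries.constantCoeff (series M) = 1 :=
  (isExp_series M).1

lemma series_add (M N : Character) : series (M + N) = series M * series N := by
  simp [series, prod_add]

/-- Over `ℂ` a polynomial splits: a root `a ≠ 0` gives a factor `1 - a⁻¹ w` up to a constant, and
the root `0` gives a power of the variable. -/
lemma exists_series_of_polynomial {P : Polynomial ℂ} (hP : P ≠ 0) :
    ∃ (c : ℂ) (k : ℕ) (M : Character), c ≠ 0 ∧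
      (P : PowerSeries ℂ) = PowerSeries.C c * PowerSeries.X ^ k * series M := by
  have hroots : ∀ s : Multiset ℂ, ∃ (c : ℂ) (k : ℕ) (M : Character), c ≠ 0 ∧
      (((s.map fun a => Polynomial.X - Polynomial.C a).prod : Polynomial ℂ) : PowerSeries ℂ) =
        PowerSeries.C c * PowerSeries.X ^ k * series M := by
    intro s
    induction s using Multiset.induction_on with
    | empty => exact ⟨1, 0, 0, one_ne_zero, by simp [series]⟩
    | cons a s ih =>
      obtain ⟨c, k, M, hc, h⟩ := ih
      rw [Multiset.map_cons, Multiset.prod_cons, Polynomial.coe_mul, h]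
      by_cases ha : a = 0
      · refine ⟨c, k + 1, M, hc, ?_⟩
        simp only [ha, map_zero, sub_zero, Polynomial.coe_X]
        ring
      · refine ⟨-a * c, k, M + point (Units.mk0 a ha)⁻¹, mul_ne_zero (neg_ne_zero.2 ha) hc, ?_⟩
        rw [series_add_point]
        have h1 : PowerSeries.C a * PowerSeries.C a⁻¹ = (1 : PowerSeries ℂ) := by
          rw [← map_mul, mul_inv_cancel₀ ha, map_one]
        simp only [Polynomial.coe_sub, Polynomial.coe_X, Polynomial.coe_C, map_mul, map_neg,
          Units.val_inv_eq_inv_val, Units.val_mk0]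
        linear_combination (-PowerSeries.C c * PowerSeries.X ^ k * series M * PowerSeries.X) * h1
  obtain ⟨c, k, M, hc, h⟩ := hroots P.roots
  refine ⟨P.leadingCoeff * c, k, M, mul_ne_zero (by simpa using hP) hc, ?_⟩
  conv_lhs => rw [(IsAlgClosed.splits P).eq_prod_roots]
  rw [Polynomial.coe_mul, h, Polynomial.coe_C, map_mul]
  ring

/-- A rational power series with constant coefficient `1` is a finite product
`∏ (1 - v w) ^ M v`. -/
lemma IsRational.exists_series {f : PowerSeries ℂ} (h : IsRational f)
    (hf : PowerSeries.constantCoeff f = 1) : ∃ M : Character, f = series M := by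
  obtain ⟨P, Q, hP, h⟩ := h
  have hf0 : f ≠ 0 := by
    rintro rfl
    simp at hf
  have hP' : (P : PowerSeries ℂ) ≠ 0 := by simpa using hP
  have hQ : Q ≠ 0 := by
    rintro rfl
    rw [Polynomial.coe_zero] at h
    exact mul_ne_zero hP' hf0 h
  obtain ⟨c, k, M, hc, e⟩ := exists_series_of_polynomial hP
  obtain ⟨c', k', M', hc', e'⟩ := exists_series_of_polynomial hQ
  rw [e, e'] at h
  -- Comparing orders and then constant coefficients removes the powers of the variable and the
  -- scalars from numerator and denominator.
  have ho : ∀ (c : ℂ) (k : ℕ) (g : PowerSeries ℂ), c ≠ 0 → PowerSeries.constantCoeff g = 1 →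
      (PowerSeries.C c * PowerSeries.X ^ k * g).order = (k : ℕ∞) := by
    intro c k g hc hg
    rw [PowerSeries.order_mul, PowerSeries.order_mul, PowerSeries.order_X_pow]
    rw [PowerSeries.order_zero_of_unit, PowerSeries.order_zero_of_unit]
    · simp
    · rw [PowerSeries.isUnit_iff_constantCoeff, hg]
      exact isUnit_one
    · rw [PowerSeries.isUnit_iff_constantCoeff]
      simpa using hc
  have hk : k = k' := by
    have h1 := ho c k (series M * f) hc (by rw [map_mul, constantCoeff_series, hf, one_mul])
    rw [← mul_assoc, h, ho c' k' _ hc' (constantCoeff_series _)] at h1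
    exact_mod_cast h1.symm
  have hX : (PowerSeries.X : PowerSeries ℂ) ^ k ≠ 0 := pow_ne_zero _ PowerSeries.X_ne_zero
  have h2 : PowerSeries.C c * (series M * f) = PowerSeries.C c' * series M' := by
    refine mul_left_cancel₀ hX ?_
    rw [← hk] at h
    linear_combination h
  have hcc : c = c' := by
    have := congrArg PowerSeries.constantCoeff h2
    simpa [constantCoeff_series, hf] using this
  have h3 : series M * f = series M' := by
    refine mul_left_cancel₀ (a := PowerSeries.C c) (by simpa using hc) ?_
    rw [h2, hcc]
  refine ⟨M' - M, ?_⟩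
  have h4 : series M * series (M' - M) = series M' := by
    rw [← series_add, add_sub_cancel]
  refine mul_left_cancel₀ (a := series M) ?_ (h3.trans h4.symm)
  intro h0
  have := constantCoeff_series M
  rw [h0] at this
  simp at this

/-- The vacuum expectation value of an operator on the Fock space. -/
def vacuum (A : Module.End ℂ Fock) : ℂ := MvPolynomial.constantCoeff (A (fun _ _ => 1) 0 0)

/-- The vacuum expectation values of the coefficients of `x ^ (-n) x' ^ (β + n)`. -/
def vacuumSeries (β : ℂ) (G : FormalDist) : PowerSeries ℂ :=
  PowerSeries.mk fun n => vacuum (G (-n) (β + n))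

lemma vacuum_zero : vacuum 0 = 0 := by simp [vacuum]

lemma vacuum_sub_smul (A B : Module.End ℂ Fock) (c : ℂ) :
    vacuum (A - c • B) = vacuum A - c * vacuum B := by
  simp [vacuum, MvPolynomial.smul_eq_C_mul]

lemma vacuumSeries_sum {ι : Type*} (β : ℂ) (s : Finset ι) (G : ι → FormalDist) :
    vacuumSeries β (∑ i ∈ s, G i) = ∑ i ∈ s, vacuumSeries β (G i) := by
  ext n
  simp only [vacuumSeries, PowerSeries.coeff_mk, map_sum, vacuum, Finset.sum_apply,
    LinearMap.sum_apply]

/-- Being annihilated by a power of `x' - z x` is a linear recursion with constant coefficients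
along an antidiagonal of exponents, so `(X - z)^m` times the series is a polynomial. -/
lemma isRational_vacuumSeries {z : ℂ} {G : FormalDist} (h : SupportedAt z G) (β : ℂ) :
    IsRational (vacuumSeries β G) := by
  obtain ⟨m, hm⟩ := h
  suffices ∃ Q : Polynomial ℂ, (((Polynomial.X - Polynomial.C z) ^ m : Polynomial ℂ) :
      PowerSeries ℂ) * vacuumSeries β G = Q by
    obtain ⟨Q, hQ⟩ := this
    exact ⟨_, Q, pow_ne_zero _ (Polynomial.X_sub_C_ne_zero z), hQ⟩
  induction m generalizing β G with
  | zero =>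
    refine ⟨0, ?_⟩
    rw [Function.iterate_zero, id_eq] at hm
    ext n
    simp [hm, vacuumSeries, vacuum_zero]
  | succ m ih =>
    obtain ⟨Q, hQ⟩ := ih (G := mulLinear z G) (β := β + 1) hm
    -- Each factor `x' - z x` acts as `X - z`, up to the boundary term at `n = 0` and a shift of the
    -- antidiagonal.
    have key : (PowerSeries.X - PowerSeries.C z) * vacuumSeries β G =
        PowerSeries.X * vacuumSeries (β + 1) (mulLinear z G) +
          PowerSeries.C (-z * vacuum (G 0 β)) := by
      ext n
      rw [sub_mul, map_sub, map_add, PowerSeries.coeff_C_mul, PowerSeries.coeff_C]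
      rcases n with _ | n
      · simp [vacuumSeries]
      · rw [PowerSeries.coeff_succ_X_mul, PowerSeries.coeff_succ_X_mul, if_neg (by omega)]
        simp only [vacuumSeries, PowerSeries.coeff_mk, mulLinear, vacuum_sub_smul]
        push_cast
        have e1 : β + 1 + (n : ℂ) - 1 = β + n := by ring
        have e2 : -(n : ℂ) - 1 = -(n + 1) := by ring
        have e3 : β + 1 + (n : ℂ) = β + (n + 1) := by ring
        rw [e1, e2, e3, add_zero]
    refine ⟨Polynomial.X * Q + (Polynomial.X - Polynomial.C z) ^ m *
      Polynomial.C (-z * vacuum (G 0 β)), ?_⟩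
    push_cast at hQ ⊢
    rw [← hQ, pow_succ, mul_assoc, key]
    ring

/-! ### The vacuum expectation value of a product -/

lemma annihilationCoeff_one (ε : Fin 4 → ℂ) (κ : ℤ → ℂ) (j : ℕ) :
    annihilationCoeff ε κ j 1 = if j = 0 then 1 else 0 := by
  rw [annihilationCoeff_apply, map_one, Polynomial.coeff_one]

lemma oscMode_one (ε : Fin 4 → ℂ) (κ : ℤ → ℂ) (m : ℤ) : oscMode ε κ m 1 = creationCoeff κ m := by
  rw [oscMode_eq_sum ε κ m 1 1]
  · simp [annihilationCoeff_one]
  · intro j hj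
    rw [annihilationCoeff_one, if_neg (by omega)]

lemma constantCoeff_creationCoeff (κ : ℤ → ℂ) (k : ℤ) :
    MvPolynomial.constantCoeff (creationCoeff κ k) = if k = 0 then 1 else 0 := by
  have h : (creation κ).map MvPolynomial.constantCoeff = 1 := by
    refine ((isExp_creation κ).map MvPolynomial.constantCoeff).unique ?_
    convert IsExp.one (S := ℂ) using 1
    funext i
    simp
  rcases lt_or_ge k 0 with hk | hk
  · rw [creationCoeff_of_neg κ hk, map_zero, if_neg hk.ne]
  · lift k to ℕ using hk
    rw [creationCoeff_natCast, ← PowerSeries.coeff_map, h, PowerSeries.coeff_one]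
    simp

/-- Only the term in which the whole degree `n` created by the second operator is contracted with
the first has a constant part. -/
lemma constantCoeff_oscMode_oscMode (ε : Fin 4 → ℂ) (κ κ' : ℤ → ℂ) (n : ℕ) :
    MvPolynomial.constantCoeff (oscMode ε κ (-n) (oscMode ε κ' n 1)) =
      PowerSeries.coeff n (contraction fun n => κ n * κ' (-n) * adamsP ε Finset.univ n) := by
  rw [oscMode_one, oscMode_eq_sum ε κ _ _ (n + 1), map_sum, Finset.sum_eq_single n]
  · rw [annihilationCoeff_creationCoeff]
    simp [constantCoeff_creationCoeff, MvPolynomial.smul_eq_C_mul]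
  · intro j _ hj
    rw [map_mul, constantCoeff_creationCoeff, if_neg (by omega), zero_mul]
  · intro h
    simp at h
  · intro j hj
    rw [annihilationCoeff_creationCoeff, creationCoeff_of_neg _ (by omega), smul_zero]

/-- The vacuum expectation value of `V(x) V'(x') - f(x, x') V'(x') V(x)` is, up to finitely many
terms, the contraction of `V` and `V'`. -/
lemma exists_vacuumSeries_twistedComm (ε : Fin 4 → ℂ) (C μ ν : ℂ) (V V' : VertexOp) :
    ∃ (β c : ℂ) (Q : Polynomial ℂ), c ≠ 0 ∧ PowerSeries.C c *
      contraction (fun n => V.κ n * V'.κ (-n) * adamsP ε Finset.univ n) =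
        vacuumSeries β (twistedComm ε C μ ν V V') + Q := by
  -- Beyond `N` the operator `V`, acting first in the opposite order, would have to produce a
  -- negative power from the vacuum, which gives zero.
  obtain ⟨N, hN⟩ := exists_nat_gt (-(μ + (V.p * V'.d + V.p' * V'.d')).re)
  -- At the origin `V` shifts the zero modes by `(V.d, V.d')`, so this is the exponent from which
  -- the modes of `V'` are integral, and `c` is its zero-mode factor there.
  refine ⟨V'.p * V.d + V'.p' * V.d', Complex.exp (V'.c * V.d + V'.c' * V.d'),
    PowerSeries.trunc N (PowerSeries.mk fun n : ℕ => C * vacuum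
      (V'.mode ε (V'.p * V.d + V'.p' * V.d' + n - ν) * V.mode ε (-n - μ))),
    Complex.exp_ne_zero _, ?_⟩
  ext n
  rw [PowerSeries.coeff_C_mul, map_add, Polynomial.coeff_coe, PowerSeries.coeff_trunc, vacuumSeries,
    PowerSeries.coeff_mk, PowerSeries.coeff_mk, twistedComm, vacuum_sub_smul]
  have h1 : vacuum (V.mode ε (-n) * V'.mode ε (V'.p * V.d + V'.p' * V.d' + n)) =
      Complex.exp (V'.c * V.d + V'.c' * V.d') * PowerSeries.coeff n
        (contraction fun n => V.κ n * V'.κ (-n) * adamsP ε Finset.univ n) := by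
    rw [vacuum, Module.End.mul_apply, V.mode_apply ε (m := -n) (by simp),
      V'.mode_apply ε (m := n) (by simp), (oscMode ε V.κ _).map_smul, MvPolynomial.smul_eq_C_mul,
      MvPolynomial.smul_eq_C_mul, map_mul, map_mul, constantCoeff_oscMode_oscMode]
    simp
  rw [h1]
  split_ifs with hn
  · ring
  · have h2 : vacuum (V'.mode ε (V'.p * V.d + V'.p' * V.d' + n - ν) * V.mode ε (-n - μ)) = 0 := by
      have : ∀ t s, t = V'.d → s = V'.d' → V.mode ε (-n - μ) (fun _ _ => 1) t s = 0 := by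
        rintro t s rfl rfl
        by_cases hm : ∃ m : ℤ, -(n : ℂ) - μ = V.p * V'.d + V.p' * V'.d' + m
        · obtain ⟨m, hm⟩ := hm
          rw [V.mode_apply ε hm, oscMode_one, creationCoeff_of_neg, smul_zero]
          have h3 := congrArg Complex.re hm
          simp only [Complex.sub_re, Complex.neg_re, Complex.natCast_re, Complex.add_re,
            Complex.intCast_re] at h3
          simp only [Complex.add_re] at hN
          have h4 : (N : ℝ) ≤ n := by exact_mod_cast not_lt.1 hn
          have h5 : (m : ℝ) < 0 := by linarith
          exact_mod_cast h5
        · exact V.mode_apply_eq_zero ε hm _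
      rw [vacuum, Module.End.mul_apply]
      by_cases hm : ∃ m : ℤ, V'.p * V.d + V'.p' * V.d' + n - ν = V'.p * 0 + V'.p' * 0 + m
      · obtain ⟨m, hm⟩ := hm
        rw [V'.mode_apply ε hm, this _ _ (zero_add _) (zero_add _)]
        simp
      · rw [V'.mode_apply_eq_zero ε hm]
        simp
    rw [h2]
    ring

/-- If `V(x) V'(x') - f(x, x') V'(x') V(x)` is a finite sum of delta functions, then the contraction
of `V` and `V'` is a rational function. -/
lemma exists_character_of_sum_supportedAt {ε : Fin 4 → ℂ} {C μ ν : ℂ} {V V' : VertexOp}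
    {D : ℂ →₀ FormalDist} (hD : ∀ z, SupportedAt z (D z)) {r : ℂ} (hr : r ≠ 0)
    (h : r • twistedComm ε C μ ν V V' = D.sum fun _ g => g) :
    ∃ M : Character, ∀ n : ℕ, n ≠ 0 → V.κ n * V'.κ (-n) * adamsP ε Finset.univ n = ev n M := by
  obtain ⟨β, c, Q, hc, e⟩ := exists_vacuumSeries_twistedComm ε C μ ν V V'
  have h1 : PowerSeries.C r * vacuumSeries β (twistedComm ε C μ ν V V') =
      vacuumSeries β (r • twistedComm ε C μ ν V V') := by
    ext n
    simp [vacuumSeries, vacuum, MvPolynomial.smul_eq_C_mul]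
  have h2 : IsRational (vacuumSeries β (twistedComm ε C μ ν V V')) := by
    refine IsRational.of_C_mul hr ?_
    rw [h1, h, Finsupp.sum, vacuumSeries_sum]
    exact isRational_sum _ _ fun z _ => isRational_vacuumSeries (hD z) β
  have h3 := IsRational.of_C_mul hc (e ▸ h2.add (isRational_coe Q))
  obtain ⟨M, hM⟩ := h3.exists_series (isExp_contraction _).1
  refine ⟨M, fun n hn => ?_⟩
  obtain ⟨i, rfl⟩ := Nat.exists_eq_succ_of_ne_zero hn
  have h4 := isExp_contraction fun n => V.κ n * V'.κ (-n) * adamsP ε Finset.univ n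
  have h5 := isExp_series M
  rw [← hM] at h5
  -- A series determines its logarithmic derivative, so equality of the products gives equality of
  -- the exponents back.
  have h6 : ∀ {a b : ℕ → ℂ} {E : PowerSeries ℂ}, IsExp a E → IsExp b E → a = b := by
    intro a b E ha hb
    have hE : E ≠ 0 := by
      rintro rfl
      simpa using ha.1
    have := mul_right_cancel₀ hE (ha.2.symm.trans hb.2)
    funext n
    simpa using congrArg (PowerSeries.coeff n) this
  have h7 := congrFun (h6 h4 h5) i
  simpa using h7

end

section

open Character

/-! ### Faces with a common vertex -/

/-- Characters are determined by their evaluations at positive powers. -/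
lemma Character.ext_ev {M N : Character} (h : ∀ n : ℕ, n ≠ 0 → ev n M = ev n N) : M = N := by
  -- Dedekind's independence applies to the functions `n ↦ v ^ n`. Only positive powers are given,
  -- so the coefficients are weighted by the nonzero factor `v`.
  have hli := linearIndependent_monoidHom (Multiplicative ℕ) ℂ
  have hinj : Function.Injective fun v : ℂˣ => powersHom ℂ (v : ℂ) := fun v w hvw =>
    Units.ext ((powersHom ℂ).injective hvw)
  have hli' := (hli.comp _ hinj)
  rw [← sub_eq_zero]
  have hev : ∀ (K : Character) (n : ℕ), ev n K =
      ∑ v ∈ K.coeff.support, (K.coeff v : ℂ) * (v : ℂ) ^ n := by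
    intro K n
    change (MonoidAlgebra.lift ℤ ℂ ℂˣ ((Units.coeHom ℂ).comp (zpowGroupHom (n : ℤ)))) K = _
    rw [MonoidAlgebra.lift_apply, Finsupp.sum]
    refine Finset.sum_congr rfl fun v _ => ?_
    simp
  have h0 : ∀ n : ℕ,
      ∑ v ∈ (M - N).coeff.support, ((M - N).coeff v : ℂ) * (v : ℂ) ^ (n + 1) = 0 := by
    intro n
    rw [← hev, map_sub, h _ (Nat.succ_ne_zero n), sub_self]
  have h1 := linearIndependent_iff'.1 hli' (M - N).coeff.support
    (fun v => ((M - N).coeff v : ℂ) * v) (by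
      funext n
      simp only [Finset.sum_apply, Pi.smul_apply, Function.comp_apply, smul_eq_mul, Pi.zero_apply]
      rw [← h0 n.toAdd]
      refine Finset.sum_congr rfl fun v _ => ?_
      rw [powersHom_apply, pow_succ]
      ring)
  ext v
  by_contra hv
  have := h1 v (Finsupp.mem_support_iff.2 hv)
  rw [mul_eq_zero] at this
  rcases this with h | h
  · exact hv (by exact_mod_cast h)
  · exact v.ne_zero h

/-- `1 - g` is not a zero divisor if `g` has infinite order. -/
lemma one_sub_single_mem_nonZeroDivisors {G : Type*} [CommGroup G] {g : G}
    (hg : ∀ n : ℕ, n ≠ 0 → g ^ n ≠ 1) :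
    (1 - MonoidAlgebra.single g 1 : MonoidAlgebra ℤ G) ∈ nonZeroDivisors (MonoidAlgebra ℤ G) := by
  rw [mem_nonZeroDivisors_iff_right]
  intro M hM
  have h1 : ∀ x, M.coeff (g * x) = M.coeff x := by
    intro x
    have h2 : MonoidAlgebra.single g 1 * M = M := by
      rw [mul_sub, mul_one, sub_eq_zero] at hM
      rw [mul_comm]
      exact hM.symm
    conv_lhs => rw [← h2]
    rw [MonoidAlgebra.coeff_single_mul_apply]
    simp
  have h2 : ∀ (n : ℕ) x, M.coeff (g ^ n * x) = M.coeff x := by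
    intro n x
    induction n with
    | zero => simp
    | succ n ih => rw [pow_succ', mul_assoc, h1, ih]
  ext x
  by_contra hx
  -- An element killed by `1 - g` has constant coefficients along the infinite orbits of `g`, which
  -- finite support forbids unless it is zero.
  refine Set.infinite_of_injective_forall_mem (f := fun n : ℕ => g ^ n * x) ?_ (fun n => ?_)
    (Finset.finite_toSet M.coeff.support)
  · intro m n hmn
    have hmn' : g ^ m = g ^ n := mul_right_cancel hmn
    wlog hlt : m ≤ n generalizing m n
    · exact (this hmn.symm hmn'.symm (le_of_not_ge hlt)).symm
    obtain ⟨k, rfl⟩ := Nat.exists_eq_add_of_le hlt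
    rw [pow_add, left_eq_mul] at hmn'
    by_contra hne
    exact hg k (by omega) hmn'
  · rw [Finset.mem_coe, Finsupp.mem_support_iff, h2]
    exact hx

/-- The quotient of `ℂˣ` by the powers of `q_a`. -/
def CosetGroup (ε : Fin 4 → ℂ) (a : Fin 4) : Type := ℂˣ ⧸ Subgroup.zpowers (qUnit ε a)

instance (ε : Fin 4 → ℂ) (a : Fin 4) : CommGroup (CosetGroup ε a) :=
  inferInstanceAs (CommGroup (ℂˣ ⧸ Subgroup.zpowers (qUnit ε a)))

/-- The class of a point modulo the powers of `q_a`. -/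
def coset (ε : Fin 4 → ℂ) (a : Fin 4) : ℂˣ →* CosetGroup ε a :=
  QuotientGroup.mk' (Subgroup.zpowers (qUnit ε a))

lemma coset_eq_one {ε : Fin 4 → ℂ} {a : Fin 4} {v : ℂˣ} :
    coset ε a v = 1 ↔ ∃ k : ℤ, qUnit ε a ^ k = v :=
  QuotientGroup.eq_one_iff (N := Subgroup.zpowers (qUnit ε a)) v

/-- The image of a character in the group ring of `ℂˣ` modulo the powers of `q_a`. -/
def reduce (ε : Fin 4 → ℂ) (a : Fin 4) : Character →+* MonoidAlgebra ℤ (CosetGroup ε a) :=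
  MonoidAlgebra.mapDomainRingHom ℤ (coset ε a)

variable {ε : Fin 4 → ℂ} {a : Fin 4}

lemma reduce_point (v : ℂˣ) :
    reduce ε a (point v) = MonoidAlgebra.single (coset ε a v) 1 := by
  simp [reduce, point]

lemma reduce_point_zpow (k : ℤ) : reduce ε a (point (qUnit ε a ^ k)) = 1 := by
  rw [reduce_point, coset_eq_one.2 ⟨k, rfl⟩]
  rfl

lemma reduce_adamsChar {S : Finset (Fin 4)} (ha : a ∈ S) : reduce ε a (adamsChar ε S) = 0 := by
  rw [adamsChar, map_prod]
  refine Finset.prod_eq_zero ha ?_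
  have := reduce_point_zpow (ε := ε) (a := a) 1
  rw [zpow_one] at this
  rw [map_sub, map_one, this, sub_self]

lemma reduce_dual_adamsChar {S : Finset (Fin 4)} (ha : a ∈ S) :
    reduce ε a (dual (adamsChar ε S)) = 0 := by
  rw [adamsChar, map_prod, map_prod]
  refine Finset.prod_eq_zero ha ?_
  have := reduce_point_zpow (ε := ε) (a := a) (-1)
  rw [zpow_neg_one] at this
  rw [map_sub, map_one, dual_point, map_sub, map_one, this, sub_self]

/-- For `i ≠ a` the class of `q_i` modulo the powers of `q_a` still has infinite order, by
genericity. -/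
lemma Generic.reduce_adamsChar_mem_nonZeroDivisors (h : Generic ε) {S : Finset (Fin 4)}
    (ha : a ∉ S) :
    reduce ε a (adamsChar ε S) ∈ nonZeroDivisors _ := by
  rw [adamsChar, map_prod]
  refine prod_mem fun i hi => ?_
  rw [map_sub, map_one, reduce_point]
  refine one_sub_single_mem_nonZeroDivisors fun n hn h1 => ?_
  rw [← map_pow, coset_eq_one] at h1
  obtain ⟨k, hk⟩ := h1
  have hia : i ≠ a := fun e => ha (e ▸ hi)
  have hk' : lat ε (Pi.single a k) = lat ε (Pi.single i (n : ℤ)) := by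
    rw [lat_single, lat_single, zpow_natCast]
    exact hk
  rw [h.lat_eq] at hk'
  have hj : ∀ a i : Fin 4, ∃ j, j ≠ a ∧ j ≠ i := by decide
  obtain ⟨j, hja, hji⟩ := hj a i
  have := hk' i j
  simp [hia, hja, hji] at this
  exact hn this

/-- The contraction of two operators attached to faces with a common vertex is not rational. -/
lemma Generic.not_rational_contraction (h : Generic ε) {A B : Finset (Fin 4)} (hA : a ∈ A)
    (hB : a ∈ B) {u u' : Character} {κ κ' : ℤ → ℂ}
    (hκ : ∀ n ≠ 0, κ n = ev (-n) u / adamsP ε A (-n))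
    (hκ' : ∀ n ≠ 0, κ' n = ev (-n) u' / adamsP ε B (-n))
    (hu : reduce ε a (dual u) = 1) (hu' : reduce ε a u' = 1) {M : Character}
    (hM : ∀ n : ℕ, n ≠ 0 → κ n * κ' (-n) * adamsP ε Finset.univ n = ev n M) : False := by
  have h1 : M * adamsChar ε A * adamsChar ε B =
      (-1) ^ A.card * point (qProd ε A) * (dual u * u') * adamsChar ε Finset.univ := by
    refine Character.ext_ev fun n hn => ?_
    have hn' : (n : ℤ) ≠ 0 := by exact_mod_cast hn
    have h2 := h.adamsP_ne_zero A (neg_ne_zero.2 hn')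
    have h3 := h.adamsP_ne_zero B hn'
    rw [map_mul, map_mul, ← hM n hn, hκ _ hn', hκ' _ (neg_ne_zero.2 hn'), neg_neg, ev_adamsChar,
      ev_adamsChar, adamsP_neg A n]
    simp only [map_mul, map_pow, map_neg, map_one, ev_point, ev_adamsChar, ev_dual]
    field_simp
  -- The factor `1 - q_a` occurs once in `P_4` and in each of `P_A` and `P_B`. After cancelling it
  -- once, `P_B` still vanishes under reduction while the rest of `P_4` does not.
  have hsplit : ∀ S : Finset (Fin 4), a ∈ S → adamsChar ε S =
      adamsChar ε (S.erase a) * (1 - point (qUnit ε a)) := fun S hS => by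
    rw [adamsChar, adamsChar, Finset.prod_erase_mul _ _ hS]
  have hnz : (1 - point (qUnit ε a) : Character) ∈ nonZeroDivisors Character :=
    one_sub_single_mem_nonZeroDivisors fun n hn => by
      rw [← zpow_natCast]
      exact h.qUnit_zpow_ne_one a (by exact_mod_cast hn)
  have h1' : M * adamsChar ε (A.erase a) * adamsChar ε B * (1 - point (qUnit ε a)) =
      (-1) ^ A.card * point (qProd ε A) * (dual u * u') * adamsChar ε (Finset.univ.erase a) *
        (1 - point (qUnit ε a)) := by
    linear_combination h1 - M * adamsChar ε B * hsplit A hA +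
      (-1) ^ A.card * point (qProd ε A) * (dual u * u') * hsplit _ (Finset.mem_univ a)
  have h2 : reduce ε a ((-1) ^ A.card * point (qProd ε A)) *
      reduce ε a (adamsChar ε (Finset.univ.erase a)) = 0 := by
    have e := congrArg (reduce ε a) ((mul_cancel_right_mem_nonZeroDivisors hnz).1 h1')
    rw [map_mul _ _ (adamsChar ε B), reduce_adamsChar hB, mul_zero, map_mul,
      map_mul _ _ (dual u * u'), map_mul _ (dual u), hu, hu', mul_one, mul_one] at e
    exact e.symm
  have h3 := (mem_nonZeroDivisors_iff_right.1 (h.reduce_adamsChar_mem_nonZeroDivisors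
    (Finset.notMem_erase a Finset.univ))) _ h2
  have h4 : (-1) ^ A.card * point (qProd ε A) * ((-1) ^ A.card * point (qProd ε A)⁻¹) =
      (1 : Character) := by
    rw [mul_mul_mul_comm, point_mul, mul_inv_cancel, point_one, mul_one, ← mul_pow]
    norm_num
  have h5 := congrArg (reduce ε a) h4
  rw [map_mul, h3, zero_mul, map_one] at h5
  exact zero_ne_one h5

/-- A sum with only finitely many remainders is impossible if no member is a sum of delta functions,
unless the family is finite with more than one member, or empty. -/
lemma SumsToZero.exists_eq_sum {ι : Type} {G : ι → FormalDist} (h : SumsToZero G)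
    (hι : Infinite ι ∨ Nonempty ι ∧ Subsingleton ι) :
    ∃ (i : ι) (D : ℂ →₀ FormalDist), (∀ z, SupportedAt z (D z)) ∧ G i = D.sum fun _ g => g := by
  obtain ⟨R, D, hG, hD, hfin, hR, -⟩ := h
  obtain ⟨i, hi⟩ : ∃ i, R i = 0 := by
    -- An infinite family has a member without remainder; in a one-element family the only remainder
    -- equals the sum, which is zero.
    rcases hι with hι | ⟨⟨i⟩, hι⟩
    · obtain ⟨i, hi⟩ := hfin.exists_notMem
      exact ⟨i, not_not.1 hi⟩
    · refine ⟨i, ?_⟩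
      rwa [finsum_eq_single R i fun j hj => absurd (Subsingleton.elim j i) hj] at hR
  exact ⟨i, D i, hD i, by rw [hG, hi, zero_add]⟩

instance (S : Finset (Fin 4)) : Inhabited (Partition S) :=
  ⟨⟨∅, by simpa using isLowerSet_empty⟩⟩

lemma infinite_partition {S : Finset (Fin 4)} (hS : S.Nonempty) : Infinite (Partition S) := by
  classical
  refine Infinite.of_injective (fun n : ℕ => (⟨Finset.Iic fun _ => n, by
    rw [Finset.coe_Iic]; exact isLowerSet_Iic _⟩ : Partition S)) ?_
  intro m n hmn
  have h1 : (Finset.Iic fun _ : S => m) = Finset.Iic fun _ => n := congrArg Subtype.val hmn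
  have h2 : Set.Iic (fun _ : S => m) = Set.Iic fun _ => n := by
    rw [← Finset.coe_Iic, h1, Finset.coe_Iic]
  obtain ⟨i, hi⟩ := hS
  exact congrFun (Set.Iic_injective h2) ⟨i, hi⟩

/-- A screening charge has terms of every level, so it completes any summand of the other factor to
total level `0`. For two sums over partitions only the pair of empty ones has level `0`. -/
lemma infinite_or_subsingleton_level (i j : Face) :
    Infinite {x : (qqChar ε i).I × (qqChar ε j).I //
      (qqChar ε i).level x.1 + (qqChar ε j).level x.2 = 0} ∨
    Nonempty {x : (qqChar ε i).I × (qqChar ε j).I //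
      (qqChar ε i).level x.1 + (qqChar ε j).level x.2 = 0} ∧
    Subsingleton {x : (qqChar ε i).I × (qqChar ε j).I //
      (qqChar ε i).level x.1 + (qqChar ε j).level x.2 = 0} := by
  have hinf : ∀ i : Face, Infinite (qqChar ε i).I := by
    rintro (a | ⟨a, b, h⟩ | a)
    · exact inferInstanceAs (Infinite ℤ)
    · exact infinite_partition (by simp)
    · refine infinite_partition ⟨a + 1, ?_⟩
      fin_cases a <;> decide
  have hleft : ∀ a j, Infinite {x : (qqChar ε (.vertex a)).I × (qqChar ε j).I //
      (qqChar ε (.vertex a)).level x.1 + (qqChar ε j).level x.2 = 0} := by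
    intro a j
    have := hinf j
    refine Infinite.of_injective (fun y : (qqChar ε j).I =>
      ⟨((-(qqChar ε j).level y : ℤ), y), neg_add_cancel _⟩) fun y y' h => ?_
    exact congrArg (fun x => x.1.2) h
  have hright : ∀ a j, Infinite {x : (qqChar ε j).I × (qqChar ε (.vertex a)).I //
      (qqChar ε j).level x.1 + (qqChar ε (.vertex a)).level x.2 = 0} := by
    intro a j
    have := hinf j
    refine Infinite.of_injective (fun y : (qqChar ε j).I =>
      ⟨(y, (-(qqChar ε j).level y : ℤ)), add_neg_cancel _⟩) fun y y' h => ?_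
    exact congrArg (fun x => x.1.1) h
  have hpart : ∀ S S' : Finset (Fin 4), Nonempty {x : Partition S × Partition S' //
        (x.1.1.card : ℤ) + (x.2.1.card : ℤ) = 0} ∧
      Subsingleton {x : Partition S × Partition S' //
        (x.1.1.card : ℤ) + (x.2.1.card : ℤ) = 0} := by
    intro S S'
    have h0 : ∀ {T : Finset (Fin 4)} (lam : Partition T), lam.1.card = 0 → lam = default :=
      fun lam h => Subtype.ext (Finset.card_eq_zero.1 h)
    refine ⟨⟨⟨(default, default), rfl⟩⟩, ⟨?_⟩⟩
    rintro ⟨⟨x, y⟩, h⟩ ⟨⟨x', y'⟩, h'⟩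
    dsimp only at h h'
    rw [Subtype.mk.injEq, h0 x (by omega), h0 y (by omega), h0 x' (by omega), h0 y' (by omega)]
  rcases i with a | ⟨a, b, h⟩ | a
  · exact Or.inl (hleft a j)
  all_goals
    rcases j with a' | ⟨a', b', h'⟩ | a'
    · exact Or.inl (hright _ _)
    · exact Or.inr (hpart _ _)
    · exact Or.inr (hpart _ _)

/-- This is the uniform description on which the obstruction rests: boundary characters reduce to
`1` because `P_S` vanishes modulo `q_a` for `a ∈ S`, and powers of `q_a` reduce to `1` trivially. -/
lemma Generic.exists_face_character (h : Generic ε) (i : Face) (x : (qqChar ε i).I) :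
    (qqChar ε i).coeff x ≠ 0 ∧ ∃ u : Character,
      (∀ n ≠ 0, ((qqChar ε i).op x).κ n = ev (-n) u / adamsP ε i.verts (-n)) ∧
      ∀ a ∈ i.verts, reduce ε a u = 1 ∧ reduce ε a (dual u) = 1 := by
  have hshape : ∀ {S : Finset (Fin 4)} (lam : Partition S), ∀ a ∈ S,
      reduce ε a (shapeChar ε lam.1) = 1 ∧ reduce ε a (dual (shapeChar ε lam.1)) = 1 := by
    intro S lam a ha
    simp only [shapeChar, map_sub, map_mul, map_one, reduce_adamsChar ha, reduce_dual_adamsChar ha,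
      zero_mul, sub_zero, and_self]
  rcases i with a | ⟨a, b, hab⟩ | a
  · refine ⟨one_ne_zero, point (qUnit ε a ^ (show ℤ from x)), fun n _ => opS_kappa a x n, ?_⟩
    intro b hb
    obtain rfl : b = a := by simpa [Face.verts] using hb
    exact ⟨reduce_point_zpow _, by rw [dual_point, ← zpow_neg]; exact reduce_point_zpow _⟩
  · refine ⟨?_, shapeChar ε x.1, fun n hn => h.dress_kappa (opX ε a b) (fun _ => rfl) x.1 n hn,
      hshape x⟩
    change ZD4 ε a b x.1 ≠ 0
    rw [ZD4_eq hab.ne]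
    exact Units.ne_zero _
  · refine ⟨?_, shapeChar ε x.1, fun n hn => h.dress_kappa (opW ε a) (fun _ => rfl) x.1 n hn,
      hshape x⟩
    change ZD6 ε a x.1 ≠ 0
    rw [ZD6_eq h]
    exact Units.ne_zero _

/-- The `qq`-characters of two faces with a common vertex do not commute. -/
theorem Generic.not_commuteUpTo (h : Generic ε) {i j : Face} (hij : ¬ Disjoint i.verts j.verts)
    (C μ ν : ℂ) : ¬ CommuteUpTo ε C μ ν (qqChar ε i) (qqChar ε j) := by
  intro hc
  obtain ⟨x, D, hD, hx⟩ := (hc 0).exists_eq_sum (infinite_or_subsingleton_level i j)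
  obtain ⟨a, ha, ha'⟩ := Finset.not_disjoint_iff.1 hij
  obtain ⟨h1, u, hu, hu1⟩ := h.exists_face_character i x.1.1
  obtain ⟨h2, u', hu', hu1'⟩ := h.exists_face_character j x.1.2
  obtain ⟨M, hM⟩ := exists_character_of_sum_supportedAt hD (mul_ne_zero h1 h2) hx
  exact h.not_rational_contraction ha ha' hu hu' (hu1 a ha).2 (hu1' a ha').1 hM

end

section

/-! ### Symmetry of the commutation relations -/

/-- The negative of a formal distribution with `x` and `x'` exchanged. -/
def negSwap : FormalDist ≃+ FormalDist where
  toFun G α β := -G β α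
  invFun G α β := -G β α
  left_inv G := by
    funext α β
    exact neg_neg _
  right_inv G := by
    funext α β
    exact neg_neg _
  map_add' G H := by
    funext α β
    exact neg_add _ _

/-- Exchanging the variables turns `x' - z x` into `x - z x' = -z (x' - z⁻¹ x)`, so the support
moves from `z` to `z⁻¹`. -/
lemma mulLinear_smul_negSwap {z : ℂ} (hz : z ≠ 0) (r : ℂ) (G : FormalDist) :
    mulLinear z⁻¹ (r • negSwap G) = (-(z⁻¹ * r)) • negSwap (mulLinear z G) := by
  funext α β
  change r • -G (β - 1) α - z⁻¹ • r • -G β (α - 1) =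
    (-(z⁻¹ * r)) • -(G β (α - 1) - z • G (β - 1) α)
  have : z⁻¹ * r * z = r := by field_simp
  rw [neg_smul_neg, smul_sub, smul_smul, smul_smul, this]
  module

lemma SupportedAt.swapped {z : ℂ} {G : FormalDist} (h : SupportedAt z G) :
    SupportedAt z⁻¹ (negSwap G) := by
  obtain ⟨m, hm⟩ := h
  -- At `z = 0`, where `z⁻¹ = 0` too, multiplication by `x'` is injective, so such a distribution is
  -- zero.
  by_cases hz : z = 0
  · subst hz
    have : ∀ (m : ℕ) (G : FormalDist), (mulLinear 0)^[m] G = 0 → G = 0 := by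
      intro m
      induction m with
      | zero => exact fun G h => h
      | succ m ih =>
        intro G h
        have h1 := ih _ h
        funext α β
        have h2 := congrFun (congrFun h1 α) (β + 1)
        simpa [mulLinear] using h2
    rw [this m G hm, map_zero]
    exact supportedAt_zero _
  · have : ∀ (m : ℕ) (r : ℂ) (G : FormalDist), (mulLinear z)^[m] G = 0 →
        (mulLinear z⁻¹)^[m] (r • negSwap G) = 0 := by
      intro m
      induction m with
      | zero =>
        intro r G h
        rw [Function.iterate_zero, id_eq] at h ⊢
        rw [h, map_zero, smul_zero]
      | succ m ih =>
        intro r G h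
        rw [Function.iterate_succ_apply, mulLinear_smul_negSwap hz]
        exact ih _ _ h
    refine ⟨m, ?_⟩
    rw [← one_smul ℂ (negSwap G)]
    exact this m 1 G hm

lemma SumsToZero.swapped {ι κ : Type} {G : ι → FormalDist} (h : SumsToZero G) (e : κ ≃ ι) :
    SumsToZero fun k => negSwap (G (e k)) := by
  obtain ⟨R, D, hG, hD, hfin, hR, hz⟩ := h
  refine ⟨fun k => negSwap (R (e k)), fun k =>
    ((D (e k)).equivMapDomain (Equiv.inv ℂ)).mapRange negSwap (map_zero _),
    fun k => ?_, fun k z => ?_, ?_, ?_, fun z => ⟨?_, ?_⟩⟩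
  · dsimp only
    rw [hG, map_add, Finsupp.sum_mapRange_index (fun _ => rfl), Finsupp.sum_equivMapDomain,
      map_finsuppSum]
  · have := (hD (e k) z⁻¹).swapped
    rwa [inv_inv] at this
  · refine (hfin.preimage e.injective.injOn).subset fun k hk h0 => hk ?_
    dsimp only
    rw [h0, map_zero]
  · rw [finsum_comp_equiv e (f := fun i => negSwap (R i)), ← AddEquiv.map_finsum, hR,
      map_zero]
  · refine ((hz z⁻¹).1.preimage e.injective.injOn).subset fun k hk h0 => hk ?_
    change negSwap (D (e k) z⁻¹) = 0
    rw [h0, map_zero]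
  · change ∑ᶠ k, negSwap (D (e k) z⁻¹) = 0
    rw [finsum_comp_equiv e (f := fun i => negSwap (D i z⁻¹)), ← AddEquiv.map_finsum,
      (hz z⁻¹).2, map_zero]

/-- For `f = 1` the commutator is antisymmetric under exchanging the two operators together with
their variables. -/
lemma CommuteUpTo.symm {ε : Fin 4 → ℂ} {T T' : OpSum} (h : CommuteUpTo ε 1 0 0 T T') :
    CommuteUpTo ε 1 0 0 T' T := by
  intro N
  let e : {i : T'.I × T.I // T'.level i.1 + T.level i.2 = N} ≃
      {i : T.I × T'.I // T.level i.1 + T'.level i.2 = N} :=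
    (Equiv.prodComm _ _).subtypeEquiv fun i => by
      rw [add_comm]
      rfl
  have := (h N).swapped e
  convert this using 2 with i
  funext α β
  change (T'.coeff i.1.1 * T.coeff i.1.2) •
      (_ * _ - (1 : ℂ) • (_ * _)) = -((T.coeff i.1.2 * T'.coeff i.1.1) •
      ((T.op i.1.2).mode ε β * (T'.op i.1.1).mode ε α -
        (1 : ℂ) • ((T'.op i.1.1).mode ε (α - 0) * (T.op i.1.2).mode ε (β - 0))))
  rw [sub_zero, sub_zero, one_smul, one_smul, mul_comm (T.coeff _),
    ← neg_sub]
  exact smul_neg _ _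

end

end GaugeOrigami

open GaugeOrigami in
theorem mainTheorem1 (ε : Fin 4 → ℂ) (hsum : ∑ a, ε a = 0)
    (hgen : ∀ m : Fin 4 → ℤ, ∏ a, GaugeOrigami.q ε a ^ m a = 1 → ∀ a b, m a = m b) :
    (∀ i j : GaugeOrigami.Face,
      (∃ C μ ν : ℂ, C ≠ 0 ∧
        GaugeOrigami.CommuteUpTo ε C μ ν (GaugeOrigami.qqChar ε i) (GaugeOrigami.qqChar ε j)) ↔
      Disjoint i.verts j.verts) ∧
    (∀ a b : Fin 4, a ≠ b →
      GaugeOrigami.CommuteUpTo ε 1 0 0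
        (GaugeOrigami.qqChar ε (.vertex a)) (GaugeOrigami.qqChar ε (.vertex b))) ∧
    (∀ (a b : Fin 4) (h : a < b) (c : Fin 4), c ∉ ({a, b} : Finset (Fin 4)) →
      GaugeOrigami.CommuteUpTo ε 1 0 0
        (GaugeOrigami.qqChar ε (.edge a b h)) (GaugeOrigami.qqChar ε (.vertex c))) ∧
    (∀ a : Fin 4,
      GaugeOrigami.CommuteUpTo ε 1 0 0
        (GaugeOrigami.qqChar ε (.facet a)) (GaugeOrigami.qqChar ε (.vertex a))) ∧
    (∀ (a b : Fin 4) (h : a < b) (c d : Fin 4) (h' : c < d),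
      Disjoint ({a, b} : Finset (Fin 4)) {c, d} →
      GaugeOrigami.CommuteUpTo ε (-(GaugeOrigami.q ε a * GaugeOrigami.q ε b)) (-1) 1
        (GaugeOrigami.qqChar ε (.edge a b h)) (GaugeOrigami.qqChar ε (.edge c d h'))) := by
  have h : Generic ε := ⟨hsum, hgen⟩
  refine ⟨fun i j => ⟨?_, fun hij => ?_⟩, fun a b hab => commuteUpTo_vertex_vertex h hab,
    fun a b hab c hc => commuteUpTo_edge_vertex h hab hc, fun a => commuteUpTo_facet_vertex h a,
    fun a b hab c d hcd hdisj => commuteUpTo_edge_edge h hab hcd hdisj⟩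
  · rintro ⟨C, μ, ν, -, hc⟩
    by_contra hij
    exact h.not_commuteUpTo hij C μ ν hc
  · have hone : ∀ {T T' : OpSum}, CommuteUpTo ε 1 0 0 T T' →
        ∃ C μ ν : ℂ, C ≠ 0 ∧ CommuteUpTo ε C μ ν T T' := fun h => ⟨1, 0, 0, one_ne_zero, h⟩
    -- Among four vertices a facet meets every edge and every other facet, so these combinations
    -- never have disjoint faces.
    have hfe : ∀ a b c : Fin 4, b < c → ¬ Disjoint ({a}ᶜ : Finset (Fin 4)) {b, c} := by decide
    have hff : ∀ a b : Fin 4, ¬ Disjoint ({a}ᶜ : Finset (Fin 4)) {b}ᶜ := by decide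
    rcases i with a | ⟨a, b, hab⟩ | a <;> rcases j with c | ⟨c, d, hcd⟩ | c <;>
      simp only [Face.verts] at hij
    · exact hone (commuteUpTo_vertex_vertex h (Finset.disjoint_singleton.1 hij))
    · exact hone (commuteUpTo_edge_vertex h hcd (Finset.disjoint_singleton_left.1 hij)).symm
    · obtain rfl : a = c := by simpa using hij
      exact hone (commuteUpTo_facet_vertex h a).symm
    · exact hone (commuteUpTo_edge_vertex h hab (Finset.disjoint_singleton_right.1 hij))
    · exact ⟨_, _, _, neg_ne_zero.2 (mul_ne_zero (Complex.exp_ne_zero _) (Complex.exp_ne_zero _)),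
        commuteUpTo_edge_edge h hab hcd hij⟩
    · exact absurd hij.symm (hfe c a b hab)
    · obtain rfl : c = a := by simpa using hij
      exact hone (commuteUpTo_facet_vertex h c)
    · exact absurd hij (hfe a c d hcd)
    · exact absurd hij (hff a c)
end
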